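/- Setting. Let $K$ be an infinite field, $\Gamma$ a finite quiver, $K\Gamma$ its path algebra (where $qp$ means "$q$ after $p$"), and $I\subseteq K\Gamma$ an admissible ideal, i.e. $I$ is a two-sided ideal contained in the span of the paths of length $\ge 2$ and containing all paths of length $\ge m$ for some $m\ge 2$. Put $\Lambda=K\Gamma/I$, with Jacobson radical $J$; vertices $e$ of $\Gamma$ are identified with idempotents of $\Lambda$. A left $\Lambda$-module is *uniserial* if it is nonzero, of finite length, and its submodules form a chain; $\Lambda$ has *finite uniserial type* if there are only finitely many uniserial left $\Lambda$-modules up to isomorphism. A path $p$ of length $l$ is a *mast* of a uniserial module $U$ if $U$ has length $l+1$ and $pU\neq 0$; it is a *mast* if it is a mast of some uniserial left module. For a sequence $\mathbb S=(S(0),\dots,S(l))$ of simple left modules, $U$ *has composition series $\mathbb S$* if $U$ is uniserial of length $l+1$ and $J^iU/J^{i+1}U\cong S(i)$ for $0\le i\le l$. A *top element* of $M$ is an $x\in M\setminus JM$ with $x=ex$ for some vertex $e$. A *right subpath* of a path $p$ is a path $u$ with $p=u'u$ for some path $u'$. A *detour* on $p$ is a pair $(\alpha,u)$ where $u$ is a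 right subpath of $p$, $\alpha$ is an arrow such that $\alpha u$ is a path which is not a right subpath of $p$, and some right subpath of $p$ longer than $u$ ends in the end vertex of $\alpha$; let $v_i(\alpha,u)$, $i\in I(\alpha,u)$, be all such longer right subpaths, and $X_i(\alpha,u)$ corresponding variables. If $p$ is a mast, the detour is a *halyard* on $p$ if $\alpha ux\ne0$ for some uniserial $U$ with mast $p$ and some top element $x$ of $U$; a halyard $(\alpha,u)$, with $u$ ending in the vertex $e$, is *circular* if there are a cycle $c:e\to e$ of positive length such that $\alpha cu$ is a right subpath of $p$, a uniserial $U$ with mast $p$, and a top element $x$ of $U$ with $\Lambda\alpha ux=\Lambda\alpha cux$. For a path $p$ starting in $a$, the variety $V_p$ is the vanishing locus, in the affine space over $K$ with coordinates $X_i(\alpha,u)$, of the polynomials obtained as follows: for $z\in I$, the paths occurring in $z$ that start in $a$ are reduced, from the right and repeatedly, by the substitutions $\alpha u\mapsto\sum_i X_i(\alpha,u)v_i(\alpha,u)$ for detours $(\alpha,u)$ on $p$, and $\alpha u\mapsto 0$ whenever $u$ is a right subpath of $p$ such that $\alpha u$ is neither a right subpath of $p$ nor belongs to a detour; the polynomials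 are the coefficients of the right subpaths of $p$ in the resulting combination. For a sequence $\mathbb S=(S(0),\dots,S(l))$ of simple modules, $V_{\mathbb S}$ is the disjoint union of the $V_p$ over all paths $p$ of length $l$ passing consecutively through the vertices $e(0),\dots,e(l)$ with $e(i)S(i)\ne0$. Isomorphisms of varieties are given by mutually inverse polynomial maps. **Theorem 3.3.** (I) If $\Lambda$ has finite uniserial type, then the following condition (N) holds: whenever $\alpha:e\to e'$ is an arrow and $p:e\to e'$ is a mast of positive length, $p\in K\Gamma\alpha\cup\alpha K\Gamma$. (II) Condition (N) implies: (a) $\Gamma$ has no double arrows (at most one arrow $e\to e'$ for any vertices $e,e'$). Hence each uniserial left $\Lambda$-module has a unique mast; for every sequence $\mathbb S$ of simple modules at most one path $p$ contributes to $V_{\mathbb S}$ (so that $V_{\mathbb S}=V_p$, or $V_{\mathbb S}=\varnothing$ if there is none); and the varieties $V_{\mathbb S}$ are determined by the isomorphism type of $\Lambda$: if $\varphi:\Lambda\to\Lambda'=K\Gamma'/I'$ is an isomorphism of $K$-algebras, with $\Gamma'$ a finite quiver and $I'$ admissible, and $\mathbb S'$ is a sequence of simple $\Lambda'$-modules corresponding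 termwise to $\mathbb S$ under $\varphi$, then there is a bijection between the paths contributing to $V_{\mathbb S}$ and those contributing to $V_{\mathbb S'}$ under which the varieties $V_p$ are isomorphic. (b) All halyards on masts of uniserial left $\Lambda$-modules are circular. In particular, if $\mathbb S$ is a sequence of pairwise non-isomorphic simple modules, there is, up to isomorphism, at most one uniserial module with composition series $\mathbb S$. (c) If $\gamma$ is a loop at a vertex $e$ and $p:e\to e$ is a mast, then $p=\gamma^m$ for some $m\ge0$. In coordinate-free terms: for a simple left module $S$, if there is a uniserial module $W$ of length $2$ with $\operatorname{top}W\cong\operatorname{soc}W\cong S$ (which is equivalent to $\operatorname{Ext}^1_\Lambda(S,S)\neq0$), and if $U$ is any uniserial module of length $l\ge2$ with $\operatorname{top}U\cong\operatorname{soc}U\cong S$, then $J^iU/J^{i+2}U\cong W$ for all $0\le i\le l-2$. (d) If $l\ge1$ and $\mathbb S=(S(0),\dots,S(l))$ is a sequence of simple left $\Lambda$-modules such that $V_{(S(1),\dots,S(l))}$ is finite, then there are, up to isomorphism, only finitely many uniserial left $\Lambda$-modules with composition series $\mathbb S$. -/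

import Mathlib

universe u

noncomputable section

/-! ### The path algebra of a quiver -/

/-- The set of all paths of a quiver, with start and end vertex recorded: `⟨a, b, p⟩` stands for
the path `p : a → b`. -/
abbrev AllPaths (V : Type u) [Quiver.{u} V] : Type u := Σ a b : V, Quiver.Path a b

/-- The `K`-vector space `KΓ` with basis the set of all paths of the quiver `Γ` on `V`. -/
def PathAlgebra (K V : Type u) [Field K] [Quiver.{u} V] : Type u := AllPaths V →₀ K

namespace PathAlgebra

variable {K V : Type u} [Field K] [Quiver.{u} V]

instance : AddCommGroup (PathAlgebra K V) := inferInstanceAs (AddCommGroup (AllPaths V →₀ K))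

instance : Module K (PathAlgebra K V) := inferInstanceAs (Module K (AllPaths V →₀ K))

variable (K V) in
/-- The basis of `KΓ` consisting of the paths. -/
def pathBasis : Module.Basis (AllPaths V) K (PathAlgebra K V) :=
  ⟨LinearEquiv.refl K (AllPaths V →₀ K)⟩

variable (K) in
/-- A path, viewed as an element of the path algebra. -/
def ofPath {a b : V} (p : Quiver.Path a b) : PathAlgebra K V := pathBasis K V ⟨a, b, p⟩

open Classical in
variable (K) in
/-- The product `q p` of two paths is `q` after `p` if `p` ends where `q` starts, and `0`
otherwise. -/
def mulPaths : AllPaths V → AllPaths V → PathAlgebra K V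
  | ⟨c, d, q⟩, ⟨_, b, p⟩ =>
    if h : c = b then ofPath K (p.comp (h ▸ q : Quiver.Path b d)) else 0

lemma mulPaths_comp {a b c : V} (p : Quiver.Path a b) (q : Quiver.Path b c) :
    mulPaths K (⟨b, c, q⟩ : AllPaths V) ⟨a, b, p⟩ = ofPath K (p.comp q) := by
  simp [mulPaths]

lemma mulPaths_of_ne {a b c d : V} (p : Quiver.Path a b) (q : Quiver.Path c d) (h : c ≠ b) :
    mulPaths K (⟨c, d, q⟩ : AllPaths V) ⟨a, b, p⟩ = 0 := by
  simp [mulPaths, h]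

variable (K V) in
/-- The bilinear extension of the product of paths. -/
def mulHom : PathAlgebra K V →ₗ[K] PathAlgebra K V →ₗ[K] PathAlgebra K V :=
  (pathBasis K V).constr K fun x => (pathBasis K V).constr K fun y => mulPaths K x y

lemma mulHom_ofPath {a b c d : V} (q : Quiver.Path c d) (p : Quiver.Path a b) :
    mulHom K V (ofPath K q) (ofPath K p) = mulPaths K ⟨c, d, q⟩ ⟨a, b, p⟩ := by
  rw [mulHom, ofPath, ofPath, Module.Basis.constr_basis, Module.Basis.constr_basis]

/-- Linear maps on the path algebra which agree on all paths are equal. -/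
lemma linearMap_ext {M : Type*} [AddCommMonoid M] [Module K M] {f g : PathAlgebra K V →ₗ[K] M}
    (h : ∀ (a b : V) (p : Quiver.Path a b), f (ofPath K p) = g (ofPath K p)) : f = g :=
  (pathBasis K V).ext fun x => h x.1 x.2.1 x.2.2

lemma mulHom_assoc (x y z : PathAlgebra K V) :
    mulHom K V (mulHom K V x y) z = mulHom K V x (mulHom K V y z) := by
  have h : ∀ (a b : V) (p : Quiver.Path a b) (c d : V) (q : Quiver.Path c d) (e f : V)
      (r : Quiver.Path e f),
      mulHom K V (mulHom K V (ofPath K p) (ofPath K q)) (ofPath K r) =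
        mulHom K V (ofPath K p) (mulHom K V (ofPath K q) (ofPath K r)) := by
    intro a b p c d q e f r
    rw [mulHom_ofPath, mulHom_ofPath]
    by_cases h1 : a = d
    · subst h1
      by_cases h2 : c = f
      · subst h2
        rw [mulPaths_comp, mulPaths_comp, mulHom_ofPath, mulHom_ofPath, mulPaths_comp,
          mulPaths_comp, Quiver.Path.comp_assoc]
      · rw [mulPaths_comp, mulPaths_of_ne _ _ h2, mulHom_ofPath, mulPaths_of_ne _ _ h2, map_zero]
    · rw [mulPaths_of_ne _ _ h1]
      by_cases h2 : c = f
      · subst h2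
        rw [mulPaths_comp, mulHom_ofPath, mulPaths_of_ne _ _ h1]
        simp
      · rw [mulPaths_of_ne _ _ h2]
        simp
  have h3 : ∀ (a b : V) (p : Quiver.Path a b) (c d : V) (q : Quiver.Path c d),
      mulHom K V (mulHom K V (ofPath K p) (ofPath K q)) =
        (mulHom K V (ofPath K p)) ∘ₗ (mulHom K V (ofPath K q)) :=
    fun a b p c d q => linearMap_ext fun e f r => h a b p c d q e f r
  have h4 : ∀ (a b : V) (p : Quiver.Path a b),
      (mulHom K V) ∘ₗ (mulHom K V (ofPath K p)) =
        (LinearMap.llcomp K _ _ _ (mulHom K V (ofPath K p))) ∘ₗ (mulHom K V) :=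
    fun a b p => linearMap_ext fun c d q => h3 a b p c d q
  have h5 : (mulHom K V).compr₂ (mulHom K V) =
      (LinearMap.lcomp K _ (mulHom K V)) ∘ₗ (LinearMap.llcomp K _ _ _) ∘ₗ (mulHom K V) :=
    linearMap_ext fun a b p => h4 a b p
  exact LinearMap.congr_fun (LinearMap.congr_fun (LinearMap.congr_fun h5 x) y) z

variable [Fintype V]

variable (K V) in
/-- The identity of the path algebra: the sum of the vertices (the paths of length zero). -/
def oneElt : PathAlgebra K V := ∑ v : V, ofPath K (Quiver.Path.nil : Quiver.Path v v)

lemma mulHom_one_left (x : PathAlgebra K V) : mulHom K V (oneElt K V) x = x := by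
  classical
  have h : mulHom K V (oneElt K V) = LinearMap.id := linearMap_ext fun a b p => by
    rw [oneElt, map_sum, LinearMap.sum_apply, Finset.sum_eq_single b]
    · rw [mulHom_ofPath, mulPaths_comp]; simp
    · intro v _ hv
      rw [mulHom_ofPath, mulPaths_of_ne _ _ hv]
    · simp
  exact LinearMap.congr_fun h x

lemma mulHom_one_right (x : PathAlgebra K V) : mulHom K V x (oneElt K V) = x := by
  classical
  have h : (mulHom K V).flip (oneElt K V) = LinearMap.id := linearMap_ext fun a b p => by
    rw [LinearMap.flip_apply, oneElt, map_sum, Finset.sum_eq_single a]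
    · rw [mulHom_ofPath, mulPaths_comp]; simp
    · intro v _ hv
      rw [mulHom_ofPath, mulPaths_of_ne _ _ hv.symm]
    · simp
  exact LinearMap.congr_fun h x

/-- The ring structure of the path algebra `KΓ` (for a finite set of vertices). -/
instance : Ring (PathAlgebra K V) :=
  { (inferInstance : AddCommGroup (PathAlgebra K V)) with
    mul := fun x y => mulHom K V x y
    one := oneElt K V
    mul_assoc := mulHom_assoc
    one_mul := mulHom_one_left
    mul_one := mulHom_one_right
    left_distrib := fun x y z => map_add (mulHom K V x) y z
    right_distrib := fun x y z => LinearMap.map_add₂ (mulHom K V) x y z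
    zero_mul := fun x => LinearMap.map_zero₂ (mulHom K V) x
    mul_zero := fun x => map_zero (mulHom K V x) }

instance : Algebra K (PathAlgebra K V) :=
  Algebra.ofModule (fun r x y => LinearMap.map_smul₂ (mulHom K V) r x y)
    (fun r x y => map_smul (mulHom K V x) r y)

lemma ofPath_mul_ofPath {a b c : V} (p : Quiver.Path a b) (q : Quiver.Path b c) :
    ofPath K q * ofPath K p = ofPath K (p.comp q) :=
  (mulHom_ofPath q p).trans (mulPaths_comp p q)

lemma ofPath_mul_ofPath_of_ne {a b c d : V} (p : Quiver.Path a b) (q : Quiver.Path c d)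
    (h : c ≠ b) : ofPath K q * ofPath K p = 0 :=
  (mulHom_ofPath q p).trans (mulPaths_of_ne p q h)

/-- An ideal `I` of `KΓ` is admissible if it contains all paths of length `≥ m` for some `m ≥ 2`
and is contained in the span of the paths of length `≥ 2`; in other words, `A ^ m ≤ I ≤ A ^ 2` for
the ideal `A` generated by the arrows. -/
def IsAdmissible (I : Ideal (PathAlgebra K V)) : Prop :=
  (∃ m : ℕ, 2 ≤ m ∧ ∀ (a b : V) (p : Quiver.Path a b), m ≤ p.length → ofPath K p ∈ I) ∧
  I.restrictScalars K ≤
    Submodule.span K {x | ∃ (a b : V) (p : Quiver.Path a b), 2 ≤ p.length ∧ x = ofPath K p}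

end PathAlgebra

/-! ### Uniserial modules -/

section Modules

variable {R : Type u} [Ring R]

/-- The submodule `J ^ i M` of a module `M`, where `J` is the Jacobson radical of the ring. -/
def radPow (R : Type u) [Ring R] (M : Type u) [AddCommGroup M] [Module R M] : ℕ → Submodule R M
  | 0 => ⊤
  | i + 1 => Ring.jacobson R • radPow R M i

/-- The subquotient `J ^ i M / J ^ j M` (for `i ≤ j`). -/
abbrev RadLayer (R : Type u) [Ring R] (M : Type u) [AddCommGroup M] [Module R M] (i j : ℕ) :
    Type u :=
  ↥(radPow R M i) ⧸ (radPow R M j).submoduleOf (radPow R M i)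

/-- The socle: the sum of all simple submodules. -/
def moduleSocle (R : Type u) [Ring R] (M : Type u) [AddCommGroup M] [Module R M] :
    Submodule R M :=
  sSup {N | IsSimpleModule R N}

/-- A uniserial module: a nonzero module of finite length whose submodules form a chain. -/
def IsUniserial (R : Type u) [Ring R] (M : Type u) [AddCommGroup M] [Module R M] : Prop :=
  Nontrivial M ∧ IsFiniteLength R M ∧ ∀ N P : Submodule R M, N ≤ P ∨ P ≤ N

/-- The modules with property `P` fall into finitely many isomorphism classes. -/
def FinitelyManyUpToIso (P : ModuleCat.{u} R → Prop) : Prop :=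
  ∃ (n : ℕ) (F : Fin n → ModuleCat.{u} R), ∀ M : ModuleCat.{u} R, P M →
    ∃ i, Nonempty (M ≃ₗ[R] F i)

/-- Finite uniserial type: only finitely many uniserial left modules up to isomorphism. -/
def FiniteUniserialType (R : Type u) [Ring R] : Prop :=
  FinitelyManyUpToIso fun M : ModuleCat.{u} R => IsUniserial R M

/-- The module `U` is uniserial with composition series `S = (S(0), …, S(l))`: its length is `l + 1`
and its consecutive composition factors, from the top down, are `S(0), …, S(l)`. -/
def HasCompSeries {l : ℕ} (S : Fin (l + 1) → ModuleCat.{u} R) (U : ModuleCat.{u} R) : Prop :=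
  IsUniserial R U ∧ Module.length R U = (l + 1 : ℕ) ∧
    ∀ i : Fin (l + 1), Nonempty (RadLayer R U i (i + 1) ≃ₗ[R] S i)

/-- `U` has top isomorphic to `S`. -/
def HasTop (U S : ModuleCat.{u} R) : Prop :=
  Nonempty ((U ⧸ radPow R U 1) ≃ₗ[R] S)

/-- `U` has socle isomorphic to `S`. -/
def HasSocle (U S : ModuleCat.{u} R) : Prop :=
  Nonempty (moduleSocle R U ≃ₗ[R] S)

end Modules

/-! ### Right subpaths, detours and their variables -/

section Paths

variable {V : Type u} [Quiver.{u} V]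

/-- `u` is a right subpath of `p`: `p = u' u` for some path `u'`, that is, `u` is an initial
segment of `p`. -/
def IsRightSubpath {a b c : V} (u : Quiver.Path a c) (p : Quiver.Path a b) : Prop :=
  ∃ u' : Quiver.Path c b, p = u.comp u'

/-- The pair `(α, u)` is a detour on `p`: `u` is a right subpath of `p`, while the path `α u` is not,
but some right subpath of `p` which is strictly longer than `u` ends in the same vertex as `α`. -/
def IsDetour {a b c d : V} (p : Quiver.Path a b) (α : c ⟶ d) (u : Quiver.Path a c) : Prop :=
  IsRightSubpath u p ∧ ¬ IsRightSubpath (u.cons α) p ∧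
    ∃ v : Quiver.Path a d, IsRightSubpath v p ∧ u.length < v.length

/-- The power `γ ^ m` of a loop `γ : e → e`. -/
def loopPow {e : V} (γ : e ⟶ e) : ℕ → Quiver.Path e e
  | 0 => Quiver.Path.nil
  | m + 1 => (loopPow γ m).cons γ

/-- The index set of the variables `X_i(α, u)` attached to `p`: a detour `(α, u)` on `p` together
with a right subpath `v = v_i(α, u)` of `p`, longer than `u`, which ends in the same vertex as
`α`. -/
structure DetourVar {a b : V} (p : Quiver.Path a b) where
  c : V
  d : V
  u : Quiver.Path a c
  α : c ⟶ d
  v : Quiver.Path a d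
  isDetour : IsDetour p α u
  isRightSubpath : IsRightSubpath v p
  length_lt : u.length < v.length

/-- The right subpaths of `p` which end in the vertex `c`. -/
def RightSubpathsTo {a b : V} (p : Quiver.Path a b) (c : V) : Type u :=
  {u : Quiver.Path a c // IsRightSubpath u p}

instance {a b : V} (p : Quiver.Path a b) (c : V) : Finite (RightSubpathsTo p c) := by
  refine Finite.of_injective (β := Fin (p.length + 1)) (fun u => ⟨u.1.length, ?_⟩) ?_
  · obtain ⟨r, hr⟩ := u.2
    have := congrArg Quiver.Path.length hr
    rw [Quiver.Path.length_comp] at this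
    omega
  · rintro ⟨u, r, hr⟩ ⟨v, s, hs⟩ h
    have h' : u.length = v.length := by simpa using h
    exact Subtype.ext ((Quiver.Path.comp_inj' h').1 (hr.symm.trans hs)).1

instance {a b : V} (p : Quiver.Path a b) (c : V) : Fintype (RightSubpathsTo p c) :=
  Fintype.ofFinite _

end Paths

/-! ### The affine varieties attached to paths -/

section Varieties

variable (K : Type u) [Field K] {V : Type u} [Quiver.{u} V]

open Classical in
/-- The coefficient of `v` in the right-hand side of the substitution for `α u`, where `u` and `v`
are right subpaths of `p`: `α u` stays as it is if it is a right subpath of `p`; it is replaced by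
`∑ X_i(α, u) v_i(α, u)` if `(α, u)` is a detour on `p`; and it is replaced by `0` otherwise. -/
def substCoeff {a b : V} (p : Quiver.Path a b) {c d : V} (α : c ⟶ d)
    (u : RightSubpathsTo p c) (v : RightSubpathsTo p d) : MvPolynomial (DetourVar p) K :=
  if v.1 = u.1.cons α then 1
  else if h : ¬ IsRightSubpath (u.1.cons α) p ∧ u.1.length < v.1.length then
    MvPolynomial.X
      { c := c, d := d, u := u.1, α := α, v := v.1
        isDetour := ⟨u.2, h.1, v.1, v.2, h.2⟩
        isRightSubpath := v.2
        length_lt := h.2 }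
  else 0

open Classical in
/-- Iterated substitution, from the right, reduces a path `q` starting in the same vertex as `p` to a
linear combination of right subpaths of `p` with coefficients in the polynomial ring
`K[X_i(α, u)]`. This is the coefficient of `v`. -/
def reducePath {a b : V} (p : Quiver.Path a b) :
    ∀ {d : V}, Quiver.Path a d → RightSubpathsTo p d → MvPolynomial (DetourVar p) K
  | _, Quiver.Path.nil, v => if v.1 = Quiver.Path.nil then 1 else 0
  | _, @Quiver.Path.cons _ _ _ c _ q α, v =>
      ∑ u : RightSubpathsTo p c, substCoeff K p α u v * reducePath p q u

open Classical in
variable {K} in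
/-- The coefficient of the right subpath `v : a → d` of `p : a → b` in the element of
`KΓ[X_i(α, u)]` obtained from `z ∈ KΓ` by substitution. Only the terms of `z` which are paths from
`a` to `d` contribute to it. -/
def reduceElt {a b : V} (p : Quiver.Path a b) {d : V} (v : RightSubpathsTo p d)
    (z : PathAlgebra K V) : MvPolynomial (DetourVar p) K :=
  ((PathAlgebra.pathBasis K V).repr z).sum fun x k =>
    if h : x.1 = a ∧ x.2.1 = d then
      MvPolynomial.C k * reducePath K p (x.2.2.cast h.1 h.2) v
    else 0

variable {K} [Fintype V]

/-- The affine variety `V_p`, a closed subset of the affine space with coordinates `X_i(α, u)`: the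
vanishing locus of all polynomials obtained from the relations in `I` by substitution. -/
def pathVariety (I : Ideal (PathAlgebra K V)) {a b : V} (p : Quiver.Path a b) :
    Set (DetourVar p → K) :=
  MvPolynomial.zeroLocus K (Ideal.span
    {f | ∃ z ∈ I, ∃ (d : V) (v : RightSubpathsTo p d), f = reduceElt p v z})

/-- Two subsets of affine spaces (over the same field) are isomorphic as affine varieties: there are
mutually inverse bijections between them which are given by polynomials. -/
def AffineVarietyIso {σ τ : Type u} (X : Set (σ → K)) (Y : Set (τ → K)) : Prop :=
  ∃ (F : τ → MvPolynomial σ K) (G : σ → MvPolynomial τ K),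
    (∀ x ∈ X, (fun j => MvPolynomial.eval x (F j)) ∈ Y) ∧
    (∀ y ∈ Y, (fun i => MvPolynomial.eval y (G i)) ∈ X) ∧
    (∀ x ∈ X, (fun i => MvPolynomial.eval (fun j => MvPolynomial.eval x (F j)) (G i)) = x) ∧
    (∀ y ∈ Y, (fun j => MvPolynomial.eval (fun i => MvPolynomial.eval y (G i)) (F j)) = y)

end Varieties

/-! ### Masts, halyards and condition (N) over `Λ = KΓ/I` -/

section BoundQuiver

variable {K V : Type u} [Field K] [Quiver.{u} V] [Fintype V]
variable (I : Ideal (PathAlgebra K V)) [I.IsTwoSided]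

/-- The residue class in `Λ = KΓ/I` of a path. -/
def pathElt {a b : V} (p : Quiver.Path a b) : PathAlgebra K V ⧸ I :=
  Ideal.Quotient.mk I (PathAlgebra.ofPath K p)

/-- The idempotent of `Λ = KΓ/I` given by a vertex. -/
def vertexElt (e : V) : PathAlgebra K V ⧸ I := pathElt I (Quiver.Path.nil : Quiver.Path e e)

/-- `x` is a top element of `M`: an element outside `J M` with `x = e x` for some vertex `e`. -/
def IsTopElement {M : ModuleCat.{u} (PathAlgebra K V ⧸ I)} (x : M) : Prop :=
  x ∉ radPow (PathAlgebra K V ⧸ I) M 1 ∧ ∃ e : V, vertexElt I e • x = x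

/-- The path `p` of length `l` is a mast of `U`: `U` is uniserial of length `l + 1` and
`p U ≠ 0`. -/
def IsMastOf {a b : V} (p : Quiver.Path a b) (U : ModuleCat.{u} (PathAlgebra K V ⧸ I)) : Prop :=
  IsUniserial (PathAlgebra K V ⧸ I) U ∧
    Module.length (PathAlgebra K V ⧸ I) U = (p.length + 1 : ℕ) ∧
    ∃ x : U, pathElt I p • x ≠ 0

/-- The path `p` is a mast of some uniserial left module. -/
def IsMast {a b : V} (p : Quiver.Path a b) : Prop :=
  ∃ U : ModuleCat.{u} (PathAlgebra K V ⧸ I), IsMastOf I p U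

/-- Condition (N): whenever `α : e → e'` is an arrow and `p : e → e'` is a mast of positive length,
`p` lies in `KΓ α ∪ α KΓ`. -/
def ConditionN : Prop :=
  ∀ (e e' : V) (α : e ⟶ e') (p : Quiver.Path e e'), 0 < p.length → IsMast I p →
    (∃ z : PathAlgebra K V, PathAlgebra.ofPath K p = z * PathAlgebra.ofPath K α.toPath) ∨
    (∃ z : PathAlgebra K V, PathAlgebra.ofPath K p = PathAlgebra.ofPath K α.toPath * z)

/-- The detour `(α, u)` on `p` is a halyard on `p`: `α u x ≠ 0` for some uniserial module `U` with
mast `p` and some top element `x` of `U`. -/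
def IsHalyard {a b c d : V} (p : Quiver.Path a b) (α : c ⟶ d) (u : Quiver.Path a c) : Prop :=
  IsDetour p α u ∧ ∃ U : ModuleCat.{u} (PathAlgebra K V ⧸ I), IsMastOf I p U ∧
    ∃ x : U, IsTopElement I x ∧ pathElt I (u.cons α) • x ≠ 0

/-- The halyard `(α, u)` on `p`, where `u` ends in `e`, is circular: there is a cycle `c : e → e` of
positive length such that `α c u` is a right subpath of `p`, and the edge `α` which leaves the
vertex at the end of `u` in the graph of some uniserial module with mast `p` leads to the vertex at
the end of `α c u`, that is, `Λ α u x = Λ α c u x`. -/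
def IsCircularHalyard {a b e e' : V} (p : Quiver.Path a b) (α : e ⟶ e')
    (u : Quiver.Path a e) : Prop :=
  IsHalyard I p α u ∧ ∃ c : Quiver.Path e e, 0 < c.length ∧
    IsRightSubpath ((u.comp c).cons α) p ∧
    ∃ U : ModuleCat.{u} (PathAlgebra K V ⧸ I), IsMastOf I p U ∧
      ∃ x : U, IsTopElement I x ∧
        Submodule.span (PathAlgebra K V ⧸ I) {pathElt I (u.cons α) • x} =
          Submodule.span (PathAlgebra K V ⧸ I) {pathElt I ((u.comp c).cons α) • x}

/-- The simple module `S` corresponds to the vertex `e`: `e S ≠ 0`. -/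
def CorrespondsTo (S : ModuleCat.{u} (PathAlgebra K V ⧸ I)) (e : V) : Prop :=
  ∃ s : S, vertexElt I e • s ≠ 0

/-- The paths of length `l` which pass consecutively through the vertices corresponding to the
members of the sequence `S = (S(0), …, S(l))` of simple modules. -/
def SeqPaths {l : ℕ} (S : Fin (l + 1) → ModuleCat.{u} (PathAlgebra K V ⧸ I)) : Type u :=
  {x : AllPaths V // x.2.2.length = l ∧ ∀ i : Fin (l + 1), ∃ (c : V) (u : Quiver.Path x.1 c),
    IsRightSubpath u x.2.2 ∧ u.length = i ∧ CorrespondsTo I (S i) c}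

/-- The variety `V_S` of a sequence `S = (S(0), …, S(l))` of simple modules, as a set: the disjoint
union of the varieties `V_p`, where `p` runs through the paths of length `l` passing through the
corresponding vertices. If the quiver has no double arrows, there is at most one such path. -/
def SeqVariety {l : ℕ} (S : Fin (l + 1) → ModuleCat.{u} (PathAlgebra K V ⧸ I)) : Type u :=
  Σ x : SeqPaths I S, pathVariety I x.1.2.2

end BoundQuiver

end

-- Everything rests on a normal form for uniserial modules. Since `I` is admissible, the Jacobson
-- radical `J` is the span of the paths of positive length and is nilpotent. A module has a chain of
-- submodules exactly when its radical layers are at most one-dimensional. If `U` is uniserial with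
-- mast `p` and top element `x` (`IsFrame`), then the elements `u x`, with `u` a right subpath of
-- `p`, form a `K`-basis adapted to the radical filtration. The module structure is thus encoded by
-- the expansions of the elements `α u x`, that is, by a point with coordinates `X_i(α, u)`
-- (`IsCoord`). Reduction by substitution computes the action of a path on `x`. Hence the
-- coordinates of a frame lie on `V_p`, frames with equal coordinates are isomorphic
-- (`IsFrame.nonempty_equiv`), and each point of `V_p` is realised by a `PointModule`.
--
-- (I) Fix an arrow `α : e → e'` and a mast `p` of minimal length violating (N) for it. By
-- minimality, every term of `α x` other than a multiple of `p x` has the form `α v x` with `v` a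
-- cycle of positive length. A change of top element removes these terms, so that `α y = t p y`. The
-- scalar `t` does not depend on the top element (`IsMinimalViolation.scalar_unique`). It may also
-- be varied freely: its coordinate only affects the reduction of arrows, whereas `I` involves paths
-- of length at least two. Since `K` is infinite, this gives infinitely many isomorphism classes.
--
-- (II) Every arrow is a mast, so (N) applied to two parallel arrows identifies them. If `α u x ≠ 0`
-- for a detour, this element generates the same submodule as `w u x` for a right subpath `w u` of
-- `p`. Subpaths of masts are masts, so (N) applies to `w` and gives `w = α c` for a cycle `c` of
-- positive length (`ConditionN.exists_cycle`). This is (b). If the composition factors are pairwise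
-- non-isomorphic, no such cycle exists and all coordinates are zero. For (c), (N) allows a power of
-- the loop to be peeled off one factor at a time. For (d), (N) provides a top element annihilated
-- by all arrows except the first arrow `α` of the mast (`ConditionN.exists_isFrame`). Then `U` is
-- determined by the coordinates of `JU` with respect to `α x`, which form a point of the variety of
-- the shortened sequence.
--
-- Invariance of the varieties: an isomorphism `φ` preserves the powers of `J` and the characters to
-- `K`. It therefore matches vertices and, in the absence of double arrows, matches arrows modulo
-- `J²` and paths modulo longer paths, up to non-zero scalars. The resulting change of basis in a
-- point module is triangular with constant diagonal, so both it and its inverse are polynomial in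
-- the point (`exists_polynomial_combination`). The two maps of varieties are mutually inverse
-- because a point is recovered from the annihilator of the top element.

noncomputable section

/-! ### Right subpaths -/

section Paths

variable {V : Type u} [Quiver.{u} V]

namespace IsRightSubpath

lemma refl {a b : V} (p : Quiver.Path a b) : IsRightSubpath p p := ⟨Quiver.Path.nil, rfl⟩

lemma nil {a b : V} (p : Quiver.Path a b) : IsRightSubpath (Quiver.Path.nil : Quiver.Path a a) p :=
  ⟨p, (Quiver.Path.nil_comp p).symm⟩

lemma of_comp {a b c : V} (u : Quiver.Path a c) (w : Quiver.Path c b) :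
    IsRightSubpath u (u.comp w) := ⟨w, rfl⟩

lemma trans {a b c d : V} {u : Quiver.Path a c} {v : Quiver.Path a d} {p : Quiver.Path a b}
    (h : IsRightSubpath u v) (h' : IsRightSubpath v p) : IsRightSubpath u p := by
  obtain ⟨w, rfl⟩ := h
  obtain ⟨w', rfl⟩ := h'
  exact ⟨w.comp w', Quiver.Path.comp_assoc _ _ _⟩

lemma length_le {a b c : V} {u : Quiver.Path a c} {p : Quiver.Path a b}
    (h : IsRightSubpath u p) : u.length ≤ p.length := by
  obtain ⟨w, rfl⟩ := h
  rw [Quiver.Path.length_comp]; omega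

lemma of_cons {a b c d : V} {u : Quiver.Path a c} {α : c ⟶ d} {p : Quiver.Path a b}
    (h : IsRightSubpath (u.cons α) p) : IsRightSubpath u p :=
  trans ⟨α.toPath, rfl⟩ h

lemma cons_right {a b c d : V} {u : Quiver.Path a c} {p : Quiver.Path a b} (α : b ⟶ d)
    (h : IsRightSubpath u p) : IsRightSubpath u (p.cons α) :=
  trans h ⟨α.toPath, rfl⟩

lemma eq_or_of_cons {a b c d : V} {u : Quiver.Path a c} {p : Quiver.Path a b} {α : b ⟶ d}
    (h : IsRightSubpath u (p.cons α)) :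
    ((⟨c, u⟩ : Σ x, Quiver.Path a x) = ⟨d, p.cons α⟩) ∨ IsRightSubpath u p := by
  obtain ⟨w, hw⟩ := h
  cases w with
  | nil => left; rw [Quiver.Path.comp_nil] at hw; rw [hw]
  | cons w β =>
    right
    rw [Quiver.Path.comp_cons] at hw
    injection hw with h1 h2 h3 h4
    subst h1
    exact ⟨w, eq_of_heq h3⟩

/-- The end vertex is part of the equality, so right subpaths can be compared by length before their
ends are known to agree. -/
lemma sigma_eq {a b c d : V} {p : Quiver.Path a b} {u : Quiver.Path a c} {v : Quiver.Path a d}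
    (hu : IsRightSubpath u p) (hv : IsRightSubpath v p) (h : u.length = v.length) :
    (⟨c, u⟩ : Σ x, Quiver.Path a x) = ⟨d, v⟩ := by
  induction p with
  | nil =>
    have h1 := hu.length_le
    have h2 := hv.length_le
    rw [Quiver.Path.length_nil] at h1 h2
    cases u with
    | nil =>
      cases v with
      | nil => rfl
      | cons v β => simp at h2
    | cons u α => simp at h1
  | cons p α ih =>
    rcases hu.eq_or_of_cons with h1 | h1 <;> rcases hv.eq_or_of_cons with h2 | h2
    · rw [h1, h2]
    · have h3 := h2.length_le
      cases h1
      simp only [Quiver.Path.length_cons] at h; omega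
    · have h3 := h1.length_le
      cases h2
      simp only [Quiver.Path.length_cons] at h; omega
    · exact ih h1 h2

lemma eq_of_length {a b c : V} {p : Quiver.Path a b} {u v : Quiver.Path a c}
    (hu : IsRightSubpath u p) (hv : IsRightSubpath v p) (h : u.length = v.length) : u = v :=
  eq_of_heq (Sigma.mk.inj (sigma_eq hu hv h)).2

lemma exists_length {a b : V} (p : Quiver.Path a b) {i : ℕ} (hi : i ≤ p.length) :
    ∃ (c : V) (u : Quiver.Path a c), IsRightSubpath u p ∧ u.length = i := by
  induction p with
  | nil => exact ⟨_, Quiver.Path.nil, refl _, by simp at hi; simp [hi]⟩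
  | cons p α ih =>
    rcases Nat.lt_or_ge p.length i with h | h
    · refine ⟨_, p.cons α, refl _, ?_⟩
      simp only [Quiver.Path.length_cons] at hi ⊢; omega
    · obtain ⟨c, u, hu, h'⟩ := ih h
      exact ⟨c, u, hu.cons_right α, h'⟩

lemma eq_of_length_eq {a b c : V} {p : Quiver.Path a b} {u : Quiver.Path a c}
    (hu : IsRightSubpath u p) (h : u.length = p.length) :
    (⟨c, u⟩ : Σ x, Quiver.Path a x) = ⟨b, p⟩ := sigma_eq hu (refl p) h

lemma of_le {a b c d : V} {p : Quiver.Path a b} {u : Quiver.Path a c} {v : Quiver.Path a d}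
    (hu : IsRightSubpath u p) (hv : IsRightSubpath v p) (h : u.length ≤ v.length) :
    IsRightSubpath u v := by
  obtain ⟨c', u', h1, h2⟩ := exists_length v h
  cases sigma_eq (h1.trans hv) hu h2
  exact h1

end IsRightSubpath

/-- A right subpath as an element of the type of right subpaths with given end. -/
def RightSubpathsTo.of {a b c : V} {p : Quiver.Path a b} (u : Quiver.Path a c)
    (hu : IsRightSubpath u p) : RightSubpathsTo p c := ⟨u, hu⟩

lemma RightSubpathsTo.ext {a b c : V} {p : Quiver.Path a b} {u v : RightSubpathsTo p c}
    (h : u.1.length = v.1.length) : u = v :=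
  Subtype.ext (u.2.eq_of_length v.2 h)

end Paths

/-! ### Algebra homomorphisms out of the path algebra -/

namespace PathAlgebra

variable {K V : Type u} [Field K] [Quiver.{u} V] [Fintype V]

/-- The algebra homomorphism out of a path algebra given by a multiplicative system of images of the
paths. -/
def liftPaths {A : Type*} [Ring A] [Algebra K A] (F : ∀ a b : V, Quiver.Path a b → A)
    (hone : ∑ v : V, F v v Quiver.Path.nil = 1)
    (hmul : ∀ (a b c : V) (p : Quiver.Path a b) (q : Quiver.Path b c),
      F b c q * F a b p = F a c (p.comp q))
    (hne : ∀ (a b c d : V) (p : Quiver.Path a b) (q : Quiver.Path c d), c ≠ b →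
      F c d q * F a b p = 0) : PathAlgebra K V →ₐ[K] A :=
  AlgHom.ofLinearMap ((pathBasis K V).constr K fun x => F x.1 x.2.1 x.2.2)
    (by
      change (pathBasis K V).constr K _ (oneElt K V) = 1
      rw [oneElt, map_sum, ← hone]
      exact Finset.sum_congr rfl fun v _ => (pathBasis K V).constr_basis K _ _)
    (by
      set f : PathAlgebra K V →ₗ[K] A := (pathBasis K V).constr K fun x => F x.1 x.2.1 x.2.2
      have hf : ∀ (a b : V) (p : Quiver.Path a b), f (ofPath K p) = F a b p := fun a b p =>
        (pathBasis K V).constr_basis K _ _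
      have h1 : ∀ (c d : V) (q : Quiver.Path c d) (a b : V) (p : Quiver.Path a b),
          f (ofPath K q * ofPath K p) = f (ofPath K q) * f (ofPath K p) := by
        intro c d q a b p
        rw [hf, hf]
        by_cases h : c = b
        · subst h
          rw [ofPath_mul_ofPath, hf, hmul]
        · rw [ofPath_mul_ofPath_of_ne _ _ h, map_zero, hne _ _ _ _ _ _ h]
      intro x y
      have h3 : ∀ (c d : V) (q : Quiver.Path c d),
          f ∘ₗ LinearMap.mulLeft K (ofPath K q) = LinearMap.mulLeft K (f (ofPath K q)) ∘ₗ f :=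
        fun c d q => linearMap_ext fun a b p => h1 c d q a b p
      have h4 : f ∘ₗ LinearMap.mulRight K y = LinearMap.mulRight K (f y) ∘ₗ f :=
        linearMap_ext fun a b q => LinearMap.congr_fun (h3 a b q) y
      exact LinearMap.congr_fun h4 x)

lemma liftPaths_ofPath {A : Type*} [Ring A] [Algebra K A] (F : ∀ a b : V, Quiver.Path a b → A)
    (hone hmul hne) {a b : V} (p : Quiver.Path a b) :
    liftPaths (K := K) F hone hmul hne (ofPath K p) = F a b p :=
  (pathBasis K V).constr_basis K _ _

end PathAlgebra

section BoundQuiver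

variable {K V : Type u} [Field K] [Quiver.{u} V] [Fintype V]
variable (I : Ideal (PathAlgebra K V)) [I.IsTwoSided]

/-! ### Multiplication of residue classes of paths -/

lemma pathElt_mul {a b c : V} (p : Quiver.Path a b) (q : Quiver.Path b c) :
    pathElt I q * pathElt I p = pathElt I (p.comp q) := by
  rw [pathElt, pathElt, ← map_mul, PathAlgebra.ofPath_mul_ofPath, pathElt]

lemma pathElt_mul_of_ne {a b c d : V} (p : Quiver.Path a b) (q : Quiver.Path c d) (h : c ≠ b) :
    pathElt I q * pathElt I p = 0 := by
  rw [pathElt, pathElt, ← map_mul, PathAlgebra.ofPath_mul_ofPath_of_ne _ _ h, map_zero]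

lemma pathElt_cons {a b c : V} (p : Quiver.Path a b) (α : b ⟶ c) :
    pathElt I (p.cons α) = pathElt I α.toPath * pathElt I p := by
  rw [pathElt_mul, Quiver.Path.comp_toPath_eq_cons]

lemma vertexElt_mul_pathElt {a b : V} (p : Quiver.Path a b) :
    vertexElt I b * pathElt I p = pathElt I p := by
  rw [vertexElt, pathElt_mul, Quiver.Path.comp_nil]

lemma pathElt_mul_vertexElt {a b : V} (p : Quiver.Path a b) :
    pathElt I p * vertexElt I a = pathElt I p := by
  rw [vertexElt, pathElt_mul, Quiver.Path.nil_comp]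

lemma vertexElt_mul_self (a : V) : vertexElt I a * vertexElt I a = vertexElt I a :=
  vertexElt_mul_pathElt I _

lemma vertexElt_mul_of_ne {a b : V} (h : a ≠ b) : vertexElt I a * vertexElt I b = 0 :=
  pathElt_mul_of_ne I _ _ h

lemma vertexElt_mul_pathElt_of_ne {a b c : V} (p : Quiver.Path a b) (h : c ≠ b) :
    vertexElt I c * pathElt I p = 0 := pathElt_mul_of_ne I _ _ h

lemma pathElt_mul_vertexElt_of_ne {a b c : V} (p : Quiver.Path a b) (h : a ≠ c) :
    pathElt I p * vertexElt I c = 0 := pathElt_mul_of_ne I _ _ h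

lemma sum_vertexElt : ∑ v : V, vertexElt I v = 1 := by
  have : (1 : PathAlgebra K V ⧸ I) = Ideal.Quotient.mk I (PathAlgebra.oneElt K V) :=
    (map_one (Ideal.Quotient.mk I)).symm
  rw [this, PathAlgebra.oneElt, map_sum]
  rfl

/-! ### The span of the paths of length at least `n` -/

/-- The `K`-span in `Λ = KΓ/I` of the paths of length at least `n`. -/
def longSpan (n : ℕ) : Submodule K (PathAlgebra K V ⧸ I) :=
  Submodule.span K {r | ∃ (a b : V) (p : Quiver.Path a b), n ≤ p.length ∧ r = pathElt I p}

variable {I}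

lemma pathElt_mem_longSpan {n : ℕ} {a b : V} (p : Quiver.Path a b) (h : n ≤ p.length) :
    pathElt I p ∈ longSpan I n := Submodule.subset_span ⟨a, b, p, h, rfl⟩

lemma mem_longSpan_zero (r : PathAlgebra K V ⧸ I) : r ∈ longSpan I 0 := by
  obtain ⟨z, rfl⟩ := Ideal.Quotient.mk_surjective r
  let f : PathAlgebra K V →ₗ[K] PathAlgebra K V ⧸ I := (Ideal.Quotient.mkₐ K I).toLinearMap
  change f z ∈ _
  have h1 : z ∈ Submodule.span K (Set.range (PathAlgebra.pathBasis K V)) := by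
    rw [Module.Basis.span_eq]; trivial
  refine Submodule.span_induction (p := fun z _ => f z ∈ longSpan I 0) ?_ ?_ ?_ ?_ h1
  · rintro _ ⟨x, rfl⟩
    exact pathElt_mem_longSpan x.2.2 (Nat.zero_le _)
  · simp
  · intro x y _ _ hx hy; rw [map_add]; exact add_mem hx hy
  · intro c x _ hx; rw [map_smul]; exact Submodule.smul_mem _ _ hx

lemma longSpan_induction {n : ℕ} {P : PathAlgebra K V ⧸ I → Prop}
    (path : ∀ (a b : V) (p : Quiver.Path a b), n ≤ p.length → P (pathElt I p))
    (zero : P 0) (add : ∀ x y, P x → P y → P (x + y)) (smul : ∀ (c : K) x, P x → P (c • x))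
    {r : PathAlgebra K V ⧸ I} (hr : r ∈ longSpan I n) : P r := by
  refine Submodule.span_induction (p := fun z _ => P z) ?_ zero (fun x y _ _ => add x y)
    (fun c x _ => smul c x) hr
  rintro _ ⟨a, b, p, h, rfl⟩
  exact path a b p h

lemma mul_mem_longSpan {m n : ℕ} {r s : PathAlgebra K V ⧸ I} (hr : r ∈ longSpan I m)
    (hs : s ∈ longSpan I n) : r * s ∈ longSpan I (m + n) := by
  refine longSpan_induction (P := fun r => r * s ∈ longSpan I (m + n)) ?_ (by simp) ?_ ?_ hr
  · intro c d q hq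
    refine longSpan_induction (P := fun s => pathElt I q * s ∈ longSpan I (m + n)) ?_ (by simp)
      ?_ ?_ hs
    · intro a b p hp
      by_cases h : c = b
      · subst h
        rw [pathElt_mul]
        exact pathElt_mem_longSpan _ (by rw [Quiver.Path.length_comp]; omega)
      · rw [pathElt_mul_of_ne _ _ _ h]; exact zero_mem _
    · intro x y hx hy; rw [mul_add]; exact add_mem hx hy
    · intro c x hx; rw [mul_smul_comm]; exact Submodule.smul_mem _ _ hx
  · intro x y hx hy; rw [add_mul]; exact add_mem hx hy
  · intro c x hx; rw [smul_mul_assoc]; exact Submodule.smul_mem _ _ hx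

lemma longSpan_anti {m n : ℕ} (h : m ≤ n) : longSpan I n ≤ longSpan I m :=
  Submodule.span_mono fun _ ⟨a, b, p, hp, e⟩ => ⟨a, b, p, h.trans hp, e⟩

lemma pow_mem_longSpan {r : PathAlgebra K V ⧸ I} (hr : r ∈ longSpan I 1) (n : ℕ) :
    r ^ n ∈ longSpan I n := by
  induction n with
  | zero => exact mem_longSpan_zero _
  | succ n ih => rw [pow_succ]; exact mul_mem_longSpan ih hr

lemma exists_longSpan_eq_bot (hI : PathAlgebra.IsAdmissible I) : ∃ m, longSpan I m = ⊥ := by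
  obtain ⟨⟨m, -, hm⟩, -⟩ := hI
  refine ⟨m, Submodule.span_eq_bot.2 ?_⟩
  rintro _ ⟨a, b, p, h, rfl⟩
  exact Ideal.Quotient.eq_zero_iff_mem.2 (hm a b p h)

/-! ### Coefficients of paths of length at most one -/

open Classical in
variable (K) in
/-- The coefficient of a path in an element of the path algebra. -/
def pathCoeff {a b : V} (p : Quiver.Path a b) : PathAlgebra K V →ₗ[K] K :=
  (PathAlgebra.pathBasis K V).coord ⟨a, b, p⟩

open Classical in
lemma pathCoeff_ofPath {a b c d : V} (p : Quiver.Path a b) (q : Quiver.Path c d) :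
    pathCoeff K p (PathAlgebra.ofPath K q) =
      if (⟨c, d, q⟩ : AllPaths V) = ⟨a, b, p⟩ then 1 else 0 := by
  rw [pathCoeff, PathAlgebra.ofPath, Module.Basis.coord_apply, Module.Basis.repr_self,
    Finsupp.single_apply]

-- The containment of `I` in the span of the paths of length at least two makes the coefficients of
-- vertices and arrows well defined modulo `I`.
omit [I.IsTwoSided] in
lemma pathCoeff_eq_zero (hI : PathAlgebra.IsAdmissible I) {a b : V} {p : Quiver.Path a b}
    (hp : p.length < 2) {z : PathAlgebra K V} (hz : z ∈ I) : pathCoeff K p z = 0 := by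
  have h := hI.2 (show z ∈ I.restrictScalars K from hz)
  refine Submodule.span_induction (p := fun z _ => pathCoeff K p z = 0) ?_ (map_zero _) ?_ ?_ h
  · rintro _ ⟨c, d, q, hq, rfl⟩
    rw [pathCoeff_ofPath, if_neg]
    intro h
    cases h
    omega
  · intro x y _ _ hx hy; rw [map_add, hx, hy, add_zero]
  · intro c x _ hx; rw [map_smul, hx, smul_zero]

/-- The coefficient of a path of length at most one in an element of `Λ = KΓ/I`. -/
def eltCoeff (hI : PathAlgebra.IsAdmissible I) {a b : V} (p : Quiver.Path a b)
    (hp : p.length < 2) : (PathAlgebra K V ⧸ I) →ₗ[K] K :=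
  ((I.restrictScalars K).liftQ (pathCoeff K p)
    (fun _ hz => pathCoeff_eq_zero hI hp hz)) ∘ₗ
    (Submodule.Quotient.restrictScalarsEquiv K I).symm.toLinearMap

open Classical in
lemma eltCoeff_pathElt (hI : PathAlgebra.IsAdmissible I) {a b c d : V} (p : Quiver.Path a b)
    (hp : p.length < 2) (q : Quiver.Path c d) :
    eltCoeff hI p hp (pathElt I q) =
      if (⟨c, d, q⟩ : AllPaths V) = ⟨a, b, p⟩ then 1 else 0 := by
  rw [← pathCoeff_ofPath]; rfl

lemma eltCoeff_of_mem_longSpan (hI : PathAlgebra.IsAdmissible I) {a b : V} (p : Quiver.Path a b)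
    (hp : p.length < 2) {n : ℕ} (hn : p.length < n) {r : PathAlgebra K V ⧸ I}
    (hr : r ∈ longSpan I n) : eltCoeff hI p hp r = 0 := by
  refine longSpan_induction (P := fun r => eltCoeff hI p hp r = 0) ?_ (map_zero _) ?_ ?_ hr
  · intro c d q hq
    rw [eltCoeff_pathElt, if_neg]
    intro h
    cases h
    omega
  · intro x y hx hy; rw [map_add, hx, hy, add_zero]
  · intro c x hx; rw [map_smul, hx, smul_zero]

open Classical in
variable (K) in
/-- The algebra homomorphism `KΓ → K` which maps the vertex `v` to `1` and all other paths to
`0`. -/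
def pathVertexChar (v : V) : PathAlgebra K V →ₐ[K] K :=
  PathAlgebra.liftPaths
    (fun a _ p => if p.length = 0 ∧ a = v then (1 : K) else 0)
    (by simp)
    (by
      intro a b c p q
      rw [Quiver.Path.length_comp]
      by_cases hp : p.length = 0
      · cases Quiver.Path.eq_of_length_zero p hp
        simp [hp]
        tauto
      · have : ¬ (p.length + q.length = 0 ∧ a = v) := by omega
        simp [hp])
    (by
      intro a b c d p q h
      by_cases hp : p.length = 0
      · cases Quiver.Path.eq_of_length_zero p hp
        by_cases h1 : c = v
        · have : a ≠ v := fun h2 => h (h1.trans h2.symm)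
          simp [this]
        · simp [h1]
      · simp [hp])

open Classical in
lemma pathVertexChar_ofPath (v : V) {a b : V} (p : Quiver.Path a b) :
    pathVertexChar K v (PathAlgebra.ofPath K p) =
      if p.length = 0 ∧ a = v then (1 : K) else 0 :=
  PathAlgebra.liftPaths_ofPath _ _ _ _ p

omit [I.IsTwoSided] in
lemma pathVertexChar_eq_zero (hI : PathAlgebra.IsAdmissible I) (v : V) {z : PathAlgebra K V}
    (hz : z ∈ I) : pathVertexChar K v z = 0 := by
  have h := hI.2 (show z ∈ I.restrictScalars K from hz)
  refine Submodule.span_induction (p := fun z _ => pathVertexChar K v z = 0) ?_ (map_zero _)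
    ?_ ?_ h
  · rintro _ ⟨c, d, q, hq, rfl⟩
    rw [pathVertexChar_ofPath, if_neg]
    omega
  · intro x y _ _ hx hy; rw [map_add, hx, hy, add_zero]
  · intro c x _ hx; rw [map_smul, hx, smul_zero]

/-- The algebra homomorphism `Λ → K` which maps the vertex `v` to `1` and all other paths to `0`. -/
def vertexChar (hI : PathAlgebra.IsAdmissible I) (v : V) : (PathAlgebra K V ⧸ I) →ₐ[K] K :=
  Ideal.Quotient.liftₐ I (pathVertexChar K v) fun _ hz => pathVertexChar_eq_zero hI v hz

open Classical in
lemma vertexChar_pathElt (hI : PathAlgebra.IsAdmissible I) (v : V) {a b : V}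
    (p : Quiver.Path a b) :
    vertexChar hI v (pathElt I p) = if p.length = 0 ∧ a = v then (1 : K) else 0 :=
  pathVertexChar_ofPath v p

lemma vertexChar_self (hI : PathAlgebra.IsAdmissible I) (v : V) :
    vertexChar hI v (vertexElt I v) = 1 := by
  rw [vertexElt, vertexChar_pathElt, if_pos ⟨rfl, rfl⟩]

lemma vertexChar_of_ne (hI : PathAlgebra.IsAdmissible I) {v w : V} (h : w ≠ v) :
    vertexChar hI v (vertexElt I w) = 0 := by
  rw [vertexElt, vertexChar_pathElt, if_neg (fun h' => h h'.2)]

lemma vertexChar_of_mem_longSpan (hI : PathAlgebra.IsAdmissible I) (v : V)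
    {r : PathAlgebra K V ⧸ I} (hr : r ∈ longSpan I 1) : vertexChar hI v r = 0 := by
  refine longSpan_induction (P := fun r => vertexChar hI v r = 0) ?_ (map_zero _) ?_ ?_ hr
  · intro c d q hq
    rw [vertexChar_pathElt, if_neg]
    omega
  · intro x y hx hy; rw [map_add, hx, hy, add_zero]
  · intro c x hx; rw [map_smul, hx, smul_zero]

/-- The vertex characters read off the vertex part of an element; what remains is a combination of
paths of positive length. -/
lemma sub_sum_vertexChar_mem (hI : PathAlgebra.IsAdmissible I) (r : PathAlgebra K V ⧸ I) :
    r - ∑ v : V, vertexChar hI v r • vertexElt I v ∈ longSpan I 1 := by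
  classical
  refine longSpan_induction
    (P := fun r => r - ∑ v : V, vertexChar hI v r • vertexElt I v ∈ longSpan I 1)
    ?_ (by simp) ?_ ?_ (mem_longSpan_zero r)
  · intro a b p _
    simp only [vertexChar_pathElt]
    by_cases hp : p.length = 0
    · cases Quiver.Path.eq_of_length_zero p hp
      cases Quiver.Path.eq_nil_of_length_zero p hp
      simp [vertexElt]
    · simpa [hp] using pathElt_mem_longSpan p (by omega)
  · intro x y hx hy
    convert add_mem hx hy using 1
    simp only [map_add, add_smul, Finset.sum_add_distrib]
    abel
  · intro c x hx
    convert Submodule.smul_mem _ c hx using 1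
    simp only [map_smul, smul_sub, Finset.smul_sum, smul_smul, smul_eq_mul]

lemma mem_longSpan_one_iff (hI : PathAlgebra.IsAdmissible I) {r : PathAlgebra K V ⧸ I} :
    r ∈ longSpan I 1 ↔ ∀ v, vertexChar hI v r = 0 := by
  refine ⟨fun h v => vertexChar_of_mem_longSpan hI v h, fun h => ?_⟩
  have := sub_sum_vertexChar_mem hI r
  simpa [h] using this

/-! ### The Jacobson radical -/

lemma isNilpotent_of_mem_longSpan (hI : PathAlgebra.IsAdmissible I) {r : PathAlgebra K V ⧸ I}
    (hr : r ∈ longSpan I 1) : IsNilpotent r := by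
  obtain ⟨m, hm⟩ := exists_longSpan_eq_bot hI
  have := pow_mem_longSpan hr m
  rw [hm] at this
  exact ⟨m, (Submodule.mem_bot K).1 this⟩

/-- Each vertex character maps `Λ` onto a field, whose radical is zero, so `J` lies in the common
kernel `longSpan I 1`. Conversely, for `r` in `longSpan I 1` every `s r` is nilpotent and `1 - s r`
is a unit, so no maximal left ideal can omit `r`. -/
lemma mem_jacobson_iff (hI : PathAlgebra.IsAdmissible I) {r : PathAlgebra K V ⧸ I} :
    r ∈ Ring.jacobson (PathAlgebra K V ⧸ I) ↔ r ∈ longSpan I 1 := by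
  constructor
  · intro hr
    rw [mem_longSpan_one_iff hI]
    intro v
    let f : (PathAlgebra K V ⧸ I) →+* K := vertexChar hI v
    have : RingHomSurjective f :=
      ⟨fun c => ⟨algebraMap K _ c, (vertexChar hI v).commutes c⟩⟩
    have h := Ring.le_comap_jacobson f hr
    have h0 : Ring.jacobson K = ⊥ := IsSemisimpleModule.jacobson_eq_bot K K
    rw [h0] at h
    exact h
  · intro hr
    rw [Ring.jacobson_eq_sInf_isMaximal, Ideal.mem_sInf]
    intro m hm
    by_contra h
    have h1 : m ⊔ Ideal.span {r} = ⊤ := (Ideal.isMaximal_def.1 hm).2 _ (by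
      refine lt_of_le_of_ne le_sup_left fun h' => h ?_
      rw [h']
      exact Ideal.mem_sup_right (Ideal.subset_span rfl))
    have h2 : (1 : PathAlgebra K V ⧸ I) ∈ m ⊔ Ideal.span {r} := by rw [h1]; trivial
    obtain ⟨x, hx, y, hy, hxy⟩ := Submodule.mem_sup.1 h2
    obtain ⟨s, rfl⟩ := Ideal.mem_span_singleton'.1 hy
    have h3 : IsUnit (1 - s * r) := (isNilpotent_of_mem_longSpan hI (by
      simpa using mul_mem_longSpan (mem_longSpan_zero s) hr)).isUnit_one_sub
    have h4 : x = 1 - s * r := by rw [← hxy]; abel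
    exact hm.ne_top (Ideal.eq_top_of_isUnit_mem _ hx (h4 ▸ h3))

end BoundQuiver

section BoundQuiver

variable {K V : Type u} [Field K] [Quiver.{u} V] [Fintype V]
variable {I : Ideal (PathAlgebra K V)} [I.IsTwoSided]

local notation "Λ" => (PathAlgebra K V ⧸ I)

/-! ### The radical filtration of a module -/

section Filtration

variable {M : Type u} [AddCommGroup M] [Module (PathAlgebra K V ⧸ I) M]

lemma radPow_succ_le {R : Type u} [Ring R] {M : Type u} [AddCommGroup M] [Module R M] (i : ℕ) :
    radPow R M (i + 1) ≤ radPow R M i := Submodule.smul_le_right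

lemma radPow_anti {R : Type u} [Ring R] {M : Type u} [AddCommGroup M] [Module R M] {i j : ℕ}
    (h : i ≤ j) : radPow R M j ≤ radPow R M i := by
  induction j, h using Nat.le_induction with
  | base => exact le_rfl
  | succ j _ ih => exact (radPow_succ_le j).trans ih

lemma map_mem_radPow {R : Type u} [Ring R] {M N : Type u} [AddCommGroup M] [Module R M]
    [AddCommGroup N] [Module R N] (f : M →ₗ[R] N) {i : ℕ} {m : M} (hm : m ∈ radPow R M i) :
    f m ∈ radPow R N i := by
  induction i generalizing m with
  | zero => trivial
  | succ i ih =>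
    refine Submodule.smul_induction_on (p := fun m => f m ∈ radPow R N (i + 1)) hm ?_ ?_
    · intro r hr n hn
      rw [map_smul]
      exact Submodule.smul_mem_smul hr (ih hn)
    · intro x y hx hy
      rw [map_add]; exact add_mem hx hy

lemma vertexElt_smul_smul {a b : V} (p : Quiver.Path a b) (m : M) :
    vertexElt I b • pathElt I p • m = pathElt I p • m := by
  rw [smul_smul, vertexElt_mul_pathElt]

lemma pathElt_smul_vertexElt_smul {a b : V} (p : Quiver.Path a b) (m : M) :
    pathElt I p • vertexElt I a • m = pathElt I p • m := by
  rw [smul_smul, pathElt_mul_vertexElt]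

lemma pathElt_smul_pathElt_smul {a b c : V} (p : Quiver.Path a b) (q : Quiver.Path b c) (m : M) :
    pathElt I q • pathElt I p • m = pathElt I (p.comp q) • m := by
  rw [smul_smul, pathElt_mul]

lemma toPath_smul_pathElt_smul {a b c : V} (p : Quiver.Path a b) (α : b ⟶ c) (m : M) :
    pathElt I α.toPath • pathElt I p • m = pathElt I (p.cons α) • m := by
  rw [smul_smul, pathElt_cons]

lemma vertexElt_smul_of_ne {a b : V} (h : a ≠ b) {m : M} (hm : vertexElt I b • m = m) :
    vertexElt I a • m = 0 := by
  rw [← hm, smul_smul, vertexElt_mul_of_ne I h, zero_smul]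

lemma sum_vertexElt_smul (m : M) : ∑ v : V, vertexElt I v • m = m := by
  rw [← Finset.sum_smul, sum_vertexElt, one_smul]

variable [Module K M] [IsScalarTower K (PathAlgebra K V ⧸ I) M]

variable (K M) in
/-- The action of an element of `Λ` as a `K`-linear map. -/
def actK (r : PathAlgebra K V ⧸ I) : M →ₗ[K] M where
  toFun m := r • m
  map_add' := smul_add r
  map_smul' c m := by
    rw [RingHom.id_apply, algebra_compatible_smul Λ c m, algebra_compatible_smul Λ c (r • m),
      smul_smul, smul_smul, Algebra.commutes]

lemma actK_apply (r : PathAlgebra K V ⧸ I) (m : M) : actK K M r m = r • m := rfl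

lemma smul_comm_K (r : PathAlgebra K V ⧸ I) (c : K) (m : M) : r • c • m = c • r • m :=
  (actK K M r).map_smul c m

lemma smul_mem_radPow_K {i : ℕ} (c : K) {m : M} (hm : m ∈ radPow Λ M i) : c • m ∈ radPow Λ M i := by
  rw [algebra_compatible_smul Λ c m]
  exact Submodule.smul_mem _ _ hm

lemma smul_mem_radPow (hI : PathAlgebra.IsAdmissible I) {r : PathAlgebra K V ⧸ I} {n i : ℕ}
    (hr : r ∈ longSpan I n) {m : M} (hm : m ∈ radPow Λ M i) : r • m ∈ radPow Λ M (i + n) := by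
  have key : ∀ (a b : V) (p : Quiver.Path a b), pathElt I p • m ∈ radPow Λ M (i + p.length) := by
    intro a b p
    induction p with
    | nil => exact Submodule.smul_mem _ _ hm
    | cons p α ih =>
      rw [← toPath_smul_pathElt_smul]
      exact Submodule.smul_mem_smul ((mem_jacobson_iff hI).2
        (pathElt_mem_longSpan _ (by simp [Quiver.Path.length_toPath]))) ih
  refine longSpan_induction (P := fun r => r • m ∈ radPow Λ M (i + n)) ?_ (by simp) ?_ ?_ hr
  · intro a b p hp
    exact radPow_anti (by omega) (key a b p)
  · intro x y hx hy
    rw [add_smul]; exact add_mem hx hy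
  · intro c x hx
    rw [smul_assoc]; exact smul_mem_radPow_K c hx

lemma pathElt_smul_mem_radPow (hI : PathAlgebra.IsAdmissible I) {a b : V} (p : Quiver.Path a b)
    {i : ℕ} {m : M} (hm : m ∈ radPow Λ M i) : pathElt I p • m ∈ radPow Λ M (i + p.length) :=
  smul_mem_radPow hI (pathElt_mem_longSpan p le_rfl) hm

lemma pathElt_smul_mem_radPow' (hI : PathAlgebra.IsAdmissible I) {a b : V} (p : Quiver.Path a b)
    (m : M) : pathElt I p • m ∈ radPow Λ M p.length := by
  simpa using pathElt_smul_mem_radPow hI p (i := 0) (m := m) trivial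

/-- A path of positive length acts last by an arrow, so `J^(i+1) M` is already the `K`-span of the
`α m` with `m ∈ J^i M`. Here `P` need only be a `K`-subspace. -/
lemma radPow_succ_induction (hI : PathAlgebra.IsAdmissible I) {i : ℕ} (P : Submodule K M)
    (h : ∀ (c d : V) (α : c ⟶ d), ∀ m ∈ radPow Λ M i, pathElt I α.toPath • m ∈ P) {m : M}
    (hm : m ∈ radPow Λ M (i + 1)) : m ∈ P := by
  refine Submodule.smul_induction_on (p := fun m => m ∈ P) hm ?_ (fun x y => add_mem)
  intro r hr n hn
  refine longSpan_induction (P := fun r => r • n ∈ P) ?_ (by simp) ?_ ?_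
    ((mem_jacobson_iff hI).1 hr)
  · intro a b p hp
    cases p with
    | nil => simp at hp
    | cons p α =>
      rw [← toPath_smul_pathElt_smul]
      exact h _ _ α _ (Submodule.smul_mem _ _ hn)
  · intro x y hx hy
    rw [add_smul]; exact add_mem hx hy
  · intro c x hx
    rw [smul_assoc]; exact Submodule.smul_mem _ _ hx

lemma radPow_induction (hI : PathAlgebra.IsAdmissible I) {i : ℕ} (P : Submodule K M)
    (h : ∀ (c d : V) (q : Quiver.Path c d), q.length = i → ∀ m : M, pathElt I q • m ∈ P) {m : M}
    (hm : m ∈ radPow Λ M i) : m ∈ P := by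
  induction i generalizing P m with
  | zero =>
    rw [← sum_vertexElt_smul (I := I) m]
    exact sum_mem fun v _ => h v v Quiver.Path.nil rfl m
  | succ i ih =>
    refine radPow_succ_induction hI P ?_ hm
    intro c d α n hn
    refine ih (P.comap (actK K M (pathElt I α.toPath))) ?_ hn
    intro a b q hq m
    rw [Submodule.mem_comap, actK_apply]
    by_cases hc : c = b
    · subst hc
      rw [toPath_smul_pathElt_smul]
      exact h _ _ _ (by simp [hq]) m
    · rw [smul_smul, pathElt_mul_of_ne I _ _ hc, zero_smul]
      exact zero_mem _

lemma radPow_eq_bot_of_forall (hI : PathAlgebra.IsAdmissible I) {i : ℕ}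
    (h : ∀ (c d : V) (q : Quiver.Path c d), q.length = i → ∀ m : M, pathElt I q • m = 0) :
    radPow Λ M i = ⊥ := by
  rw [eq_bot_iff]
  intro m hm
  exact radPow_induction hI (⊥ : Submodule K M)
    (fun c d q hq m => by rw [h c d q hq m]; exact zero_mem _) hm

lemma exists_radPow_eq_bot (hI : PathAlgebra.IsAdmissible I) : ∃ n, radPow Λ M n = ⊥ := by
  obtain ⟨n, hn⟩ := exists_longSpan_eq_bot hI
  refine ⟨n, radPow_eq_bot_of_forall hI fun c d q hq m => ?_⟩
  have := pathElt_mem_longSpan (I := I) q hq.ge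
  rw [hn, Submodule.mem_bot] at this
  rw [this, zero_smul]

/-- Nakayama's argument: a filtration that stops once stays constant, and nilpotency of `J` makes it
end at zero. -/
lemma radPow_eq_bot_of_eq_succ (hI : PathAlgebra.IsAdmissible I) {i : ℕ}
    (h : radPow Λ M (i + 1) = radPow Λ M i) : radPow Λ M i = ⊥ := by
  have h1 : ∀ k, radPow Λ M (i + k) = radPow Λ M i := by
    intro k
    induction k with
    | zero => rfl
    | succ k ih =>
      change Ring.jacobson Λ • radPow Λ M (i + k) = _
      rw [ih]; exact h
  obtain ⟨n, hn⟩ := exists_radPow_eq_bot (M := M) hI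
  rw [← h1 n, eq_bot_iff, ← hn]
  exact radPow_anti (by omega)

/-- Modulo `J`, the element `r` is a combination of vertices, and all of them except `v` annihilate
`y`. -/
lemma smul_sub_vertexChar_smul_mem (hI : PathAlgebra.IsAdmissible I) {v : V} {y : M} {i : ℕ}
    (hy : y ∈ radPow Λ M i) (hv : vertexElt I v • y = y) (r : PathAlgebra K V ⧸ I) :
    r • y - vertexChar hI v r • y ∈ radPow Λ M (i + 1) := by
  have h := smul_mem_radPow hI (sub_sum_vertexChar_mem hI r) hy
  rw [sub_smul, Finset.sum_smul, Finset.sum_eq_single v] at h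
  · rwa [smul_assoc, hv] at h
  · intro w _ hw
    rw [smul_assoc, vertexElt_smul_of_ne hw hv, smul_zero]
  · simp

omit [Module K M] [IsScalarTower K (PathAlgebra K V ⧸ I) M] in
lemma exists_vertexElt_smul_notMem {i : ℕ} {m : M} (h : m ∉ radPow Λ M i) :
    ∃ v : V, vertexElt I v • m ∉ radPow Λ M i := by
  by_contra! h'
  exact h (sum_vertexElt_smul (I := I) m ▸ sum_mem fun v _ => h' v)

end Filtration

/-! ### Modules whose submodules form a chain -/

section Chain

variable {M : Type u} [AddCommGroup M] [Module (PathAlgebra K V ⧸ I) M]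
variable [Module K M] [IsScalarTower K (PathAlgebra K V ⧸ I) M]

/-- In a module whose submodules form a chain, the layers of the radical filtration are at most
one-dimensional. -/
lemma exists_sub_smul_mem_of_chain (hI : PathAlgebra.IsAdmissible I)
    (hM : ∀ N P : Submodule Λ M, N ≤ P ∨ P ≤ N) {i : ℕ} {v : V} {y : M}
    (hy : y ∈ radPow Λ M i) (hy' : y ∉ radPow Λ M (i + 1)) (hv : vertexElt I v • y = y) {n : M}
    (hn : n ∈ radPow Λ M i) : ∃ c : K, n - c • y ∈ radPow Λ M (i + 1) := by
  -- If `z'` lies in `J^(i+1) M + Λ z`, then it is a `K`-multiple of `z` modulo the next layer,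
  -- because `Λ` acts there on `z` through a character.
  have key : ∀ {w w' : V} {z z' : M}, z ∈ radPow Λ M i → z' ∈ radPow Λ M i →
      vertexElt I w • z = z →
      radPow Λ M (i + 1) ⊔ Submodule.span Λ {z'} ≤ radPow Λ M (i + 1) ⊔ Submodule.span Λ {z} →
      ∃ c : K, z' - c • z ∈ radPow Λ M (i + 1) := by
    intro w w' z z' hz hz' hw h
    have h1 : z' ∈ radPow Λ M (i + 1) ⊔ Submodule.span Λ {z} :=
      h (Submodule.mem_sup_right (Submodule.mem_span_singleton_self _))
    obtain ⟨m, hm, m', hm', rfl⟩ := Submodule.mem_sup.1 h1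
    obtain ⟨r, rfl⟩ := Submodule.mem_span_singleton.1 hm'
    refine ⟨vertexChar hI w r, ?_⟩
    rw [add_sub_assoc]
    exact add_mem hm (smul_sub_vertexChar_smul_mem hI hz hw r)
  -- The components of `n` at the vertices are treated separately, since the scalar action is
  -- available only for elements fixed by a vertex. If the inclusion goes the wrong way, the scalar
  -- is non-zero by `hy'` and can be inverted.
  have h2 : ∀ w : V, ∃ c : K, vertexElt I w • n - c • y ∈ radPow Λ M (i + 1) := by
    intro w
    have hz : vertexElt I w • n ∈ radPow Λ M i := Submodule.smul_mem _ _ hn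
    have hw : vertexElt I w • vertexElt I w • n = vertexElt I w • n := by
      rw [smul_smul, vertexElt_mul_self]
    rcases hM (radPow Λ M (i + 1) ⊔ Submodule.span Λ {vertexElt I w • n})
      (radPow Λ M (i + 1) ⊔ Submodule.span Λ {y}) with h | h
    · exact key (w' := w) hy hz hv h
    · obtain ⟨c, hc⟩ := key (w' := v) hz hy hw h
      have hc0 : c ≠ 0 := by
        rintro rfl
        rw [zero_smul, sub_zero] at hc
        exact hy' hc
      refine ⟨c⁻¹, ?_⟩
      have := smul_mem_radPow_K (-c⁻¹) hc
      rwa [smul_sub, neg_smul, neg_smul, smul_smul, inv_mul_cancel₀ hc0, one_smul,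
        sub_neg_eq_add, neg_add_eq_sub] at this
  choose c hc using h2
  refine ⟨∑ w, c w, ?_⟩
  have h3 : n - (∑ w, c w) • y = ∑ w, (vertexElt I w • n - c w • y) := by
    rw [Finset.sum_sub_distrib, sum_vertexElt_smul, Finset.sum_smul]
  rw [h3]
  exact sum_mem fun w _ => hc w

/-- If the layers of the radical filtration are at most one-dimensional, then the submodules form a
chain. -/
lemma chain_of_layers (hI : PathAlgebra.IsAdmissible I)
    (h : ∀ i, ∃ y : M, ∀ n ∈ radPow Λ M i, ∃ c : K, n - c • y ∈ radPow Λ M (i + 1)) :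
    ∀ N P : Submodule Λ M, N ≤ P ∨ P ≤ N := by
  obtain ⟨k, hk⟩ := exists_radPow_eq_bot (M := M) hI
  -- A submodule containing an element of exact depth `i` contains all of `J^i M`: this holds modulo
  -- `J^(i+1) M`, and multiplying repeatedly by `J` pushes the error term to zero.
  have h1 : ∀ (i : ℕ) (P : Submodule Λ M) (n : M), n ∈ P → n ∈ radPow Λ M i →
      n ∉ radPow Λ M (i + 1) → radPow Λ M i ≤ P := by
    intro i P n hnP hn hn'
    have h2 : radPow Λ M i ≤ P ⊔ radPow Λ M (i + 1) := by
      obtain ⟨y, hy⟩ := h i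
      obtain ⟨c, hc⟩ := hy n hn
      have hc0 : c ≠ 0 := by
        rintro rfl
        rw [zero_smul, sub_zero] at hc
        exact hn' hc
      intro m hm
      obtain ⟨d, hd⟩ := hy m hm
      have e : m = (d * c⁻¹) • n + ((m - d • y) + (-(d * c⁻¹)) • (n - c • y)) := by
        rw [smul_sub, neg_smul, neg_smul, smul_smul, mul_assoc, inv_mul_cancel₀ hc0, mul_one]
        abel
      rw [e]
      refine Submodule.add_mem_sup ?_ (add_mem hd (smul_mem_radPow_K _ hc))
      rw [algebra_compatible_smul Λ]
      exact Submodule.smul_mem _ _ hnP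
    have h3 : ∀ j, radPow Λ M i ≤ P ⊔ radPow Λ M (i + j) := by
      intro j
      induction j with
      | zero => exact le_sup_right
      | succ j ih =>
        refine h2.trans (sup_le le_sup_left ?_)
        refine (Submodule.smul_mono (le_refl (Ring.jacobson Λ)) ih).trans ?_
        rw [Submodule.smul_sup]
        exact sup_le (Submodule.smul_le_right.trans le_sup_left) le_sup_right
    have h4 := h3 k
    rwa [eq_bot_iff.2 ((radPow_anti (by omega)).trans hk.le : radPow Λ M (i + k) ≤ ⊥),
      sup_bot_eq] at h4
  -- Hence the only submodules are the members of the radical filtration.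
  have h2 : ∀ P : Submodule Λ M, ∃ i, P = radPow Λ M i := by
    intro P
    classical
    by_cases hP : P ≤ radPow Λ M k
    · exact ⟨k, le_antisymm hP (hk.le.trans bot_le)⟩
    · have hex : ∃ i, ¬ P ≤ radPow Λ M i := ⟨k, hP⟩
      have hs := Nat.find_spec hex
      have hm := fun {j} => Nat.find_min hex (m := j)
      obtain ⟨j, hj⟩ : ∃ j, Nat.find hex = j + 1 := by
        refine Nat.exists_eq_succ_of_ne_zero fun h0 => ?_
        rw [h0] at hs
        exact hs le_top
      rw [hj] at hs hm
      have hle : P ≤ radPow Λ M j := not_not.1 (hm (Nat.lt_succ_self j))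
      obtain ⟨n, hn, hn'⟩ := SetLike.not_le_iff_exists.1 hs
      exact ⟨j, le_antisymm hle (h1 j P n hn (hle hn) hn')⟩
  intro N P
  obtain ⟨i, rfl⟩ := h2 N
  obtain ⟨j, rfl⟩ := h2 P
  rcases le_total i j with h | h
  · exact Or.inr (radPow_anti h)
  · exact Or.inl (radPow_anti h)

/-- The length of a module whose submodules form a chain. -/
lemma length_of_chain (hI : PathAlgebra.IsAdmissible I)
    (hM : ∀ N P : Submodule Λ M, N ≤ P ∨ P ≤ N) {n : ℕ} (h : ∀ i < n, radPow Λ M i ≠ ⊥) :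
    Module.length Λ M = n + Module.length Λ (radPow Λ M n) := by
  induction n with
  | zero =>
    rw [Nat.cast_zero, zero_add]
    exact Module.length_top.symm
  | succ n ih =>
    rw [ih fun i hi => h i (by omega), Nat.cast_succ, add_assoc]
    congr 1
    have hle := radPow_succ_le (R := Λ) (M := M) n
    have h1 : ¬ radPow Λ M n ≤ radPow Λ M (n + 1) := fun h' =>
      h n (Nat.lt_succ_self n) (radPow_eq_bot_of_eq_succ hI (le_antisymm hle h'))
    obtain ⟨z, hz, hz'⟩ := SetLike.not_le_iff_exists.1 h1
    obtain ⟨v, hv⟩ := exists_vertexElt_smul_notMem hz'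
    -- Some vertex component of a representative of a non-zero class stays outside the next layer,
    -- and that component spans the layer over `K`.
    have hs : IsSimpleModule Λ (RadLayer Λ M n (n + 1)) := by
      rw [isSimpleModule_iff_toSpanSingleton_surjective]
      refine ⟨⟨⟨Submodule.Quotient.mk ⟨z, hz⟩, 0, ?_⟩⟩, ?_⟩
      · rw [Ne, Submodule.Quotient.mk_eq_zero]
        exact hz'
      · intro x hx y
        obtain ⟨⟨x, hx0⟩, rfl⟩ := Submodule.Quotient.mk_surjective _ x
        obtain ⟨⟨y, hy0⟩, rfl⟩ := Submodule.Quotient.mk_surjective _ y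
        have hx1 : x ∉ radPow Λ M (n + 1) := fun h' =>
          hx ((Submodule.Quotient.mk_eq_zero _).2 h')
        obtain ⟨w, hw⟩ := exists_vertexElt_smul_notMem hx1
        obtain ⟨c, hc⟩ := exists_sub_smul_mem_of_chain hI hM (Submodule.smul_mem _ _ hx0) hw
          (by rw [smul_smul, vertexElt_mul_self]) hy0
        refine ⟨(algebraMap K Λ c) * vertexElt I w, ?_⟩
        rw [LinearMap.toSpanSingleton_apply, ← Submodule.Quotient.mk_smul]
        symm
        rw [Submodule.Quotient.eq]
        change y - ((algebraMap K Λ c) * vertexElt I w) • x ∈ radPow Λ M (n + 1)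
        rwa [mul_smul, ← algebra_compatible_smul Λ]
    have h3 := Module.length_eq_add_of_exact
      ((radPow Λ M (n + 1)).submoduleOf (radPow Λ M n)).subtype
      ((radPow Λ M (n + 1)).submoduleOf (radPow Λ M n)).mkQ
      (Submodule.subtype_injective _) (Submodule.mkQ_surjective _)
      (LinearMap.exact_subtype_mkQ _)
    rw [h3, Module.length_eq_one_iff.2 hs, add_comm,
      (Submodule.submoduleOfEquivOfLe hle).length_eq]

lemma isUniserial_of_chain (hI : PathAlgebra.IsAdmissible I)
    (hM : ∀ N P : Submodule Λ M, N ≤ P ∨ P ≤ N) {l : ℕ} (h : radPow Λ M l ≠ ⊥)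
    (h' : radPow Λ M (l + 1) = ⊥) :
    IsUniserial Λ M ∧ Module.length Λ M = (l + 1 : ℕ) := by
  have h1 : Module.length Λ M = (l + 1 : ℕ) := by
    rw [length_of_chain hI hM (n := l + 1), h', Module.length_bot, add_zero]
    intro i hi hb
    exact h (eq_bot_iff.2 ((radPow_anti (by omega)).trans hb.le))
  refine ⟨⟨?_, ?_, hM⟩, h1⟩
  · rw [← Module.length_pos_iff (R := Λ), h1]
    exact_mod_cast Nat.succ_pos l
  · rw [← Module.length_ne_top_iff, h1]
    exact ENat.natCast_ne_top _

lemma exists_radPow_of_isUniserial (hI : PathAlgebra.IsAdmissible I) (hM : IsUniserial Λ M) :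
    ∃ l : ℕ, Module.length Λ M = (l + 1 : ℕ) ∧ radPow Λ M l ≠ ⊥ ∧ radPow Λ M (l + 1) = ⊥ := by
  classical
  have hex := exists_radPow_eq_bot (M := M) hI
  obtain ⟨l, hl⟩ : ∃ l, Nat.find hex = l + 1 := by
    refine Nat.exists_eq_succ_of_ne_zero fun h0 => ?_
    have hs := Nat.find_spec hex
    rw [h0] at hs
    have := hM.1
    exact top_ne_bot hs
  have h1 : radPow Λ M (l + 1) = ⊥ := hl ▸ Nat.find_spec hex
  have h2 : radPow Λ M l ≠ ⊥ := Nat.find_min hex (by omega)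
  exact ⟨l, (isUniserial_of_chain hI hM.2.2 h2 h1).2, h2, h1⟩

end Chain

end BoundQuiver

section BoundQuiver

variable {K V : Type u} [Field K] [Quiver.{u} V] [Fintype V]
variable {I : Ideal (PathAlgebra K V)} [I.IsTwoSided]

local notation "Λ" => (PathAlgebra K V ⧸ I)

lemma chain_subquotient {R : Type u} [Ring R] {M : Type u} [AddCommGroup M] [Module R M]
    (hM : ∀ N P : Submodule R M, N ≤ P ∨ P ≤ N) {N : Submodule R M} (Q : Submodule R N) :
    ∀ A B : Submodule R (N ⧸ Q), A ≤ B ∨ B ≤ A := by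
  intro A B
  have key : ∀ A B : Submodule R (N ⧸ Q),
      (A.comap Q.mkQ).map N.subtype ≤ (B.comap Q.mkQ).map N.subtype → A ≤ B := fun A B h =>
    (Submodule.comap_le_comap_iff_of_surjective (Submodule.mkQ_surjective Q)).1
      ((Submodule.map_le_map_iff_of_injective (Submodule.subtype_injective N) _ _).1 h)
  exact (hM _ _).imp (key A B) (key B A)

/-! ### Framed modules: uniserial modules with a mast and a top element -/

variable (I) in
/-- The submodules of `M` form a chain, and `x` is an element with `x = e x` for the starting vertex
`e` of the path `p` such that `p x ≠ 0`, while all longer paths annihilate `M`. In other words, `M`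
is uniserial with mast `p` and top element `x`. -/
structure IsFrame {M : Type u} [AddCommGroup M] [Module (PathAlgebra K V ⧸ I) M] {a b : V}
    (p : Quiver.Path a b) (x : M) : Prop where
  vertex : vertexElt I a • x = x
  chain : ∀ N P : Submodule (PathAlgebra K V ⧸ I) M, N ≤ P ∨ P ≤ N
  ne : pathElt I p • x ≠ 0
  bot : radPow (PathAlgebra K V ⧸ I) M (p.length + 1) = ⊥

namespace IsFrame

variable {M : Type u} [AddCommGroup M] [Module (PathAlgebra K V ⧸ I) M]
variable {a b : V} {p : Quiver.Path a b} {x : M}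

lemma map {N : Type u} [AddCommGroup N] [Module (PathAlgebra K V ⧸ I) N] (hx : IsFrame I p x)
    (f : M ≃ₗ[PathAlgebra K V ⧸ I] N) : IsFrame I p (f x) where
  vertex := by rw [← map_smul, hx.vertex]
  chain A B := by
    have := hx.chain (A.comap f.toLinearMap) (B.comap f.toLinearMap)
    rwa [Submodule.comap_le_comap_iff_of_surjective f.surjective,
      Submodule.comap_le_comap_iff_of_surjective f.surjective] at this
  ne := by
    rw [← map_smul]
    exact fun h => hx.ne ((LinearEquiv.map_eq_zero_iff f).1 h)
  bot := by
    rw [eq_bot_iff]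
    intro n hn
    have := map_mem_radPow f.symm.toLinearMap hn
    rw [hx.bot, Submodule.mem_bot] at this
    exact (LinearEquiv.map_eq_zero_iff f.symm).1 this

variable [Module K M] [IsScalarTower K (PathAlgebra K V ⧸ I) M]

lemma mem_radPow (_ : IsFrame I p x) (hI : PathAlgebra.IsAdmissible I) {c : V}
    (u : Quiver.Path a c) : pathElt I u • x ∈ radPow Λ M u.length :=
  pathElt_smul_mem_radPow' hI u x

/-- Write `p = w u`. If `u x` lay one layer deeper, then `p x = w u x` would lie beyond the last
layer and vanish. -/
lemma notMem_radPow (hx : IsFrame I p x) (hI : PathAlgebra.IsAdmissible I) {c : V}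
    {u : Quiver.Path a c} (hu : IsRightSubpath u p) :
    pathElt I u • x ∉ radPow Λ M (u.length + 1) := by
  obtain ⟨w, rfl⟩ := hu
  intro h
  have h1 := pathElt_smul_mem_radPow hI w h
  rw [pathElt_smul_pathElt_smul] at h1
  have h2 := radPow_anti (i := (u.comp w).length + 1)
    (by rw [Quiver.Path.length_comp]; omega) h1
  rw [hx.bot] at h2
  exact hx.ne h2

/-- Every element of a layer is a multiple of the corresponding basis element. -/
lemma exists_sub_smul_mem (hx : IsFrame I p x) (hI : PathAlgebra.IsAdmissible I) {c : V}
    {u : Quiver.Path a c} (hu : IsRightSubpath u p) {n : M} (hn : n ∈ radPow Λ M u.length) :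
    ∃ k : K, n - k • pathElt I u • x ∈ radPow Λ M (u.length + 1) :=
  exists_sub_smul_mem_of_chain hI hx.chain (hx.mem_radPow hI u) (hx.notMem_radPow hI hu)
    (vertexElt_smul_smul u x) hn

/-- The layer is spanned by the class of `u x`, on which every vertex other than the end of `u` acts
as zero. -/
lemma vertex_eq (hx : IsFrame I p x) (hI : PathAlgebra.IsAdmissible I) {c d : V}
    {u : Quiver.Path a c} (hu : IsRightSubpath u p) {n : M} (hn : n ∈ radPow Λ M u.length)
    (hn' : n ∉ radPow Λ M (u.length + 1)) (hd : vertexElt I d • n = n) : c = d := by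
  by_contra h
  obtain ⟨k, hk⟩ := hx.exists_sub_smul_mem hI hu hn
  have h1 := Submodule.smul_mem _ (vertexElt I d) hk
  rw [smul_sub, hd, smul_comm_K, vertexElt_smul_of_ne (Ne.symm h) (vertexElt_smul_smul u x),
    smul_zero, sub_zero] at h1
  exact hn' h1

lemma mem_span (hx : IsFrame I p x) (hI : PathAlgebra.IsAdmissible I) {i : ℕ} {n : M}
    (hn : n ∈ radPow Λ M i) :
    n ∈ Submodule.span K {m | ∃ (c : V) (v : Quiver.Path a c), IsRightSubpath v p ∧ i ≤ v.length ∧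
      m = pathElt I v • x} := by
  rcases Nat.lt_or_ge p.length i with h | h
  · have : n ∈ radPow Λ M (p.length + 1) := radPow_anti h hn
    rw [hx.bot, Submodule.mem_bot] at this
    rw [this]; exact zero_mem _
  · obtain ⟨j, hj⟩ := Nat.exists_eq_add_of_le h
    induction j generalizing i n with
    | zero =>
      obtain ⟨k, hk⟩ := hx.exists_sub_smul_mem hI (IsRightSubpath.refl p) (n := n)
        (by rwa [hj, add_zero])
      rw [hx.bot, Submodule.mem_bot, sub_eq_zero] at hk
      rw [hk]
      exact Submodule.smul_mem _ _ (Submodule.subset_span ⟨b, p, IsRightSubpath.refl p, h, rfl⟩)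
    | succ j ih =>
      obtain ⟨c, u, hu, rfl⟩ := IsRightSubpath.exists_length p h
      obtain ⟨k, hk⟩ := hx.exists_sub_smul_mem hI hu hn
      have h1 := ih hk (by omega) (by omega)
      rw [← sub_add_cancel n (k • pathElt I u • x)]
      refine add_mem (Submodule.span_mono ?_ h1) (Submodule.smul_mem _ _
        (Submodule.subset_span ⟨c, u, hu, le_rfl, rfl⟩))
      rintro _ ⟨d, v, hv, hv', rfl⟩
      exact ⟨d, v, hv, by omega, rfl⟩

/-- An element of `e_d J^i M` is a linear combination of the `v x`, where `v` runs through the right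
subpaths of `p` of length at least `i` which end in `d`. -/
lemma exists_sum (hx : IsFrame I p x) (hI : PathAlgebra.IsAdmissible I) {i : ℕ} {n : M}
    (hn : n ∈ radPow Λ M i) {d : V} (hd : vertexElt I d • n = n) :
    ∃ k : RightSubpathsTo p d → K, (∀ v, v.1.length < i → k v = 0) ∧
      n = ∑ v, k v • pathElt I v.1 • x := by
  classical
  rw [← hd]
  refine Submodule.span_induction (p := fun n _ => ∃ k : RightSubpathsTo p d → K,
    (∀ v, v.1.length < i → k v = 0) ∧ vertexElt I d • n = ∑ v, k v • pathElt I v.1 • x)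
    ?_ ?_ ?_ ?_ (hx.mem_span hI hn)
  · rintro _ ⟨c, v, hv, hi, rfl⟩
    by_cases h : c = d
    · subst h
      refine ⟨Pi.single (RightSubpathsTo.of v hv) 1, ?_, ?_⟩
      · intro w hw
        rw [Pi.single_apply, if_neg]
        rintro rfl
        exact absurd hi (not_le.2 hw)
      · rw [vertexElt_smul_smul, Finset.sum_eq_single (RightSubpathsTo.of v hv)]
        · rw [Pi.single_eq_same, one_smul]; rfl
        · intro w _ hw
          rw [Pi.single_apply, if_neg hw, zero_smul]
        · simp
    · refine ⟨0, fun _ _ => rfl, ?_⟩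
      rw [vertexElt_smul_of_ne (Ne.symm h) (vertexElt_smul_smul v x)]
      simp
  · exact ⟨0, fun _ _ => rfl, by simp⟩
  · rintro m m' _ _ ⟨k, hk, hk'⟩ ⟨l, hl, hl'⟩
    refine ⟨k + l, fun v hv => by simp [hk v hv, hl v hv], ?_⟩
    rw [smul_add, hk', hl', ← Finset.sum_add_distrib]
    exact Finset.sum_congr rfl fun v _ => by rw [Pi.add_apply, add_smul]
  · rintro c m _ ⟨k, hk, hk'⟩
    refine ⟨c • k, fun v hv => by simp [hk v hv], ?_⟩
    rw [smul_comm_K, hk', Finset.smul_sum]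
    exact Finset.sum_congr rfl fun v _ => by rw [Pi.smul_apply, smul_eq_mul, mul_smul]

/-- The `v x`, where `v` runs through the right subpaths of `p`, are linearly independent. -/
lemma eq_zero_of_sum (hx : IsFrame I p x) (hI : PathAlgebra.IsAdmissible I) {d : V}
    {k : RightSubpathsTo p d → K} (h : ∑ v, k v • pathElt I v.1 • x = 0) : k = 0 := by
  -- Consider a shortest term with non-zero coefficient. All other remaining terms lie in deeper
  -- layers, because two right subpaths of equal length coincide; so `v x` would lie too deep as
  -- well.
  have key : ∀ (n : ℕ) (v : RightSubpathsTo p d), v.1.length = n → k v = 0 := by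
    intro n
    induction n using Nat.strong_induction_on with
    | _ n ih =>
    intro v hv
    by_contra hk
    have h1 : k v • pathElt I v.1 • x ∈ radPow Λ M (v.1.length + 1) := by
      have := Classical.decEq (RightSubpathsTo p d)
      rw [← Finset.add_sum_erase _ _ (Finset.mem_univ v)] at h
      rw [eq_neg_of_add_eq_zero_left h]
      refine neg_mem (sum_mem fun w hw => ?_)
      rcases lt_trichotomy w.1.length v.1.length with h' | h' | h'
      · rw [ih w.1.length (hv ▸ h') w rfl, zero_smul]; exact zero_mem _
      · exact absurd (RightSubpathsTo.ext h') (Finset.ne_of_mem_erase hw)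
      · exact radPow_anti h' (smul_mem_radPow_K _ (hx.mem_radPow hI w.1))
    have h2 := smul_mem_radPow_K (k v)⁻¹ h1
    rw [smul_smul, inv_mul_cancel₀ hk, one_smul] at h2
    exact hx.notMem_radPow hI v.2 h2
  funext v
  exact key _ v rfl

lemma coeff_unique (hx : IsFrame I p x) (hI : PathAlgebra.IsAdmissible I) {d : V}
    {k l : RightSubpathsTo p d → K}
    (h : ∑ v, k v • pathElt I v.1 • x = ∑ v, l v • pathElt I v.1 • x) : k = l := by
  rw [← sub_eq_zero]
  refine hx.eq_zero_of_sum hI ?_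
  rw [← sub_eq_zero, ← Finset.sum_sub_distrib] at h
  rw [← h]
  exact Finset.sum_congr rfl fun v _ => by rw [Pi.sub_apply, sub_smul]

lemma radPow_ne_bot (hx : IsFrame I p x) (hI : PathAlgebra.IsAdmissible I) :
    radPow Λ M p.length ≠ ⊥ := fun h => by
  have := hx.mem_radPow hI p
  rw [h, Submodule.mem_bot] at this
  exact hx.ne this

lemma exists_smul_eq (hx : IsFrame I p x) (hI : PathAlgebra.IsAdmissible I) (m : M) :
    ∃ r : PathAlgebra K V ⧸ I, r • x = m := by
  refine Submodule.span_induction (p := fun m _ => ∃ r : PathAlgebra K V ⧸ I, r • x = m) ?_ ?_ ?_ ?_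
    (hx.mem_span hI (i := 0) (n := m) trivial)
  · rintro _ ⟨c, v, -, -, rfl⟩
    exact ⟨_, rfl⟩
  · exact ⟨0, zero_smul _ _⟩
  · rintro _ _ _ _ ⟨r, rfl⟩ ⟨s, rfl⟩
    exact ⟨r + s, add_smul _ _ _⟩
  · rintro c _ _ ⟨r, rfl⟩
    exact ⟨c • r, smul_assoc _ _ _⟩

/-- Modulo `JM` the element `y` is `k x` with `k ≠ 0`, and `p` annihilates `JM` because `J^(l+1) M =
0` for `l` the length of `p`. Hence `p y = k p x`. -/
lemma of_top (hx : IsFrame I p x) (hI : PathAlgebra.IsAdmissible I) {y : M} {e : V}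
    (hy : y ∉ radPow Λ M 1) (he : vertexElt I e • y = y) : a = e ∧ pathElt I p • y ≠ 0 := by
  have h0 : a = e := hx.vertex_eq hI (IsRightSubpath.nil p) (n := y) trivial hy he
  refine ⟨h0, ?_⟩
  obtain ⟨k, hk⟩ := hx.exists_sub_smul_mem hI (IsRightSubpath.nil p) (n := y) trivial
  have hk' : y - k • x ∈ radPow Λ M 1 := by
    have h1 : pathElt I (Quiver.Path.nil : Quiver.Path a a) • x = x := hx.vertex
    rw [h1] at hk
    exact hk
  have hk0 : k ≠ 0 := by
    rintro rfl
    rw [zero_smul, sub_zero] at hk'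
    exact hy hk'
  have h2 := pathElt_smul_mem_radPow hI p hk'
  rw [add_comm, hx.bot, Submodule.mem_bot, smul_sub, sub_eq_zero, smul_comm_K] at h2
  rw [h2]
  exact smul_ne_zero hk0 hx.ne

lemma of_top_frame (hx : IsFrame I p x) (hI : PathAlgebra.IsAdmissible I) {y : M}
    (hy : y ∉ radPow Λ M 1) (he : vertexElt I a • y = y) : IsFrame I p y :=
  ⟨he, hx.chain, (hx.of_top hI hy he).2, hx.bot⟩

/-- These changes of top element are used to normalise the action of arrows on it. -/
lemma sub_frame (hx : IsFrame I p x) (hI : PathAlgebra.IsAdmissible I) {z : M}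
    (hz : z ∈ radPow Λ M 1) (he : vertexElt I a • z = z) : IsFrame I p (x - z) := by
  refine hx.of_top_frame hI (fun h => ?_) (by rw [smul_sub, hx.vertex, he])
  have h1 := hx.notMem_radPow hI (IsRightSubpath.nil p)
  apply h1
  have h2 : pathElt I (Quiver.Path.nil : Quiver.Path a a) • x = x := hx.vertex
  rw [h2, ← sub_add_cancel x z]
  exact add_mem h hz

/-- The subquotients of a framed module. -/
lemma radLayer (hx : IsFrame I p x) (hI : PathAlgebra.IsAdmissible I) {c d : V}
    {u : Quiver.Path a c} {w : Quiver.Path c d} (h : IsRightSubpath (u.comp w) p)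
    (hm : pathElt I u • x ∈ radPow Λ M u.length) :
    IsFrame I w (Submodule.Quotient.mk ⟨pathElt I u • x, hm⟩ :
      RadLayer Λ M u.length (u.length + (w.length + 1))) where
  vertex := by
    rw [← Submodule.Quotient.mk_smul]
    congr 1
    exact Subtype.ext (vertexElt_smul_smul u x)
  chain := chain_subquotient hx.chain _
  ne := by
    rw [← Submodule.Quotient.mk_smul, Ne, Submodule.Quotient.mk_eq_zero]
    change pathElt I w • pathElt I u • x ∉ radPow Λ M (u.length + (w.length + 1))
    rw [pathElt_smul_pathElt_smul, ← add_assoc, ← Quiver.Path.length_comp]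
    exact hx.notMem_radPow hI h
  bot := by
    refine radPow_eq_bot_of_forall (K := K) hI fun c' d' q hq m => ?_
    obtain ⟨⟨m, hm⟩, rfl⟩ := Submodule.Quotient.mk_surjective _ m
    rw [← Submodule.Quotient.mk_smul, Submodule.Quotient.mk_eq_zero]
    change pathElt I q • m ∈ radPow Λ M (u.length + (w.length + 1))
    rw [← hq]
    exact pathElt_smul_mem_radPow hI q hm

end IsFrame

/-- Every uniserial module has a mast. -/
lemma exists_isFrame {M : Type u} [AddCommGroup M] [Module (PathAlgebra K V ⧸ I) M]
    [Module K M] [IsScalarTower K (PathAlgebra K V ⧸ I) M] (hI : PathAlgebra.IsAdmissible I)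
    (hM : ∀ N P : Submodule Λ M, N ≤ P ∨ P ≤ N) {l : ℕ}
    (h : radPow Λ M l ≠ ⊥) (h' : radPow Λ M (l + 1) = ⊥) :
    ∃ (a b : V) (p : Quiver.Path a b) (x : M), p.length = l ∧ IsFrame I p x := by
  -- Otherwise every path of length `l` annihilates `M`: if `q m ≠ 0`, the component of `m` at the
  -- start of `q` is a top element with mast `q`.
  by_contra! hc
  refine h (radPow_eq_bot_of_forall (K := K) hI fun c d q hq m => ?_)
  by_contra hq'
  refine hc c d q (vertexElt I c • m) hq ⟨?_, hM, ?_, hq ▸ h'⟩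
  · rw [smul_smul, vertexElt_mul_self]
  · rwa [pathElt_smul_vertexElt_smul]

/-- Two masts of a module pass through the same vertices. -/
lemma IsFrame.vertices_eq {M : Type u} [AddCommGroup M] [Module (PathAlgebra K V ⧸ I) M]
    [Module K M] [IsScalarTower K (PathAlgebra K V ⧸ I) M] (hI : PathAlgebra.IsAdmissible I)
    {a b a' b' : V} {p : Quiver.Path a b} {p' : Quiver.Path a' b'} {x x' : M}
    (hx : IsFrame I p x) (hx' : IsFrame I p' x') {c c' : V} {u : Quiver.Path a c}
    {u' : Quiver.Path a' c'} (hu : IsRightSubpath u p) (hu' : IsRightSubpath u' p')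
    (h : u.length = u'.length) : c = c' :=
  hx.vertex_eq hI hu (h ▸ hx'.mem_radPow hI u') (h ▸ hx'.notMem_radPow hI hu')
    (vertexElt_smul_smul u' x')

lemma IsFrame.length_eq {M : Type u} [AddCommGroup M] [Module (PathAlgebra K V ⧸ I) M]
    [Module K M] [IsScalarTower K (PathAlgebra K V ⧸ I) M] (hI : PathAlgebra.IsAdmissible I)
    {a b a' b' : V} {p : Quiver.Path a b} {p' : Quiver.Path a' b'} {x x' : M}
    (hx : IsFrame I p x) (hx' : IsFrame I p' x') : p.length = p'.length := by
  have h1 := (isUniserial_of_chain hI hx.chain (hx.radPow_ne_bot hI) hx.bot).2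
  have h2 := (isUniserial_of_chain hI hx'.chain (hx'.radPow_ne_bot hI) hx'.bot).2
  have h3 : ((p.length + 1 : ℕ) : ℕ∞) = ((p'.length + 1 : ℕ) : ℕ∞) := h1.symm.trans h2
  have := Nat.cast_injective h3
  omega

/-! ### Masts and frames -/

open scoped ModuleCat.Algebra in
lemma isMastOf_iff (hI : PathAlgebra.IsAdmissible I) {a b : V} {p : Quiver.Path a b}
    {U : ModuleCat.{u} (PathAlgebra K V ⧸ I)} :
    IsMastOf I p U ↔ ∃ x : U, IsFrame I p x := by
  constructor
  · rintro ⟨h1, h2, y, hy⟩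
    obtain ⟨l, h3, h4, h5⟩ := exists_radPow_of_isUniserial (K := K) hI h1
    have h6 : ((l + 1 : ℕ) : ℕ∞) = ((p.length + 1 : ℕ) : ℕ∞) := h3.symm.trans h2
    have h7 := Nat.cast_injective h6
    refine ⟨vertexElt I a • y, ?_, h1.2.2, ?_, h7 ▸ h5⟩
    · rw [smul_smul, vertexElt_mul_self]
    · rwa [pathElt_smul_vertexElt_smul]
  · rintro ⟨x, hx⟩
    obtain ⟨h1, h2⟩ := isUniserial_of_chain (K := K) hI hx.chain (hx.radPow_ne_bot hI) hx.bot
    exact ⟨h1, h2, x, hx.ne⟩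

open scoped ModuleCat.Algebra in
lemma isTopElement_iff (hI : PathAlgebra.IsAdmissible I) {a b : V} {p : Quiver.Path a b}
    {U : ModuleCat.{u} (PathAlgebra K V ⧸ I)} (hp : IsMastOf I p U) {x : U} :
    IsTopElement I x ↔ IsFrame I p x := by
  obtain ⟨y, hy⟩ := (isMastOf_iff hI).1 hp
  constructor
  · rintro ⟨h1, e, he⟩
    obtain rfl := (hy.of_top hI h1 he).1
    exact hy.of_top_frame hI h1 he
  · intro hx
    refine ⟨?_, a, hx.vertex⟩
    have h1 := hx.notMem_radPow hI (IsRightSubpath.nil p)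
    have h2 : pathElt I (Quiver.Path.nil : Quiver.Path a a) • x = x := hx.vertex
    rwa [h2] at h1

lemma isMast_of_isFrame (hI : PathAlgebra.IsAdmissible I) {a b : V} {p : Quiver.Path a b}
    {M : Type u} [AddCommGroup M] [Module (PathAlgebra K V ⧸ I) M] {x : M} (hx : IsFrame I p x) :
    IsMast I p := ⟨ModuleCat.of _ M, (isMastOf_iff hI).2 ⟨x, hx⟩⟩

/-- Subpaths of masts are masts. -/
lemma IsFrame.isMast_comp (hI : PathAlgebra.IsAdmissible I)
    {M : Type u} [AddCommGroup M] [Module (PathAlgebra K V ⧸ I) M]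
    [Module K M] [IsScalarTower K (PathAlgebra K V ⧸ I) M]
    {a b c d : V} {p : Quiver.Path a b} {x : M} (hx : IsFrame I p x) {u : Quiver.Path a c}
    {w : Quiver.Path c d} (h : IsRightSubpath (u.comp w) p) : IsMast I w :=
  isMast_of_isFrame hI (hx.radLayer hI h (hx.mem_radPow hI u))

open scoped ModuleCat.Algebra in
lemma IsMast.of_comp (hI : PathAlgebra.IsAdmissible I) {a b c d : V} {p : Quiver.Path a b}
    (hp : IsMast I p) {u : Quiver.Path a c}
    {w : Quiver.Path c d} (h : IsRightSubpath (u.comp w) p) : IsMast I w := by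
  obtain ⟨U, hU⟩ := hp
  obtain ⟨x, hx⟩ := (isMastOf_iff hI).1 hU
  exact hx.isMast_comp hI h

end BoundQuiver

/-! ### Coordinates -/

section Reduction

variable {K V : Type u} [Field K] [Quiver.{u} V]

open Classical in
lemma substCoeff_of_isRightSubpath {a b : V} {p : Quiver.Path a b} {c d : V} {α : c ⟶ d}
    {u : RightSubpathsTo p c} (h : IsRightSubpath (u.1.cons α) p) (v : RightSubpathsTo p d) :
    substCoeff K p α u v = if v = RightSubpathsTo.of _ h then 1 else 0 := by
  by_cases hv : v.1 = u.1.cons α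
  · have : v = RightSubpathsTo.of _ h := Subtype.ext hv
    rw [substCoeff, if_pos hv, if_pos this]
  · have : v ≠ RightSubpathsTo.of _ h := fun h' => hv (congrArg Subtype.val h')
    rw [substCoeff, if_neg hv, if_neg this, dif_neg]
    exact fun h' => h'.1 h

open Classical in
lemma substCoeff_cons {a b : V} {p : Quiver.Path a b} {c d : V} {α : c ⟶ d}
    {u : Quiver.Path a c} (h : IsRightSubpath (u.cons α) p) (v : RightSubpathsTo p d) :
    substCoeff K p α (RightSubpathsTo.of u h.of_cons) v =
      if v = RightSubpathsTo.of _ h then 1 else 0 :=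
  substCoeff_of_isRightSubpath (u := RightSubpathsTo.of u h.of_cons) h v

lemma substCoeff_of_length_le {a b : V} {p : Quiver.Path a b} {c d : V} (α : c ⟶ d)
    (u : RightSubpathsTo p c) (v : RightSubpathsTo p d) (h : v.1.length ≤ u.1.length) :
    substCoeff K p α u v = 0 := by
  classical
  rw [substCoeff, if_neg, dif_neg]
  · exact fun h' => absurd h'.2 (not_lt.2 h)
  · intro h'
    rw [h', Quiver.Path.length_cons] at h
    omega

lemma substCoeff_detourVar {a b : V} {p : Quiver.Path a b} (w : DetourVar p) :
    substCoeff K p w.α (RightSubpathsTo.of w.u w.isDetour.1)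
      (RightSubpathsTo.of w.v w.isRightSubpath) = MvPolynomial.X w := by
  classical
  have h1 : (RightSubpathsTo.of w.v w.isRightSubpath).1 ≠
      (RightSubpathsTo.of w.u w.isDetour.1).1.cons w.α := fun h =>
    w.isDetour.2.1 (h ▸ w.isRightSubpath)
  rw [substCoeff, if_neg h1, dif_pos ⟨w.isDetour.2.1, w.length_lt⟩]
  rfl

variable (K) in
/-- The value of the substitution coefficients at a point, determined by arbitrary coefficients. -/
lemma eval_substCoeff_of_forall {a b : V} {p : Quiver.Path a b} {c d : V} {α : c ⟶ d}
    {u : RightSubpathsTo p c} (h : ¬ IsRightSubpath (u.1.cons α) p) (k : DetourVar p → K)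
    (f : RightSubpathsTo p d → K) (hf : ∀ v, v.1.length ≤ u.1.length → f v = 0)
    (hk : ∀ w : DetourVar p, ∀ (hc : w.c = c) (hd : w.d = d), w.u.cast rfl hc = u.1 →
      w.α.cast hc hd = α →
      k w = f (RightSubpathsTo.of (w.v.cast rfl hd) (by cases hd; exact w.isRightSubpath)))
    (v : RightSubpathsTo p d) : MvPolynomial.eval k (substCoeff K p α u v) = f v := by
  classical
  have h1 : v.1 ≠ u.1.cons α := fun h' => h (h' ▸ v.2)
  rw [substCoeff, if_neg h1]
  by_cases h2 : u.1.length < v.1.length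
  · rw [dif_pos ⟨h, h2⟩, MvPolynomial.eval_X]
    exact hk _ rfl rfl rfl rfl
  · rw [dif_neg (fun h' => h2 h'.2), map_zero, hf v (not_lt.1 h2)]

open Classical in
variable (K) in
/-- Reduction as a linear map. -/
def reduceLin {a b : V} (p : Quiver.Path a b) {d : V} (v : RightSubpathsTo p d) :
    PathAlgebra K V →ₗ[K] MvPolynomial (DetourVar p) K :=
  (PathAlgebra.pathBasis K V).constr K fun x =>
    if h : x.1 = a ∧ x.2.1 = d then reducePath K p (x.2.2.cast h.1 h.2) v else 0

lemma reduceElt_eq {a b : V} (p : Quiver.Path a b) {d : V} (v : RightSubpathsTo p d)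
    (z : PathAlgebra K V) : reduceElt p v z = reduceLin K p v z := by
  rw [reduceElt, reduceLin, Module.Basis.constr_apply]
  refine Finsupp.sum_congr fun x _ => ?_
  split_ifs with h
  · rw [MvPolynomial.C_mul']
  · rw [smul_zero]

lemma reduceLin_ofPath {a b : V} (p : Quiver.Path a b) {d : V} (v : RightSubpathsTo p d)
    (q : Quiver.Path a d) : reduceLin K p v (PathAlgebra.ofPath K q) = reducePath K p q v := by
  rw [reduceLin, PathAlgebra.ofPath, Module.Basis.constr_basis, dif_pos ⟨rfl, rfl⟩]
  rfl

lemma reduceLin_ofPath_of_ne {a b : V} (p : Quiver.Path a b) {d : V} (v : RightSubpathsTo p d)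
    {a' d' : V} (q : Quiver.Path a' d') (h : ¬ (a' = a ∧ d' = d)) :
    reduceLin K p v (PathAlgebra.ofPath K q) = 0 := by
  rw [reduceLin, PathAlgebra.ofPath, Module.Basis.constr_basis, dif_neg h]

variable [Fintype V]
variable {A : Type*} [Ring A] [Algebra K A] (ψ : PathAlgebra K V →ₐ[K] A)
variable {M : Type*} [AddCommGroup M] [Module A M] [Module K M] [IsScalarTower K A M]

/-- Reduction computes the action of a path. -/
lemma path_smul_eq_sum {a b : V} {p : Quiver.Path a b} {k : DetourVar p → K} {x : M}
    (h : ∀ (c d : V) (α : c ⟶ d) (u : RightSubpathsTo p c),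
      ψ (PathAlgebra.ofPath K (u.1.cons α)) • x =
        ∑ v, MvPolynomial.eval k (substCoeff K p α u v) • ψ (PathAlgebra.ofPath K v.1) • x)
    {d : V} (q : Quiver.Path a d) :
    ψ (PathAlgebra.ofPath K q) • x =
      ∑ v, MvPolynomial.eval k (reducePath K p q v) • ψ (PathAlgebra.ofPath K v.1) • x := by
  have hc : ∀ {c d : V} (u : Quiver.Path a c) (α : c ⟶ d), ψ (PathAlgebra.ofPath K (u.cons α)) =
      ψ (PathAlgebra.ofPath K α.toPath) * ψ (PathAlgebra.ofPath K u) := by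
    intro c d u α
    rw [← map_mul, PathAlgebra.ofPath_mul_ofPath, Quiver.Path.comp_toPath_eq_cons]
  induction q with
  | nil =>
    rw [Finset.sum_eq_single (RightSubpathsTo.of Quiver.Path.nil (IsRightSubpath.nil p))]
    · have : (RightSubpathsTo.of Quiver.Path.nil (IsRightSubpath.nil p)).1 = Quiver.Path.nil := rfl
      rw [reducePath, if_pos this, map_one, one_smul]; rfl
    · intro v _ hv
      have hv' : ¬ v.1 = Quiver.Path.nil := fun h' => hv (Subtype.ext h')
      rw [reducePath, if_neg hv', map_zero, zero_smul]
    · intro h'; exact absurd (Finset.mem_univ _) h'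
  | cons q α ih =>
    rw [hc, mul_smul, ih, Finset.smul_sum]
    simp only [reducePath, map_sum, map_mul, Finset.sum_smul]
    rw [Finset.sum_comm]
    refine Finset.sum_congr rfl fun u _ => ?_
    rw [smul_algebra_smul_comm, ← mul_smul, ← hc, h, Finset.smul_sum]
    refine Finset.sum_congr rfl fun v _ => ?_
    rw [smul_smul, mul_comm]

/-- Reduction computes the action of the path algebra. -/
lemma smul_eq_sum_sum {a b : V} {p : Quiver.Path a b} {k : DetourVar p → K} {x : M}
    (hx : ψ (PathAlgebra.ofPath K (Quiver.Path.nil : Quiver.Path a a)) • x = x)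
    (h : ∀ (c d : V) (α : c ⟶ d) (u : RightSubpathsTo p c),
      ψ (PathAlgebra.ofPath K (u.1.cons α)) • x =
        ∑ v, MvPolynomial.eval k (substCoeff K p α u v) • ψ (PathAlgebra.ofPath K v.1) • x)
    (z : PathAlgebra K V) :
    ψ z • x = ∑ d : V, ∑ v : RightSubpathsTo p d,
      MvPolynomial.eval k (reduceLin K p v z) • ψ (PathAlgebra.ofPath K v.1) • x := by
  have hz : z ∈ Submodule.span K (Set.range (PathAlgebra.pathBasis K V)) := by
    rw [Module.Basis.span_eq]; trivial
  refine Submodule.span_induction (p := fun z _ => ψ z • x = ∑ d : V, ∑ v : RightSubpathsTo p d,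
      MvPolynomial.eval k (reduceLin K p v z) • ψ (PathAlgebra.ofPath K v.1) • x) ?_ ?_ ?_ ?_ hz
  · rintro _ ⟨⟨a', d', q⟩, rfl⟩
    change ψ (PathAlgebra.ofPath K q) • x = ∑ d : V, ∑ v : RightSubpathsTo p d,
      MvPolynomial.eval k (reduceLin K p v (PathAlgebra.ofPath K q)) •
        ψ (PathAlgebra.ofPath K v.1) • x
    by_cases ha : a' = a
    · subst ha
      rw [Finset.sum_eq_single d']
      · simp only [reduceLin_ofPath]
        exact path_smul_eq_sum ψ h q
      · intro d _ hd
        refine Finset.sum_eq_zero fun v _ => ?_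
        rw [reduceLin_ofPath_of_ne _ _ _ (fun h' => hd h'.2.symm), map_zero, zero_smul]
      · intro h'; exact absurd (Finset.mem_univ _) h'
    · rw [Finset.sum_eq_zero]
      · rw [← hx, ← mul_smul, ← map_mul, PathAlgebra.ofPath_mul_ofPath_of_ne _ _ ha, map_zero,
          zero_smul]
      · intro d _
        refine Finset.sum_eq_zero fun v _ => ?_
        rw [reduceLin_ofPath_of_ne _ _ _ (fun h' => ha h'.1), map_zero, zero_smul]
  · simp
  · intro y z _ _ hy hz
    simp only [map_add, add_smul, hy, hz, Finset.sum_add_distrib]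
  · intro c z _ hz
    simp only [map_smul, smul_assoc, hz, Finset.smul_sum, MvPolynomial.smul_eval, mul_smul]

end Reduction

-- Coordinates of framed modules

section BoundQuiver

variable {K V : Type u} [Field K] [Quiver.{u} V] [Fintype V]
variable {I : Ideal (PathAlgebra K V)} [I.IsTwoSided]

local notation "Λ" => (PathAlgebra K V ⧸ I)

variable (I) in
/-- `k` is the point of affine space which describes the action of the arrows on the elements `u x`,
where `u` runs through the right subpaths of `p`. -/
def IsCoord {M : Type u} [AddCommGroup M] [Module (PathAlgebra K V ⧸ I) M] [Module K M] {a b : V}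
    (p : Quiver.Path a b) (x : M) (k : DetourVar p → K) : Prop :=
  ∀ (c d : V) (α : c ⟶ d) (u : RightSubpathsTo p c),
    pathElt I (u.1.cons α) • x =
      ∑ v : RightSubpathsTo p d, MvPolynomial.eval k (substCoeff K p α u v) • pathElt I v.1 • x

section

variable {M : Type u} [AddCommGroup M] [Module (PathAlgebra K V ⧸ I) M]
variable [Module K M] [IsScalarTower K (PathAlgebra K V ⧸ I) M]
variable {a b : V} {p : Quiver.Path a b} {x : M}

lemma IsCoord.mk_smul_eq {k : DetourVar p → K} (hk : IsCoord I p x k) (hx : vertexElt I a • x = x)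
    (z : PathAlgebra K V) :
    (Ideal.Quotient.mk I z) • x = ∑ d : V, ∑ v : RightSubpathsTo p d,
      MvPolynomial.eval k (reduceLin K p v z) • pathElt I v.1 • x :=
  smul_eq_sum_sum (Ideal.Quotient.mkₐ K I) hx hk z

/-- Multiplication by the vertex `d` isolates the terms belonging to right subpaths that end in `d`.
-/
lemma IsFrame.coeff_eq_zero (hx : IsFrame I p x) (hI : PathAlgebra.IsAdmissible I)
    {f : ∀ d : V, RightSubpathsTo p d → K}
    (h : ∑ d : V, ∑ v : RightSubpathsTo p d, f d v • pathElt I v.1 • x = 0) : f = 0 := by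
  funext d
  refine hx.eq_zero_of_sum hI ?_
  have h1 := congrArg (fun m => vertexElt I d • m) h
  simp only [smul_zero, Finset.smul_sum] at h1
  rw [Finset.sum_eq_single d] at h1
  · rw [← h1]
    exact Finset.sum_congr rfl fun v _ => by rw [smul_comm_K, vertexElt_smul_smul]
  · intro c _ hc
    refine Finset.sum_eq_zero fun v _ => ?_
    rw [smul_comm_K, vertexElt_smul_of_ne (Ne.symm hc) (vertexElt_smul_smul v.1 x), smul_zero]
  · intro h'; exact absurd (Finset.mem_univ _) h'

/-- Since `α u x` lies in `J^(|u|+1) M` and is fixed by the end vertex of `α`, it is a combination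
of the `v x` with `v` longer than `u` and ending there. These are exactly the terms permitted by the
substitution. -/
lemma IsFrame.exists_isCoord (hx : IsFrame I p x) (hI : PathAlgebra.IsAdmissible I) :
    ∃ k : DetourVar p → K, IsCoord I p x k := by
  have h1 : ∀ (c d : V) (α : c ⟶ d) (u : RightSubpathsTo p c), ∃ f : RightSubpathsTo p d → K,
      (∀ v, v.1.length < u.1.length + 1 → f v = 0) ∧
        pathElt I (u.1.cons α) • x = ∑ v, f v • pathElt I v.1 • x := fun c d α u =>
    hx.exists_sum hI (hx.mem_radPow hI (u.1.cons α)) (vertexElt_smul_smul _ x)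
  choose f hf hf' using h1
  refine ⟨fun w => f w.c w.d w.α (RightSubpathsTo.of w.u w.isDetour.1)
    (RightSubpathsTo.of w.v w.isRightSubpath), ?_⟩
  intro c d α u
  by_cases h : IsRightSubpath (u.1.cons α) p
  · rw [Finset.sum_eq_single (RightSubpathsTo.of _ h)]
    · rw [substCoeff_of_isRightSubpath h, if_pos rfl, map_one, one_smul]; rfl
    · intro v _ hv
      rw [substCoeff_of_isRightSubpath h, if_neg hv, map_zero, zero_smul]
    · intro h'; exact absurd (Finset.mem_univ _) h'
  · rw [hf']
    refine Finset.sum_congr rfl fun v _ => ?_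
    -- This also covers pairs that are not detours: then no `v` ending in `d` is longer than `u`,
    -- and all coefficients are zero.
    rw [eval_substCoeff_of_forall K h _ (f c d α u) (fun v hv => hf c d α u v (by omega))]
    rintro w rfl rfl hu rfl
    have hu' : RightSubpathsTo.of w.u w.isDetour.1 = u := Subtype.ext hu
    subst hu'
    rfl

lemma IsFrame.isCoord_unique (hx : IsFrame I p x) (hI : PathAlgebra.IsAdmissible I)
    {k l : DetourVar p → K} (hk : IsCoord I p x k) (hl : IsCoord I p x l) : k = l := by
  funext w
  have h1 := (hk _ _ w.α (RightSubpathsTo.of w.u w.isDetour.1)).symm.trans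
    (hl _ _ w.α (RightSubpathsTo.of w.u w.isDetour.1))
  have h2 := congrFun (hx.coeff_unique hI h1) (RightSubpathsTo.of w.v w.isRightSubpath)
  rwa [substCoeff_detourVar, MvPolynomial.eval_X, MvPolynomial.eval_X] at h2

omit [I.IsTwoSided] in
lemma mem_pathVariety_iff {k : DetourVar p → K} : k ∈ pathVariety I p ↔
    ∀ z ∈ I, ∀ (d : V) (v : RightSubpathsTo p d), MvPolynomial.eval k (reduceLin K p v z) = 0 := by
  rw [pathVariety, MvPolynomial.mem_zeroLocus_iff]
  constructor
  · intro h z hz d v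
    have := h _ (Ideal.subset_span ⟨z, hz, d, v, rfl⟩)
    rw [reduceElt_eq] at this
    exact this
  · intro h f hf
    refine Submodule.span_induction (p := fun f _ => MvPolynomial.eval k f = 0) ?_ ?_ ?_ ?_ hf
    · rintro _ ⟨z, hz, d, v, rfl⟩
      rw [reduceElt_eq]; exact h z hz d v
    · exact map_zero _
    · intro f g _ _ hf hg; rw [map_add, hf, hg, add_zero]
    · intro c f _ hf; rw [smul_eq_mul, map_mul, hf, mul_zero]

/-- An element of `I` acts on `x` as zero, and the `v x` are linearly independent, so all its
reduced coefficients vanish at `k`. -/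
lemma IsFrame.coord_mem_pathVariety (hx : IsFrame I p x) (hI : PathAlgebra.IsAdmissible I)
    {k : DetourVar p → K} (hk : IsCoord I p x k) : k ∈ pathVariety I p := by
  rw [mem_pathVariety_iff]
  intro z hz d v
  have h1 := hk.mk_smul_eq hx.vertex z
  rw [Ideal.Quotient.eq_zero_iff_mem.2 hz, zero_smul] at h1
  exact congrFun (congrFun (hx.coeff_eq_zero hI h1.symm) d) v

/-- Top elements with the same coordinates have the same annihilator. -/
lemma IsFrame.smul_eq_zero_iff (hx : IsFrame I p x) (hI : PathAlgebra.IsAdmissible I)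
    {N : Type u} [AddCommGroup N] [Module (PathAlgebra K V ⧸ I) N]
    [Module K N] [IsScalarTower K (PathAlgebra K V ⧸ I) N] {y : N} (hy : IsFrame I p y)
    {k : DetourVar p → K} (hk : IsCoord I p x k) (hk' : IsCoord I p y k)
    (r : PathAlgebra K V ⧸ I) : r • x = 0 ↔ r • y = 0 := by
  obtain ⟨z, rfl⟩ := Ideal.Quotient.mk_surjective r
  rw [hk.mk_smul_eq hx.vertex, hk'.mk_smul_eq hy.vertex]
  constructor <;> intro h
  · have := hx.coeff_eq_zero hI (f := fun d v => MvPolynomial.eval k (reduceLin K p v z)) h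
    refine Finset.sum_eq_zero fun d _ => Finset.sum_eq_zero fun v _ => ?_
    rw [show MvPolynomial.eval k (reduceLin K p v z) = 0 from congrFun (congrFun this d) v,
      zero_smul]
  · have := hy.coeff_eq_zero hI (f := fun d v => MvPolynomial.eval k (reduceLin K p v z)) h
    refine Finset.sum_eq_zero fun d _ => Finset.sum_eq_zero fun v _ => ?_
    rw [show MvPolynomial.eval k (reduceLin K p v z) = 0 from congrFun (congrFun this d) v,
      zero_smul]

/-- Modules with the same coordinates are isomorphic. -/
lemma IsFrame.nonempty_equiv (hx : IsFrame I p x) (hI : PathAlgebra.IsAdmissible I)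
    {N : Type u} [AddCommGroup N] [Module (PathAlgebra K V ⧸ I) N]
    [Module K N] [IsScalarTower K (PathAlgebra K V ⧸ I) N] {y : N} (hy : IsFrame I p y)
    {k : DetourVar p → K} (hk : IsCoord I p x k) (hk' : IsCoord I p y k) :
    Nonempty (M ≃ₗ[PathAlgebra K V ⧸ I] N) := by
  -- Both modules are cyclic, generated by their top elements, so equality of the two annihilators
  -- suffices.
  have h1 : LinearMap.ker (LinearMap.toSpanSingleton Λ M x) =
      LinearMap.ker (LinearMap.toSpanSingleton Λ N y) := by
    ext r
    exact hx.smul_eq_zero_iff hI hy hk hk' r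
  exact ⟨(LinearMap.quotKerEquivOfSurjective (LinearMap.toSpanSingleton Λ M x)
    (hx.exists_smul_eq hI)).symm ≪≫ₗ Submodule.quotEquivOfEq _ _ h1 ≪≫ₗ
    LinearMap.quotKerEquivOfSurjective (LinearMap.toSpanSingleton Λ N y) (hy.exists_smul_eq hI)⟩

end

end BoundQuiver

/-! ### The module given by a point of affine space -/

section PointSpace

variable {K V : Type u} [Field K] [Quiver.{u} V]

variable (K) in
/-- The vector space with basis the right subpaths of `p`. -/
abbrev PointSpace {a b : V} (p : Quiver.Path a b) : Type u := ∀ c : V, RightSubpathsTo p c → K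

open Classical in
variable (K) in
/-- The basis vector given by a right subpath. -/
def basisVec {a b c : V} {p : Quiver.Path a b} (u : RightSubpathsTo p c) : PointSpace K p :=
  Pi.single c (Pi.single u 1)

/-- The action of an arrow on coordinate vectors. -/
def arrowMap {a b : V} {p : Quiver.Path a b} (k : DetourVar p → K) {c d : V} (α : c ⟶ d) :
    (RightSubpathsTo p c → K) →ₗ[K] (RightSubpathsTo p d → K) where
  toFun f v := ∑ u, MvPolynomial.eval k (substCoeff K p α u v) * f u
  map_add' f g := by
    funext v
    simp only [Pi.add_apply, mul_add, Finset.sum_add_distrib]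
  map_smul' r f := by
    funext v
    simp only [Pi.smul_apply, smul_eq_mul, RingHom.id_apply, Finset.mul_sum]
    exact Finset.sum_congr rfl fun u _ => by ring

/-- The action of a path on coordinate vectors. -/
def pathMap {a b : V} {p : Quiver.Path a b} (k : DetourVar p → K) {c : V} :
    ∀ {d : V}, Quiver.Path c d → ((RightSubpathsTo p c → K) →ₗ[K] (RightSubpathsTo p d → K))
  | _, Quiver.Path.nil => LinearMap.id
  | _, Quiver.Path.cons q α => arrowMap k α ∘ₗ pathMap k q

lemma pathMap_comp {a b : V} {p : Quiver.Path a b} (k : DetourVar p → K) {c d e : V}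
    (q : Quiver.Path c d) (r : Quiver.Path d e) :
    pathMap k (q.comp r) = pathMap k r ∘ₗ pathMap k q := by
  induction r with
  | nil => rfl
  | cons r α ih => rw [Quiver.Path.comp_cons, pathMap, pathMap, ih, LinearMap.comp_assoc]

variable [Fintype V]

open Classical in
/-- The action of the path algebra given by a point of affine space. -/
def pointHom {a b : V} {p : Quiver.Path a b} (k : DetourVar p → K) :
    PathAlgebra K V →ₐ[K] Module.End K (PointSpace K p) :=
  PathAlgebra.liftPaths
    (fun c d q => LinearMap.single K (fun c => RightSubpathsTo p c → K) d ∘ₗ pathMap k q ∘ₗ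
      LinearMap.proj c)
    (by
      refine LinearMap.ext fun f => ?_
      rw [LinearMap.sum_apply]
      exact Finset.univ_sum_single f)
    (by
      intro c d e q r
      refine LinearMap.ext fun f => ?_
      simp [pathMap_comp])
    (by
      intro c d e g q r h
      refine LinearMap.ext fun f => ?_
      simp [Pi.single_eq_of_ne h])

open Classical in
lemma pointHom_ofPath {a b : V} {p : Quiver.Path a b} (k : DetourVar p → K) {c d : V}
    (q : Quiver.Path c d) (f : PointSpace K p) :
    pointHom k (PathAlgebra.ofPath K q) f = Pi.single d (pathMap k q (f c)) := by
  rw [pointHom, PathAlgebra.liftPaths_ofPath]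
  rfl

lemma sum_smul_basisVec {a b : V} {p : Quiver.Path a b} (f : PointSpace K p) :
    f = ∑ c, ∑ u : RightSubpathsTo p c, f c u • basisVec K u := by
  classical
  conv_lhs => rw [← Finset.univ_sum_single f]
  refine Finset.sum_congr rfl fun c _ => ?_
  conv_lhs => rw [← Finset.univ_sum_single (f c)]
  rw [← LinearMap.coe_single K (fun c => RightSubpathsTo p c → K), map_sum]
  refine Finset.sum_congr rfl fun u _ => ?_
  rw [basisVec, ← LinearMap.coe_single K (fun c => RightSubpathsTo p c → K), ← map_smul]
  congr 1
  funext v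
  by_cases h : v = u
  · subst h; simp
  · simp [h]

lemma pointHom_arrow_basisVec {a b : V} {p : Quiver.Path a b} (k : DetourVar p → K) {c d : V}
    (α : c ⟶ d) (u : RightSubpathsTo p c) :
    pointHom k (PathAlgebra.ofPath K α.toPath) (basisVec K u) =
      ∑ v : RightSubpathsTo p d, MvPolynomial.eval k (substCoeff K p α u v) • basisVec K v := by
  classical
  rw [pointHom_ofPath, sum_smul_basisVec (Pi.single d _), Finset.sum_eq_single d]
  · refine Finset.sum_congr rfl fun v _ => ?_
    congr 1
    rw [Pi.single_eq_same, basisVec, Pi.single_eq_same]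
    change ∑ u', MvPolynomial.eval k (substCoeff K p α u' v) * (Pi.single u 1 : _ → K) u' = _
    rw [Finset.sum_eq_single u]
    · rw [Pi.single_eq_same, mul_one]
    · intro w _ hw
      rw [Pi.single_eq_of_ne hw, mul_zero]
    · intro h'; exact absurd (Finset.mem_univ _) h'
  · intro e _ he
    refine Finset.sum_eq_zero fun v _ => ?_
    rw [Pi.single_eq_of_ne he, Pi.zero_apply, zero_smul]
  · intro h'; exact absurd (Finset.mem_univ _) h'

lemma pointHom_cons {a b : V} {p : Quiver.Path a b} (k : DetourVar p → K) {c d e : V}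
    (q : Quiver.Path c d) (α : d ⟶ e) (f : PointSpace K p) :
    pointHom k (PathAlgebra.ofPath K (q.cons α)) f =
      pointHom k (PathAlgebra.ofPath K α.toPath) (pointHom k (PathAlgebra.ofPath K q) f) := by
  rw [← Module.End.mul_apply, ← map_mul, PathAlgebra.ofPath_mul_ofPath,
    Quiver.Path.comp_toPath_eq_cons]

variable (K) in
/-- The basis vector given by the path of length zero. -/
def topVec {a b : V} (p : Quiver.Path a b) : PointSpace K p :=
  basisVec K (RightSubpathsTo.of Quiver.Path.nil (IsRightSubpath.nil p))

lemma pointHom_topVec {a b : V} {p : Quiver.Path a b} (k : DetourVar p → K) {c : V}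
    (u : RightSubpathsTo p c) :
    pointHom k (PathAlgebra.ofPath K u.1) (topVec K p) = basisVec K u := by
  classical
  have key : ∀ {c : V} (u : Quiver.Path a c) (hu : IsRightSubpath u p),
      pointHom k (PathAlgebra.ofPath K u) (topVec K p) = basisVec K (RightSubpathsTo.of u hu) := by
    intro c u hu
    induction u with
    | nil =>
      rw [pointHom_ofPath]
      change (Pi.single a (topVec K p a) : PointSpace K p) = _
      rw [topVec, basisVec, Pi.single_eq_same]
    | cons u α ih =>
      rw [pointHom_cons, ih hu.of_cons, pointHom_arrow_basisVec,
        Finset.sum_eq_single (RightSubpathsTo.of _ hu)]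
      · rw [substCoeff_cons hu, if_pos rfl, map_one, one_smul]
      · intro v _ hv
        rw [substCoeff_cons hu, if_neg hv, map_zero, zero_smul]
      · intro h'; exact absurd (Finset.mem_univ _) h'
  exact key u.1 u.2

/-- Coordinates of a point module. -/
lemma pointHom_isCoord {a b : V} {p : Quiver.Path a b} (k : DetourVar p → K) {c d : V}
    (α : c ⟶ d) (u : RightSubpathsTo p c) :
    pointHom k (PathAlgebra.ofPath K (u.1.cons α)) (topVec K p) =
      ∑ v : RightSubpathsTo p d, MvPolynomial.eval k (substCoeff K p α u v) •
        pointHom k (PathAlgebra.ofPath K v.1) (topVec K p) := by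
  rw [pointHom_cons, pointHom_topVec, pointHom_arrow_basisVec]
  exact Finset.sum_congr rfl fun v _ => by rw [pointHom_topVec]

/-- The equations of `V_p` say precisely that `I` annihilates the top vector. The other basis
vectors are of the form `u` times the top vector, and `z u` is again in `I` because `I` is
two-sided. -/
lemma pointHom_eq_zero {I : Ideal (PathAlgebra K V)} [I.IsTwoSided] {a b : V}
    {p : Quiver.Path a b} {k : DetourVar p → K} (hk : k ∈ pathVariety I p) {z : PathAlgebra K V}
    (hz : z ∈ I) : pointHom k z = 0 := by
  have h1 : ∀ z ∈ I, pointHom k z (topVec K p) = 0 := by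
    intro z hz
    have h2 := smul_eq_sum_sum (pointHom k) (x := topVec K p) (k := k)
      (pointHom_topVec k (RightSubpathsTo.of Quiver.Path.nil (IsRightSubpath.nil p)))
      (fun c d α u => pointHom_isCoord k α u) z
    rw [Module.End.smul_def] at h2
    rw [h2]
    refine Finset.sum_eq_zero fun d _ => Finset.sum_eq_zero fun v _ => ?_
    rw [mem_pathVariety_iff.1 hk z hz d v, zero_smul]
  refine LinearMap.ext fun f => ?_
  rw [sum_smul_basisVec f, map_sum, LinearMap.zero_apply]
  refine Finset.sum_eq_zero fun c _ => ?_
  rw [map_sum]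
  refine Finset.sum_eq_zero fun u _ => ?_
  rw [map_smul, ← pointHom_topVec k u, ← Module.End.mul_apply, ← map_mul,
    h1 _ (I.mul_mem_right _ hz), smul_zero]

/-- The filtration of the space by the lengths of right subpaths. -/
def lengthFil {a b : V} (p : Quiver.Path a b) (i : ℕ) : Submodule K (PointSpace K p) where
  carrier := {f | ∀ (c : V) (v : RightSubpathsTo p c), v.1.length < i → f c v = 0}
  add_mem' hf hg c v h := by rw [Pi.add_apply, Pi.add_apply, hf c v h, hg c v h, add_zero]
  zero_mem' _ _ _ := rfl
  smul_mem' r f hf c v h := by rw [Pi.smul_apply, Pi.smul_apply, hf c v h, smul_zero]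

omit [Fintype V] in
lemma basisVec_mem_lengthFil {a b c : V} {p : Quiver.Path a b} (u : RightSubpathsTo p c) :
    basisVec K u ∈ lengthFil p u.1.length := by
  classical
  intro d v h
  rw [basisVec]
  by_cases hd : d = c
  · subst hd
    rw [Pi.single_eq_same, Pi.single_eq_of_ne]
    rintro rfl
    exact lt_irrefl _ h
  · rw [Pi.single_eq_of_ne hd]; rfl

omit [Fintype V] in
lemma lengthFil_anti {a b : V} {p : Quiver.Path a b} {i j : ℕ} (h : i ≤ j) :
    lengthFil (K := K) p j ≤ lengthFil p i := fun _ hf c v hv => hf c v (by omega)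

omit [Fintype V] in
lemma lengthFil_eq_bot {a b : V} (p : Quiver.Path a b) :
    lengthFil (K := K) p (p.length + 1) = ⊥ := by
  rw [eq_bot_iff]
  intro f hf
  rw [Submodule.mem_bot]
  funext c v
  exact hf c v (Nat.lt_succ_of_le v.2.length_le)

lemma pointHom_arrow_mem_lengthFil {a b : V} {p : Quiver.Path a b} (k : DetourVar p → K) {c d : V}
    (α : c ⟶ d) {i : ℕ} {f : PointSpace K p} (hf : f ∈ lengthFil p i) :
    pointHom k (PathAlgebra.ofPath K α.toPath) f ∈ lengthFil p (i + 1) := by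
  classical
  rw [pointHom_ofPath]
  intro e v h
  by_cases he : e = d
  · subst he
    rw [Pi.single_eq_same]
    change ∑ u, MvPolynomial.eval k (substCoeff K p α u v) * f c u = 0
    refine Finset.sum_eq_zero fun u _ => ?_
    rcases Nat.lt_or_ge u.1.length i with h1 | h1
    · rw [hf c u h1, mul_zero]
    · rw [substCoeff_of_length_le α u v (by omega), map_zero, zero_mul]
  · rw [Pi.single_eq_of_ne he]; rfl

omit [Fintype V] in
lemma sub_smul_basisVec_mem {a b c : V} {p : Quiver.Path a b} (u : RightSubpathsTo p c)
    {f : PointSpace K p} (hf : f ∈ lengthFil p u.1.length) :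
    f - f c u • basisVec K u ∈ lengthFil p (u.1.length + 1) := by
  classical
  intro d v h
  rcases Nat.lt_or_ge v.1.length u.1.length with h1 | h1
  · rw [Pi.sub_apply, Pi.sub_apply, Pi.smul_apply, Pi.smul_apply, hf d v h1,
      basisVec_mem_lengthFil u d v h1, smul_zero, sub_zero]
  · obtain ⟨u, hu⟩ := u
    obtain ⟨v, hv⟩ := v
    cases IsRightSubpath.sigma_eq hu hv (by change u.length ≤ v.length at h1
                                            change v.length < u.length + 1 at h; omega)
    have hb : ∀ w : RightSubpathsTo p c, f c w - f c w * basisVec K w c w = 0 := fun w => by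
      rw [basisVec, Pi.single_eq_same, Pi.single_eq_same, mul_one, sub_self]
    exact hb (RightSubpathsTo.of u hu)

end PointSpace

-- The `Λ`-modules attached to points of `V_p`

section PointModule

variable {K V : Type u} [Field K] [Quiver.{u} V] [Fintype V]
variable {I : Ideal (PathAlgebra K V)} [I.IsTwoSided]

local notation "Λ" => (PathAlgebra K V ⧸ I)

/-- The action of `Λ` given by a point of the variety `V_p`. -/
def quotPointHom {a b : V} {p : Quiver.Path a b} {k : DetourVar p → K}
    (hk : k ∈ pathVariety I p) : (PathAlgebra K V ⧸ I) →ₐ[K] Module.End K (PointSpace K p) :=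
  Ideal.Quotient.liftₐ I (pointHom k) fun _ hz => pointHom_eq_zero hk hz

/-- The `Λ`-module given by a point of the variety `V_p`. -/
def PointModule {a b : V} {p : Quiver.Path a b} {k : DetourVar p → K}
    (_ : k ∈ pathVariety I p) : Type u := PointSpace K p

variable {a b : V} {p : Quiver.Path a b} {k : DetourVar p → K} (hk : k ∈ pathVariety I p)

instance : AddCommGroup (PointModule hk) := inferInstanceAs (AddCommGroup (PointSpace K p))

instance : Module K (PointModule hk) := inferInstanceAs (Module K (PointSpace K p))

instance : Module (PathAlgebra K V ⧸ I) (PointModule hk) :=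
  Module.compHom (PointSpace K p) (quotPointHom hk).toRingHom

lemma PointModule.smul_def (r : PathAlgebra K V ⧸ I) (m : PointModule hk) :
    r • m = quotPointHom hk r m := rfl

instance : IsScalarTower K (PathAlgebra K V ⧸ I) (PointModule hk) where
  smul_assoc c r m := by
    rw [PointModule.smul_def, PointModule.smul_def, map_smul]
    rfl

/-- The top element of a point module. -/
def PointModule.top : PointModule hk := topVec K p

lemma PointModule.isCoord : IsCoord I p (PointModule.top hk) k := fun _ _ α u =>
  pointHom_isCoord k α u

lemma PointModule.pathElt_smul_top {c : V} (u : RightSubpathsTo p c) :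
    pathElt I u.1 • PointModule.top hk = basisVec K u := pointHom_topVec k u

/-- The filtration of a point module by the lengths of right subpaths. -/
def PointModule.fil (i : ℕ) : Submodule K (PointModule hk) := lengthFil p i

/-- Arrows raise the length filtration by at least one, which gives one inclusion. For the other,
the basis vector of `u` is `u` applied to the top vector and hence lies in `J^|u|`. -/
lemma PointModule.mem_radPow_iff (hI : PathAlgebra.IsAdmissible I) {i : ℕ} {m : PointModule hk} :
    m ∈ radPow Λ (PointModule hk) i ↔ (m : PointSpace K p) ∈ lengthFil p i := by
  constructor
  · intro hm
    induction i generalizing m with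
    | zero => exact fun c v h => absurd h (Nat.not_lt_zero _)
    | succ i ih =>
      exact radPow_succ_induction hI (PointModule.fil hk (i + 1))
        (fun c d α n hn => pointHom_arrow_mem_lengthFil k α (ih hn)) hm
  · intro hm
    have h1 : m = ∑ c, ∑ u : RightSubpathsTo p c, (m : PointSpace K p) c u •
        (pathElt I u.1 • PointModule.top hk) := by
      simp only [PointModule.pathElt_smul_top]
      exact sum_smul_basisVec (m : PointSpace K p)
    rw [h1]
    refine sum_mem fun c _ => sum_mem fun u _ => ?_
    rcases Nat.lt_or_ge u.1.length i with h | h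
    · rw [hm c u h, zero_smul]; exact zero_mem _
    · exact smul_mem_radPow_K _ (radPow_anti h (pathElt_smul_mem_radPow' hI _ _))

/-- This is the converse of `IsFrame.coord_mem_pathVariety`: together with `PointModule.isCoord` it
realises every point of `V_p` by a uniserial module with mast `p`. -/
lemma PointModule.isFrame (hI : PathAlgebra.IsAdmissible I) :
    IsFrame I p (PointModule.top hk) where
  vertex := PointModule.pathElt_smul_top hk
    (RightSubpathsTo.of Quiver.Path.nil (IsRightSubpath.nil p))
  chain := by
    refine chain_of_layers (K := K) hI fun i => ?_
    rcases Nat.lt_or_ge p.length i with h | h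
    · refine ⟨0, fun n hn => ⟨0, ?_⟩⟩
      rw [zero_smul, sub_zero]
      rw [PointModule.mem_radPow_iff hk hI] at hn ⊢
      have h1 := lengthFil_anti (show p.length + 1 ≤ i from h) hn
      rw [lengthFil_eq_bot] at h1
      have h2 : n = 0 := h1
      rw [h2]
      exact zero_mem _
    · obtain ⟨c, u, hu, rfl⟩ := IsRightSubpath.exists_length p h
      refine ⟨basisVec K (RightSubpathsTo.of u hu), fun n hn =>
        ⟨(n : PointSpace K p) c (RightSubpathsTo.of u hu), ?_⟩⟩
      rw [PointModule.mem_radPow_iff hk hI] at hn ⊢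
      exact sub_smul_basisVec_mem (RightSubpathsTo.of u hu) hn
  ne := by
    classical
    rw [show pathElt I p • PointModule.top hk =
      basisVec K (RightSubpathsTo.of p (IsRightSubpath.refl p)) from
      PointModule.pathElt_smul_top hk (RightSubpathsTo.of p (IsRightSubpath.refl p))]
    intro h
    have h1 := congrFun (congrFun h b) (RightSubpathsTo.of p (IsRightSubpath.refl p))
    rw [basisVec, Pi.single_eq_same, Pi.single_eq_same] at h1
    exact one_ne_zero h1
  bot := by
    rw [eq_bot_iff]
    intro m hm
    rw [PointModule.mem_radPow_iff hk hI, lengthFil_eq_bot] at hm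
    exact hm

end PointModule

section BoundQuiver

variable {K V : Type u} [Field K] [Quiver.{u} V] [Fintype V]
variable {I : Ideal (PathAlgebra K V)} [I.IsTwoSided]

local notation "Λ" => (PathAlgebra K V ⧸ I)

/-! ### Condition (N) in terms of paths -/

lemma mem_of_ofPath_mem_span {T : Set (AllPaths V)} {a b : V} {p : Quiver.Path a b}
    (h : PathAlgebra.ofPath K p ∈ Submodule.span K (PathAlgebra.pathBasis K V '' T)) :
    (⟨a, b, p⟩ : AllPaths V) ∈ T := by
  rw [Module.Basis.mem_span_image, PathAlgebra.ofPath, Module.Basis.repr_self] at h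
  apply h
  simp

/-- All products `z α` lie in the span of the paths starting with `α`, and a path in the span of a
set of paths belongs to that set. -/
lemma exists_eq_toPath_comp {e e' : V} {α : e ⟶ e'} {p : Quiver.Path e e'}
    (h : ∃ z : PathAlgebra K V, PathAlgebra.ofPath K p = z * PathAlgebra.ofPath K α.toPath) :
    IsRightSubpath α.toPath p := by
  obtain ⟨z, hz⟩ := h
  have h1 : ∀ z : PathAlgebra K V, z * PathAlgebra.ofPath K α.toPath ∈
      Submodule.span K (PathAlgebra.pathBasis K V ''
        {x | ∃ (d : V) (q : Quiver.Path e' d), x = ⟨e, d, α.toPath.comp q⟩}) := by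
    intro z
    have hz : z ∈ Submodule.span K (Set.range (PathAlgebra.pathBasis K V)) := by
      rw [Module.Basis.span_eq]; trivial
    induction hz using Submodule.span_induction with
    | mem x hx =>
      obtain ⟨⟨c, d, q⟩, rfl⟩ := hx
      change PathAlgebra.ofPath K q * _ ∈ _
      by_cases hc : c = e'
      · subst hc
        rw [PathAlgebra.ofPath_mul_ofPath]
        exact Submodule.subset_span ⟨_, ⟨d, q, rfl⟩, rfl⟩
      · rw [PathAlgebra.ofPath_mul_ofPath_of_ne _ _ hc]; exact zero_mem _
    | zero => rw [zero_mul]; exact zero_mem _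
    | add x y _ _ hx hy => rw [add_mul]; exact add_mem hx hy
    | smul c x _ hx => rw [smul_mul_assoc]; exact Submodule.smul_mem _ _ hx
  obtain ⟨d, q, hq⟩ := mem_of_ofPath_mem_span (hz ▸ h1 z)
  cases hq
  exact ⟨q, rfl⟩

lemma exists_eq_cons {e e' : V} {α : e ⟶ e'} {p : Quiver.Path e e'}
    (h : ∃ z : PathAlgebra K V, PathAlgebra.ofPath K p = PathAlgebra.ofPath K α.toPath * z) :
    ∃ q : Quiver.Path e e, p = q.cons α := by
  obtain ⟨z, hz⟩ := h
  have h1 : ∀ z : PathAlgebra K V, PathAlgebra.ofPath K α.toPath * z ∈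
      Submodule.span K (PathAlgebra.pathBasis K V ''
        {x | ∃ (d : V) (q : Quiver.Path d e), x = ⟨d, e', q.cons α⟩}) := by
    intro z
    have hz : z ∈ Submodule.span K (Set.range (PathAlgebra.pathBasis K V)) := by
      rw [Module.Basis.span_eq]; trivial
    induction hz using Submodule.span_induction with
    | mem x hx =>
      obtain ⟨⟨c, d, q⟩, rfl⟩ := hx
      change _ * PathAlgebra.ofPath K q ∈ _
      by_cases hc : e = d
      · subst hc
        rw [PathAlgebra.ofPath_mul_ofPath]
        exact Submodule.subset_span ⟨_, ⟨c, q, rfl⟩, rfl⟩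
      · rw [PathAlgebra.ofPath_mul_ofPath_of_ne _ _ hc]; exact zero_mem _
    | zero => rw [mul_zero]; exact zero_mem _
    | add x y _ _ hx hy => rw [mul_add]; exact add_mem hx hy
    | smul c x _ hx => rw [mul_smul_comm]; exact Submodule.smul_mem _ _ hx
  obtain ⟨d, q, hq⟩ := mem_of_ofPath_mem_span (hz ▸ h1 z)
  cases hq
  exact ⟨q, rfl⟩

variable (I) in
/-- Condition (N) in terms of paths. -/
lemma conditionN_iff : ConditionN I ↔ ∀ (e e' : V) (α : e ⟶ e') (p : Quiver.Path e e'),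
    0 < p.length → IsMast I p → IsRightSubpath α.toPath p ∨ ∃ q : Quiver.Path e e, p = q.cons α := by
  constructor
  · intro h e e' α p hp hm
    exact (h e e' α p hp hm).imp exists_eq_toPath_comp exists_eq_cons
  · intro h e e' α p hp hm
    refine (h e e' α p hp hm).imp ?_ ?_
    · rintro ⟨q, rfl⟩
      exact ⟨PathAlgebra.ofPath K q, (PathAlgebra.ofPath_mul_ofPath _ _).symm⟩
    · rintro ⟨q, rfl⟩
      exact ⟨PathAlgebra.ofPath K q, (PathAlgebra.ofPath_mul_ofPath q α.toPath).symm⟩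

/-! ### The basis of a framed module -/

section

variable {M : Type u} [AddCommGroup M] [Module (PathAlgebra K V ⧸ I) M]
variable [Module K M] [IsScalarTower K (PathAlgebra K V ⧸ I) M]
variable {a b : V} {p : Quiver.Path a b} {x : M}

/-- The basis of a framed module consisting of the `u x`, where `u` runs through the right subpaths
of the mast. -/
def IsFrame.basis (hx : IsFrame I p x) (hI : PathAlgebra.IsAdmissible I) :
    Module.Basis (Σ c, RightSubpathsTo p c) K M :=
  Module.Basis.mk (v := fun s : Σ c, RightSubpathsTo p c => pathElt I s.2.1 • x)
    (by
      rw [Fintype.linearIndependent_iff]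
      intro g hg s
      rw [Fintype.sum_sigma] at hg
      exact congrFun (congrFun (hx.coeff_eq_zero hI (f := fun c v => g ⟨c, v⟩) hg) s.1) s.2)
    (by
      intro m _
      refine Submodule.span_mono ?_ (hx.mem_span hI (i := 0) (n := m) trivial)
      rintro _ ⟨c, v, hv, -, rfl⟩
      exact ⟨⟨c, RightSubpathsTo.of v hv⟩, rfl⟩)

lemma IsFrame.basis_apply (hx : IsFrame I p x) (hI : PathAlgebra.IsAdmissible I) {c : V}
    (u : RightSubpathsTo p c) : hx.basis hI ⟨c, u⟩ = pathElt I u.1 • x := by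
  rw [IsFrame.basis, Module.Basis.mk_apply]

/-- The coefficient of `u x`. -/
lemma IsFrame.exists_coeff (hx : IsFrame I p x) (hI : PathAlgebra.IsAdmissible I) {c : V}
    {u : Quiver.Path a c} (hu : IsRightSubpath u p) :
    ∃ f : M →ₗ[K] K, f (pathElt I u • x) = 1 ∧ ∀ (d : V) (v : Quiver.Path a d),
      IsRightSubpath v p → v.length ≠ u.length → f (pathElt I v • x) = 0 := by
  classical
  refine ⟨(hx.basis hI).coord ⟨c, RightSubpathsTo.of u hu⟩, ?_, ?_⟩
  · rw [show pathElt I u • x = _ from (hx.basis_apply hI (RightSubpathsTo.of u hu)).symm, Module.Basis.coord_apply,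
      Module.Basis.repr_self, Finsupp.single_eq_same]
  · intro d v hv h
    rw [show pathElt I v • x = _ from (hx.basis_apply hI (RightSubpathsTo.of v hv)).symm, Module.Basis.coord_apply,
      Module.Basis.repr_self, Finsupp.single_eq_of_ne]
    intro h'
    apply h
    cases h'
    rfl

end

/-! ### Finite uniserial type implies condition (N) -/

section FiniteType

variable {M : Type u} [AddCommGroup M] [Module (PathAlgebra K V ⧸ I) M]
variable [Module K M] [IsScalarTower K (PathAlgebra K V ⧸ I) M]

variable (I) in
/-- The path `p` is a mast which violates condition (N) for the arrow `α`, while all shorter masts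
satisfy it for `α`. -/
structure IsMinimalViolation {e e' : V} (α : e ⟶ e') (p : Quiver.Path e e') : Prop where
  pos : 0 < p.length
  start : ¬ IsRightSubpath α.toPath p
  ending : ∀ q : Quiver.Path e e, p ≠ q.cons α
  mast : IsMast I p
  minimal : ∀ p' : Quiver.Path e e', p'.length < p.length → 0 < p'.length → IsMast I p' →
    IsRightSubpath α.toPath p' ∨ ∃ q : Quiver.Path e e, p' = q.cons α

namespace IsMinimalViolation

variable {e e' : V} {α : e ⟶ e'} {p : Quiver.Path e e'}

/-- Write `p = p' v`. Then `p'` is a shorter mast from `e` to `e'`. By minimality it starts with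
`α`, as wanted, or ends with `α`, in which case `p` would also end with `α`. -/
lemma cons_isRightSubpath (h : IsMinimalViolation I α p) (hI : PathAlgebra.IsAdmissible I)
    {v : Quiver.Path e e} (hv : IsRightSubpath v p) (hv0 : 0 < v.length)
    (hv1 : v.length ≠ p.length) : IsRightSubpath (v.cons α) p := by
  obtain ⟨p', hp⟩ := hv
  have hl := congrArg Quiver.Path.length hp
  rw [Quiver.Path.length_comp] at hl
  rcases h.minimal p' (by omega) (by omega)
    (h.mast.of_comp hI (u := v) (hp ▸ IsRightSubpath.refl (v.comp p'))) with ⟨q, hq⟩ | ⟨q, hq⟩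
  · refine ⟨q, ?_⟩
    rw [hp, hq, ← Quiver.Path.comp_assoc]
    rfl
  · exact absurd (by rw [hp, hq, Quiver.Path.comp_cons]) (h.ending (v.comp q))

/-- The path `w` is itself a shorter mast from `e` to `e'`. It cannot start with `α` because `p`
does not, so it ends with `α`; for the same reason what precedes this `α` is not trivial. -/
lemma exists_eq_cons (h : IsMinimalViolation I α p) (hI : PathAlgebra.IsAdmissible I)
    {w : Quiver.Path e e'} (hw : IsRightSubpath w p) (hw0 : 0 < w.length)
    (hw1 : w.length ≠ p.length) : ∃ v : Quiver.Path e e, 0 < v.length ∧ w = v.cons α := by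
  have hl := hw.length_le
  have hm : IsMast I w := h.mast.of_comp hI (u := Quiver.Path.nil) (by
    rwa [Quiver.Path.nil_comp])
  rcases h.minimal w (by omega) hw0 hm with h1 | ⟨q, rfl⟩
  · exact absurd (h1.trans hw) h.start
  · refine ⟨q, ?_, rfl⟩
    by_contra hq
    cases Quiver.Path.eq_nil_of_length_zero q (by omega)
    exact h.start hw

/-- The scalar `t` with `α x = t p x` does not depend on the top element `x`. -/
lemma scalar_unique (h : IsMinimalViolation I α p) (hI : PathAlgebra.IsAdmissible I) {x y : M}
    (hx : IsFrame I p x) (hy : IsFrame I p y) {t s : K}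
    (ht : pathElt I α.toPath • x = t • pathElt I p • x)
    (hs : pathElt I α.toPath • y = s • pathElt I p • y) : t = s := by
  obtain ⟨f, hf, hf'⟩ := hx.exists_coeff hI (IsRightSubpath.refl p)
  have hnil : pathElt I (Quiver.Path.nil : Quiver.Path e e) • x = x := hx.vertex
  obtain ⟨c, hc⟩ := hx.exists_sub_smul_mem hI (IsRightSubpath.nil p) (n := y) trivial
  rw [hnil] at hc
  have hc' : y - c • x ∈ radPow Λ M 1 := hc
  obtain ⟨k, hk, hk'⟩ := hx.exists_sum hI hc'
    (by rw [smul_sub, hy.vertex, smul_comm_K, hx.vertex])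
  -- The difference is a combination of `v x` with `v` a cycle of positive length. For each such
  -- `v`, either `v` has the length of `p` and `α v x = 0`, or `α v` is a right subpath different
  -- from `p`. In neither case is there a contribution to the coefficient of `p x`.
  have h1 : f (pathElt I α.toPath • (y - c • x)) = 0 := by
    rw [hk', Finset.smul_sum, map_sum]
    refine Finset.sum_eq_zero fun v _ => ?_
    rw [smul_comm_K, toPath_smul_pathElt_smul, map_smul]
    by_cases hv0 : v.1.length < 1
    · rw [hk v hv0, zero_smul]
    by_cases hv1 : v.1.length = p.length
    · have h2 := hx.mem_radPow hI (v.1.cons α)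
      rw [Quiver.Path.length_cons, hv1, hx.bot, Submodule.mem_bot] at h2
      rw [h2, map_zero, smul_zero]
    · have h2 := h.cons_isRightSubpath hI v.2 (by omega) hv1
      rw [hf' _ _ h2, smul_zero]
      intro h3
      exact h.ending _ (h2.eq_of_length (IsRightSubpath.refl p) h3).symm
  have h2 : pathElt I p • y = c • pathElt I p • x := by
    have := pathElt_smul_mem_radPow hI p hc'
    rwa [add_comm, hx.bot, Submodule.mem_bot, smul_sub, sub_eq_zero, smul_comm_K] at this
  rw [smul_sub, hs, h2, smul_comm_K, ht, smul_smul, smul_smul, map_sub, LinearMap.map_smul,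
    LinearMap.map_smul, hf, smul_eq_mul, smul_eq_mul, mul_one, mul_one] at h1
  have hc0 : c ≠ 0 := by
    rintro rfl
    rw [zero_smul] at h2
    exact hy.ne h2
  have h3 : c * (s - t) = 0 := by linear_combination h1
  exact (sub_eq_zero.1 ((mul_eq_zero.1 h3).resolve_left hc0)).symm

/-- By `exists_eq_cons` every term of `α x` other than the one at `p x` is a multiple of some `α v
x` with `v` a cycle of positive length. Subtracting the corresponding combination of the `v x` from
the top element removes these terms and does not change `p x`. -/
lemma exists_frame (h : IsMinimalViolation I α p) (hI : PathAlgebra.IsAdmissible I) {x : M}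
    (hx : IsFrame I p x) :
    ∃ (y : M) (t : K), IsFrame I p y ∧ pathElt I α.toPath • y = t • pathElt I p • y := by
  -- The elements `α z + t p x` with `z` in `JM` and fixed by `e`. They form a subspace, so that `α
  -- x` can be placed in it term by term.
  let D : Submodule K M :=
    { carrier := {m | ∃ (z : M) (t : K), z ∈ radPow Λ M 1 ∧ vertexElt I e • z = z ∧
        m = pathElt I α.toPath • z + t • pathElt I p • x}
      zero_mem' := ⟨0, 0, zero_mem _, smul_zero _, by simp⟩
      add_mem' := by
        rintro _ _ ⟨z, t, hz, hz', rfl⟩ ⟨z', t', hw, hw', rfl⟩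
        refine ⟨z + z', t + t', add_mem hz hw, by rw [smul_add, hz', hw'], ?_⟩
        rw [smul_add, add_smul]
        abel
      smul_mem' := by
        rintro c _ ⟨z, t, hz, hz', rfl⟩
        refine ⟨c • z, c * t, smul_mem_radPow_K c hz, by rw [smul_comm_K, hz'], ?_⟩
        rw [smul_add, smul_comm_K, mul_smul] }
  obtain ⟨k, hk, hk'⟩ := hx.exists_sum hI (i := 1) (d := e')
    (pathElt_smul_mem_radPow' hI α.toPath x) (vertexElt_smul_smul _ x)
  have h1 : pathElt I α.toPath • x ∈ D := by
    rw [hk']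
    refine sum_mem fun w _ => ?_
    by_cases hw0 : w.1.length < 1
    · rw [hk w hw0, zero_smul]; exact zero_mem _
    refine Submodule.smul_mem _ _ ?_
    by_cases hw1 : w.1.length = p.length
    · refine ⟨0, 1, zero_mem _, smul_zero _, ?_⟩
      rw [w.2.eq_of_length (IsRightSubpath.refl p) hw1]
      simp
    · obtain ⟨v, hv0, hv⟩ := h.exists_eq_cons hI w.2 (by omega) hw1
      refine ⟨pathElt I v • x, 0, radPow_anti hv0 (hx.mem_radPow hI v), vertexElt_smul_smul v x, ?_⟩
      rw [toPath_smul_pathElt_smul, hv]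
      simp
  obtain ⟨z, t, hz, hz', hzt⟩ := h1
  refine ⟨x - z, t, hx.sub_frame hI hz hz', ?_⟩
  have h2 : pathElt I p • z = 0 := by
    have := pathElt_smul_mem_radPow hI p hz
    rwa [add_comm, hx.bot, Submodule.mem_bot] at this
  rw [smul_sub, smul_sub, h2, sub_zero, hzt]
  abel

/-- The variable attached to the detour `(α, e)` and the path `p` itself. -/
def var (h : IsMinimalViolation I α p) : DetourVar p where
  c := e
  d := e'
  u := Quiver.Path.nil
  α := α
  v := p
  isDetour := ⟨IsRightSubpath.nil p, h.start, p, IsRightSubpath.refl p, h.pos⟩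
  isRightSubpath := IsRightSubpath.refl p
  length_lt := h.pos

end IsMinimalViolation

-- Substitution never replaces a path by a shorter one.
omit [Fintype V] in
lemma reducePath_of_length_lt {a b : V} {p : Quiver.Path a b} {d : V} (q : Quiver.Path a d)
    (v : RightSubpathsTo p d) (h : v.1.length < q.length) : reducePath K p q v = 0 := by
  induction q with
  | nil => simp at h
  | cons q β ih =>
    rw [reducePath]
    refine Finset.sum_eq_zero fun u _ => ?_
    rw [Quiver.Path.length_cons] at h
    rcases Nat.lt_or_ge u.1.length q.length with h1 | h1
    · rw [ih u h1, mul_zero]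
    · rw [substCoeff_of_length_le β u v (by omega), zero_mul]

omit [Fintype V] in
lemma eval_substCoeff_update {a b : V} {p : Quiver.Path a b} (w : DetourVar p)
    [DecidableEq (DetourVar p)] (k : DetourVar p → K)
    (t : K) {c d : V} (β : c ⟶ d) (u : RightSubpathsTo p c) (v : RightSubpathsTo p d)
    (h : u.1.length ≠ w.u.length ∨ v.1.length ≠ w.v.length) :
    MvPolynomial.eval (Function.update k w t) (substCoeff K p β u v) =
      MvPolynomial.eval k (substCoeff K p β u v) := by
  classical
  rw [substCoeff]
  split_ifs with h1 h2
  · simp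
  · rw [MvPolynomial.eval_X, MvPolynomial.eval_X, Function.update_of_ne]
    rintro rfl
    rcases h with h | h <;> exact h rfl
  · simp

namespace IsMinimalViolation

variable {e e' : V} {α : e ⟶ e'} {p : Quiver.Path e e'}

/-- The variable enters only where `α` acts on the trivial path and `p` is then selected. The
trivial path occurs only in the reduction of a trivial path, and every arrow sends `p` to zero. So
the variable can appear only in the coefficient of `p` in the reduction of a single arrow, which
`hqv` excludes. -/
lemma eval_reducePath_update (h : IsMinimalViolation I α p) [DecidableEq (DetourVar p)]
    (k : DetourVar p → K) (t : K) {d : V} (q : Quiver.Path e d) (v : RightSubpathsTo p d)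
    (hq : 0 < q.length) (hqv : 2 ≤ q.length ∨ v.1.length < p.length) :
    MvPolynomial.eval (Function.update k h.var t) (reducePath K p q v) =
      MvPolynomial.eval k (reducePath K p q v) := by
  induction q with
  | nil => simp at hq
  | cons q β ih =>
    rw [reducePath, map_sum, map_sum]
    refine Finset.sum_congr rfl fun u _ => ?_
    rw [map_mul, map_mul]
    rcases Nat.eq_zero_or_pos q.length with hq0 | hq0
    · cases Quiver.Path.eq_of_length_zero q hq0
      cases Quiver.Path.eq_nil_of_length_zero q hq0
      have hv : v.1.length < p.length := hqv.resolve_left (by simp)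
      rw [eval_substCoeff_update _ _ _ _ _ _ (Or.inr hv.ne)]
      congr 1
      rw [reducePath]
      split_ifs <;> simp
    · rcases Nat.lt_or_ge u.1.length p.length with hu | hu
      · rw [ih u hq0 (Or.inr hu)]
        rcases Nat.eq_zero_or_pos u.1.length with hu0 | hu0
        · rw [reducePath_of_length_lt q u (by omega), map_zero, mul_zero, mul_zero]
        · rw [eval_substCoeff_update _ _ _ _ _ _ (Or.inl hu0.ne')]
      · rw [substCoeff_of_length_le β u v (v.2.length_le.trans hu), map_zero, zero_mul, map_zero,
          zero_mul]

/-- Relations in `I` involve only paths of length at least two, whose reductions are independent of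
the variable. -/
lemma update_mem_pathVariety (h : IsMinimalViolation I α p) (hI : PathAlgebra.IsAdmissible I)
    [DecidableEq (DetourVar p)] {k : DetourVar p → K} (hk : k ∈ pathVariety I p) (t : K) :
    Function.update k h.var t ∈ pathVariety I p := by
  rw [mem_pathVariety_iff] at hk ⊢
  intro z hz d v
  rw [← hk z hz d v]
  have h1 := hI.2 (show z ∈ I.restrictScalars K from hz)
  refine Submodule.span_induction (p := fun z _ =>
    MvPolynomial.eval (Function.update k h.var t) (reduceLin K p v z) =
      MvPolynomial.eval k (reduceLin K p v z)) ?_ ?_ ?_ ?_ h1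
  · rintro _ ⟨a', d', q, hq, rfl⟩
    by_cases h2 : a' = e ∧ d' = d
    · obtain ⟨rfl, rfl⟩ := h2
      rw [reduceLin_ofPath]
      exact h.eval_reducePath_update k t q v (by omega) (Or.inl hq)
    · rw [reduceLin_ofPath_of_ne _ _ _ h2, map_zero, map_zero]
  · simp
  · intro y z _ _ hy hz
    rw [map_add, map_add, map_add, hy, hz]
  · intro c z _ hz
    rw [map_smul, MvPolynomial.smul_eval, MvPolynomial.smul_eval, hz]

open scoped ModuleCat.Algebra in
/-- A minimal violation of condition (N) leads to a one-parameter family of pairwise non-isomorphic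
uniserial modules. -/
lemma exists_family (h : IsMinimalViolation I α p) (hI : PathAlgebra.IsAdmissible I) :
    ∃ k : K → DetourVar p → K, ∃ hk : ∀ t, k t ∈ pathVariety I p,
      ∀ t, pathElt I α.toPath • PointModule.top (hk t) =
        t • pathElt I p • PointModule.top (hk t) := by
  classical
  obtain ⟨U, hU⟩ := h.mast
  obtain ⟨x, hx⟩ := (isMastOf_iff hI).1 hU
  obtain ⟨y, t₀, hy, hyt⟩ := h.exists_frame (K := K) hI hx
  obtain ⟨k, hk⟩ := hy.exists_isCoord (K := K) hI
  have hkV := hy.coord_mem_pathVariety hI hk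
  refine ⟨fun t => Function.update k h.var t, fun t => h.update_mem_pathVariety hI hkV t,
    fun t => ?_⟩
  have hp := IsRightSubpath.refl p
  have hn := IsRightSubpath.nil p
  -- In the normalised frame `α y = t₀ p y`, so the substitution for `α` has no term apart from the
  -- one at `p`; after the update that coefficient is `t`.
  have h1 : ∀ v : RightSubpathsTo p e', v.1.length ≠ p.length →
      MvPolynomial.eval k (substCoeff K p α (RightSubpathsTo.of Quiver.Path.nil hn) v) = 0 := by
    intro v hv
    have h2 := hk e e' α (RightSubpathsTo.of Quiver.Path.nil hn)
    have h3 : pathElt I ((RightSubpathsTo.of Quiver.Path.nil hn).1.cons α) • y =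
        ∑ v : RightSubpathsTo p e', (Pi.single (RightSubpathsTo.of p hp) t₀ : _ → K) v •
          pathElt I v.1 • y := by
      rw [Finset.sum_eq_single (RightSubpathsTo.of p hp), Pi.single_eq_same]
      · exact hyt
      · intro w _ hw
        rw [Pi.single_eq_of_ne hw, zero_smul]
      · intro h'; exact absurd (Finset.mem_univ _) h'
    have h4 := congrFun (hy.coeff_unique hI (h2.symm.trans h3)) v
    rw [h4, Pi.single_eq_of_ne]
    rintro rfl
    exact hv rfl
  have h5 := PointModule.isCoord (h.update_mem_pathVariety hI hkV t) e e' α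
    (RightSubpathsTo.of Quiver.Path.nil hn)
  refine h5.trans ?_
  rw [Finset.sum_eq_single (RightSubpathsTo.of p hp)]
  · have h6 := substCoeff_detourVar (K := K) h.var
    change substCoeff K p α (RightSubpathsTo.of Quiver.Path.nil hn) (RightSubpathsTo.of p hp) =
      MvPolynomial.X h.var at h6
    rw [h6, MvPolynomial.eval_X, Function.update_self]
    rfl
  · intro v _ hv
    have hv' : v.1.length ≠ p.length := fun h' => hv (RightSubpathsTo.ext h')
    rw [eval_substCoeff_update _ _ _ _ _ _ (Or.inr hv'), h1 v hv', zero_smul]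
  · intro h'; exact absurd (Finset.mem_univ _) h'

end IsMinimalViolation

/-- Strong induction on the length supplies a violation that is minimal for its arrow, and hence a
family indexed by the infinite field. Two distinct parameters give isomorphic modules; transporting
the top element of one into the other contradicts `IsMinimalViolation.scalar_unique`. -/
theorem conditionN_of_finiteUniserialType [Infinite K] (hI : PathAlgebra.IsAdmissible I)
    (hF : FiniteUniserialType (PathAlgebra K V ⧸ I)) : ConditionN I := by
  rw [conditionN_iff]
  intro e e' α p
  induction hn : p.length using Nat.strong_induction_on generalizing p with
  | _ n ih =>
  subst hn
  intro hpos hm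
  by_contra hc
  push Not at hc
  have h : IsMinimalViolation I α p :=
    ⟨hpos, hc.1, hc.2, hm, fun p' hl h0 hm' => ih p'.length hl p' rfl h0 hm'⟩
  obtain ⟨k, hk, hkt⟩ := h.exists_family hI
  obtain ⟨n, F, hF⟩ := hF
  have h1 : ∀ t, ∃ i, Nonempty (PointModule (hk t) ≃ₗ[PathAlgebra K V ⧸ I] F i) := fun t =>
    hF (ModuleCat.of _ (PointModule (hk t)))
      ((isMastOf_iff (U := ModuleCat.of _ (PointModule (hk t))) hI).2
        ⟨_, PointModule.isFrame (hk t) hI⟩).1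
  choose i hi using h1
  obtain ⟨t, s, hts, his⟩ := Finite.exists_ne_map_eq_of_infinite i
  obtain ⟨f⟩ := hi t
  obtain ⟨g⟩ := hi s
  rw [← his] at g
  let φ := f.trans g.symm
  have h2 := hkt t
  refine hts (h.scalar_unique hI ((PointModule.isFrame (hk t) hI).map φ)
    (PointModule.isFrame (hk s) hI) ?_ (hkt s))
  rw [← map_smul, h2, algebra_compatible_smul Λ t, map_smul, map_smul, ← algebra_compatible_smul Λ t]

end FiniteType

end BoundQuiver

-- Paths in quivers without double arrows

section Paths

variable {V : Type u} [Quiver.{u} V]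

/-- Without double arrows, a path is determined by the vertices through which it passes. -/
lemma path_eq_of_vertices (hV : ∀ a b : V, Subsingleton (a ⟶ b)) {a b a' b' : V}
    (p : Quiver.Path a b) (p' : Quiver.Path a' b') (hl : p.length = p'.length)
    (h : ∀ (c c' : V) (u : Quiver.Path a c) (u' : Quiver.Path a' c'), IsRightSubpath u p →
      IsRightSubpath u' p' → u.length = u'.length → c = c') :
    (⟨a, b, p⟩ : AllPaths V) = ⟨a', b', p'⟩ := by
  induction p generalizing b' with
  | nil =>
    cases p' with
    | nil => cases h _ _ _ _ (IsRightSubpath.refl _) (IsRightSubpath.refl _) rfl; rfl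
    | cons p' β => simp at hl
  | cons p α ih =>
    cases p' with
    | nil => simp at hl
    | cons p' β =>
      cases ih p' (by simpa using hl)
        (fun c c' u u' hu hu' => h c c' u u' (hu.cons_right α) (hu'.cons_right β))
      cases h _ _ _ _ (IsRightSubpath.refl _) (IsRightSubpath.refl _) (by simp)
      cases (hV _ _).elim α β
      rfl

lemma toPath_comp_loopPow {e : V} (γ : e ⟶ e) (m : ℕ) :
    γ.toPath.comp (loopPow γ m) = loopPow γ (m + 1) := by
  induction m with
  | zero => rfl
  | succ m ih => rw [loopPow, Quiver.Path.comp_cons, ih]; rfl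

end Paths

section BoundQuiver

variable {K V : Type u} [Field K] [Quiver.{u} V] [Fintype V]
variable {I : Ideal (PathAlgebra K V)} [I.IsTwoSided]

local notation "Λ" => (PathAlgebra K V ⧸ I)

/-! ### Double arrows -/

-- Paths of length at least two have coefficient zero at every right subpath of `p`, so there are no
-- equations and `V_p` is the whole affine space. Hence vertices and arrows are always masts.
omit [I.IsTwoSided] in
lemma mem_pathVariety_of_length_le_one (hI : PathAlgebra.IsAdmissible I) {a b : V}
    {p : Quiver.Path a b} (hp : p.length ≤ 1) (k : DetourVar p → K) : k ∈ pathVariety I p := by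
  rw [mem_pathVariety_iff]
  intro z hz d v
  refine Submodule.span_induction (p := fun z _ => MvPolynomial.eval k (reduceLin K p v z) = 0)
    ?_ (by simp) ?_ ?_ (hI.2 (show z ∈ I.restrictScalars K from hz))
  · rintro _ ⟨a', d', q, hq, rfl⟩
    by_cases h2 : a' = a ∧ d' = d
    · obtain ⟨rfl, rfl⟩ := h2
      have := v.2.length_le
      rw [reduceLin_ofPath, reducePath_of_length_lt q v (by omega), map_zero]
    · rw [reduceLin_ofPath_of_ne _ _ _ h2, map_zero]
  · intro y z _ _ hy hz
    rw [map_add, map_add, hy, hz, add_zero]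
  · intro c z _ hz
    rw [map_smul, MvPolynomial.smul_eval, hz, mul_zero]

lemma isMast_of_length_le_one (hI : PathAlgebra.IsAdmissible I) {a b : V}
    {p : Quiver.Path a b} (hp : p.length ≤ 1) : IsMast I p :=
  isMast_of_isFrame hI (PointModule.isFrame (mem_pathVariety_of_length_le_one hI hp 0) hI)

/-- The arrow `β` is a mast of length one; condition (N) for `α` and this mast forces the two arrows
to agree. -/
lemma ConditionN.subsingleton (hN : ConditionN I) (hI : PathAlgebra.IsAdmissible I) (a b : V) :
    Subsingleton (a ⟶ b) := by
  refine ⟨fun α β => ?_⟩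
  rcases (conditionN_iff I).1 hN a b α β.toPath (by simp [Quiver.Path.length_toPath])
    (isMast_of_length_le_one hI (by simp [Quiver.Path.length_toPath])) with h | ⟨q, hq⟩
  · have := h.eq_of_length (IsRightSubpath.refl _) rfl
    injection this
  · injection hq with _ _ _ h
    exact h.symm

/-! ### Simple modules -/

section Simple

variable {S : Type u} [AddCommGroup S] [Module (PathAlgebra K V ⧸ I) S]

lemma radPow_one_eq_bot_of_simple [Module K S] [IsScalarTower K (PathAlgebra K V ⧸ I) S]
    (hI : PathAlgebra.IsAdmissible I) (hS : IsSimpleModule Λ S) : radPow Λ S 1 = ⊥ := by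
  rcases eq_bot_or_eq_top (radPow Λ S 1) with h | h
  · exact h
  · have := radPow_eq_bot_of_eq_succ (K := K) (M := S) hI (i := 0) h
    exact absurd this.symm bot_ne_top

lemma isFrame_of_simple [Module K S] [IsScalarTower K (PathAlgebra K V ⧸ I) S]
    (hI : PathAlgebra.IsAdmissible I) (hS : IsSimpleModule Λ S) {e : V} {s : S}
    (hs : vertexElt I e • s ≠ 0) :
    IsFrame I (Quiver.Path.nil : Quiver.Path e e) (vertexElt I e • s) where
  vertex := by rw [smul_smul, vertexElt_mul_self]
  chain A B := by
    rcases eq_bot_or_eq_top A with h | h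
    · exact Or.inl (h ▸ bot_le)
    · exact Or.inr (h ▸ le_top)
  ne := by
    change vertexElt I e • vertexElt I e • s ≠ 0
    rwa [smul_smul, vertexElt_mul_self]
  bot := radPow_one_eq_bot_of_simple (K := K) hI hS

/-- Since `JS = 0`, the module is one-dimensional, spanned by an element fixed by `e`, and `Λ` acts
through the character at `e`. -/
lemma simple_smul_eq [Module K S] [IsScalarTower K (PathAlgebra K V ⧸ I) S]
    (hI : PathAlgebra.IsAdmissible I) (hS : IsSimpleModule Λ S) {e : V} {s : S}
    (hs : vertexElt I e • s ≠ 0) (r : PathAlgebra K V ⧸ I) (t : S) :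
    r • t = vertexChar hI e r • t := by
  have h := isFrame_of_simple (K := K) hI hS hs
  obtain ⟨c, hc⟩ := h.exists_sub_smul_mem hI (IsRightSubpath.nil _) (n := t) trivial
  have h1 : t = c • vertexElt I e • vertexElt I e • s := by
    have h2 : t - c • vertexElt I e • vertexElt I e • s ∈ radPow Λ S 1 := hc
    rwa [radPow_one_eq_bot_of_simple (K := K) hI hS, Submodule.mem_bot, sub_eq_zero] at h2
  rw [smul_smul, vertexElt_mul_self] at h1
  have h3 := smul_sub_vertexChar_smul_mem hI (i := 0) (y := vertexElt I e • s) trivial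
    h.vertex r
  rw [zero_add, radPow_one_eq_bot_of_simple (K := K) hI hS, Submodule.mem_bot, sub_eq_zero] at h3
  rw [h1, smul_comm_K, h3, smul_comm]

end Simple

omit [Fintype V] in
lemma isEmpty_detourVar_nil (e : V) : IsEmpty (DetourVar (Quiver.Path.nil : Quiver.Path e e)) :=
  ⟨fun w => by
    have h1 := w.isRightSubpath.length_le
    have h2 := w.length_lt
    rw [Quiver.Path.length_nil] at h1
    omega⟩

open scoped ModuleCat.Algebra

lemma CorrespondsTo.eq (hI : PathAlgebra.IsAdmissible I) {S : ModuleCat.{u} (PathAlgebra K V ⧸ I)}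
    (hS : IsSimpleModule (PathAlgebra K V ⧸ I) S) {e e' : V} (h : CorrespondsTo I S e)
    (h' : CorrespondsTo I S e') : e = e' := by
  obtain ⟨s, hs⟩ := h
  obtain ⟨t, ht⟩ := h'
  by_contra hne
  rw [simple_smul_eq (K := K) hI hS hs, vertexChar_of_ne hI (Ne.symm hne), zero_smul] at ht
  exact ht rfl

lemma exists_correspondsTo {S : ModuleCat.{u} (PathAlgebra K V ⧸ I)}
    (hS : IsSimpleModule (PathAlgebra K V ⧸ I) S) : ∃ e, CorrespondsTo I S e := by
  have := IsSimpleModule.nontrivial (PathAlgebra K V ⧸ I) S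
  obtain ⟨s, hs⟩ := exists_ne (0 : S)
  by_contra! h
  apply hs
  rw [← sum_vertexElt_smul (I := I) s]
  refine Finset.sum_eq_zero fun v _ => ?_
  by_contra hv
  exact h v ⟨s, hv⟩

/-- The trivial path has no detours, so there are no coordinates in which the two modules could
differ. -/
lemma CorrespondsTo.nonempty_equiv (hI : PathAlgebra.IsAdmissible I)
    {S T : ModuleCat.{u} (PathAlgebra K V ⧸ I)}
    (hS : IsSimpleModule (PathAlgebra K V ⧸ I) S) (hT : IsSimpleModule (PathAlgebra K V ⧸ I) T)
    {e : V} (h : CorrespondsTo I S e)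
    (h' : CorrespondsTo I T e) : Nonempty (S ≃ₗ[PathAlgebra K V ⧸ I] T) := by
  obtain ⟨s, hs⟩ := h
  obtain ⟨t, ht⟩ := h'
  have h1 := isFrame_of_simple (K := K) hI hS hs
  have h2 := isFrame_of_simple (K := K) hI hT ht
  obtain ⟨k, hk⟩ := h1.exists_isCoord (K := K) hI
  obtain ⟨k', hk'⟩ := h2.exists_isCoord (K := K) hI
  have := isEmpty_detourVar_nil e
  obtain rfl := Subsingleton.elim k k'
  exact h1.nonempty_equiv hI h2 hk hk'

lemma CorrespondsTo.congr {S T : ModuleCat.{u} (PathAlgebra K V ⧸ I)} {e : V}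
    (h : CorrespondsTo I S e) (f : S ≃ₗ[PathAlgebra K V ⧸ I] T) : CorrespondsTo I T e := by
  obtain ⟨s, hs⟩ := h
  refine ⟨f s, ?_⟩
  rw [← map_smul]
  exact fun h => hs ((LinearEquiv.map_eq_zero_iff f).1 h)

/-! ### Uniqueness of masts -/

lemma existsUnique_mast (hI : PathAlgebra.IsAdmissible I) (hV : ∀ a b : V, Subsingleton (a ⟶ b))
    {U : ModuleCat.{u} (PathAlgebra K V ⧸ I)} (hU : IsUniserial (PathAlgebra K V ⧸ I) U) :
    ∃! x : AllPaths V, IsMastOf I x.2.2 U := by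
  obtain ⟨l, -, h2, h3⟩ := exists_radPow_of_isUniserial (K := K) hI hU
  obtain ⟨a, b, p, x, -, hx⟩ := exists_isFrame (K := K) hI hU.2.2 h2 h3
  refine ⟨⟨a, b, p⟩, (isMastOf_iff hI).2 ⟨x, hx⟩, ?_⟩
  rintro ⟨a', b', p'⟩ h
  obtain ⟨x', hx'⟩ := (isMastOf_iff hI).1 h
  exact path_eq_of_vertices hV p' p (hx'.length_eq (K := K) hI hx)
    fun c c' u u' hu hu' => hx'.vertices_eq (K := K) hI hx hu hu'

lemma subsingleton_seqPaths (hI : PathAlgebra.IsAdmissible I)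
    (hV : ∀ a b : V, Subsingleton (a ⟶ b)) {l : ℕ}
    (S : Fin (l + 1) → ModuleCat.{u} (PathAlgebra K V ⧸ I))
    (hS : ∀ i, IsSimpleModule (PathAlgebra K V ⧸ I) (S i)) : Subsingleton (SeqPaths I S) := by
  refine ⟨?_⟩
  rintro ⟨⟨a, b, p⟩, hp, hp'⟩ ⟨⟨a', b', q⟩, hq, hq'⟩
  refine Subtype.ext (path_eq_of_vertices hV p q (hp.trans hq.symm) ?_)
  intro c c' u u' hu hu' h
  have hl := hu.length_le
  obtain ⟨d, v, hv, hvl, hvS⟩ := hp' ⟨u.length, by change p.length = l at hp; omega⟩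
  obtain ⟨d', v', hv', hvl', hvS'⟩ := hq' ⟨u.length, by change p.length = l at hp; omega⟩
  cases IsRightSubpath.sigma_eq hv hu hvl
  cases IsRightSubpath.sigma_eq hv' hu' (hvl'.trans h)
  exact hvS.eq hI (hS _) hvS'

lemma IsFrame.correspondsTo (hI : PathAlgebra.IsAdmissible I) {U : ModuleCat.{u} Λ}
    {a b : V} {p : Quiver.Path a b} {x : U} (hx : IsFrame I p x) {c : V} {u : Quiver.Path a c}
    (hu : IsRightSubpath u p) {S : ModuleCat.{u} (PathAlgebra K V ⧸ I)}
    (f : RadLayer Λ U u.length (u.length + 1) ≃ₗ[PathAlgebra K V ⧸ I] S) : CorrespondsTo I S c := by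
  have h1 := hx.radLayer (K := K) hI (u := u) (w := Quiver.Path.nil)
    (by rwa [Quiver.Path.comp_nil]) (hx.mem_radPow (K := K) hI u)
  exact CorrespondsTo.congr (S := ModuleCat.of Λ (RadLayer Λ U u.length (u.length + 1)))
    ⟨_, h1.ne⟩ f

lemma HasCompSeries.exists_isFrame (hI : PathAlgebra.IsAdmissible I) {l : ℕ}
    {S : Fin (l + 1) → ModuleCat.{u} (PathAlgebra K V ⧸ I)} {U : ModuleCat.{u} Λ}
    (hU : HasCompSeries S U) : ∃ (P : SeqPaths I S) (x : U), IsFrame I P.1.2.2 x := by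
  obtain ⟨h1, h2, h3⟩ := hU
  obtain ⟨l', h4, h5, h6⟩ := exists_radPow_of_isUniserial (K := K) hI h1
  obtain ⟨a, b, p, x, hl, hx⟩ := _root_.exists_isFrame (K := K) hI h1.2.2 h5 h6
  have h7 : ((l' + 1 : ℕ) : ℕ∞) = ((l + 1 : ℕ) : ℕ∞) := h4.symm.trans h2
  have h8 := Nat.cast_injective h7
  refine ⟨⟨⟨a, b, p⟩, by change p.length = l; omega, fun i => ?_⟩, x, hx⟩
  obtain ⟨c, u, hu, hui⟩ := IsRightSubpath.exists_length p (i := i) (by omega)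
  refine ⟨c, u, hu, hui, ?_⟩
  obtain ⟨f⟩ := h3 i
  rw [← hui] at f
  exact hx.correspondsTo hI hu f

/-! ### Halyards -/

section Frames

variable {M : Type u} [AddCommGroup M] [Module (PathAlgebra K V ⧸ I) M]
variable [Module K M] [IsScalarTower K (PathAlgebra K V ⧸ I) M]
variable {a b : V} {p : Quiver.Path a b} {x : M}

/-- As the submodules form a chain, an element outside `J^(|u|+1) M` generates a submodule
containing it. Modulo `J^(|u|+1) M`, the elements `n` and `u x` are proportional. -/
lemma IsFrame.span_eq (hx : IsFrame I p x) (hI : PathAlgebra.IsAdmissible I) {c : V}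
    {u : Quiver.Path a c} (hu : IsRightSubpath u p) {n : M} (hn : n ∈ radPow Λ M u.length)
    (hn' : n ∉ radPow Λ M (u.length + 1)) :
    Submodule.span Λ {n} = Submodule.span Λ {pathElt I u • x} := by
  have key : ∀ m : M, m ∉ radPow Λ M (u.length + 1) →
      radPow Λ M (u.length + 1) ≤ Submodule.span Λ {m} := fun m hm =>
    (hx.chain _ _).resolve_right fun h => hm (h (Submodule.mem_span_singleton_self m))
  obtain ⟨k, hk⟩ := hx.exists_sub_smul_mem hI hu hn
  have hk0 : k ≠ 0 := by
    rintro rfl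
    rw [zero_smul, sub_zero] at hk
    exact hn' hk
  refine le_antisymm ?_ ?_
  · rw [Submodule.span_singleton_le_iff_mem, ← sub_add_cancel n (k • pathElt I u • x)]
    refine add_mem (key _ (hx.notMem_radPow hI hu) hk) ?_
    rw [algebra_compatible_smul Λ]
    exact Submodule.smul_mem _ _ (Submodule.mem_span_singleton_self _)
  · have e : pathElt I u • x = k⁻¹ • n + (-k⁻¹) • (n - k • pathElt I u • x) := by
      rw [smul_sub, neg_smul, neg_smul, smul_smul, inv_mul_cancel₀ hk0, one_smul]
      abel
    rw [Submodule.span_singleton_le_iff_mem, e]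
    refine add_mem ?_ (key n hn' (smul_mem_radPow_K _ hk))
    rw [algebra_compatible_smul Λ]
    exact Submodule.smul_mem _ _ (Submodule.mem_span_singleton_self _)

omit [Module K M] [IsScalarTower K (PathAlgebra K V ⧸ I) M] in
lemma IsFrame.exists_layer (hx : IsFrame I p x) {i : ℕ} {n : M}
    (hn : n ∈ radPow Λ M i) (hn0 : n ≠ 0) :
    ∃ j, i ≤ j ∧ j ≤ p.length ∧ n ∈ radPow Λ M j ∧ n ∉ radPow Λ M (j + 1) := by
  have hi : i < p.length + 1 := by
    by_contra h
    have h1 := radPow_anti (not_lt.1 h) hn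
    rw [hx.bot] at h1
    exact hn0 h1
  by_contra! hc
  have key : ∀ j, i + j ≤ p.length + 1 → n ∈ radPow Λ M (i + j) := by
    intro j
    induction j with
    | zero => exact fun _ => hn
    | succ j ih => exact fun h => hc (i + j) (by omega) (by omega) (ih (by omega))
  have h1 := key (p.length + 1 - i) (by omega)
  rw [show i + (p.length + 1 - i) = p.length + 1 by omega, hx.bot] at h1
  exact hn0 h1

/-- Under condition (N), if `α u x ≠ 0` and `α u` is not a right subpath of `p`, then `α u x` and
`α c u x` generate the same submodule, for some cycle `c`. -/
lemma ConditionN.exists_cycle (hN : ConditionN I) (hI : PathAlgebra.IsAdmissible I)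
    (hx : IsFrame I p x) {c d : V} {α : c ⟶ d} {u : Quiver.Path a c} (hu : IsRightSubpath u p)
    (hα : ¬ IsRightSubpath (u.cons α) p) (hne : pathElt I (u.cons α) • x ≠ 0) :
    ∃ w : Quiver.Path c c, 0 < w.length ∧ IsRightSubpath ((u.comp w).cons α) p ∧
      Submodule.span Λ {pathElt I (u.cons α) • x} =
        Submodule.span Λ {pathElt I ((u.comp w).cons α) • x} := by
  -- Let `j` be the exact depth of `α u x` and `v` the right subpath of `p` of length `j`. Then `v`
  -- ends where `α` ends and extends `u`, say `v = w u`, and the subpath `w` of `p` is a mast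
  -- parallel to `α`.
  obtain ⟨j, hij, hjl, hj, hj'⟩ := hx.exists_layer (hx.mem_radPow hI (u.cons α)) hne
  rw [Quiver.Path.length_cons] at hij
  obtain ⟨d', v, hv, rfl⟩ := IsRightSubpath.exists_length p hjl
  obtain rfl := hx.vertex_eq hI hv hj hj' (vertexElt_smul_smul _ x)
  obtain ⟨w, rfl⟩ := hu.of_le hv (by omega)
  rw [Quiver.Path.length_comp] at hij
  -- If `w` started with `α`, then `α u` would be a right subpath of `p`. The same would happen if
  -- `w = α q` with `q` trivial.
  rcases (conditionN_iff I).1 hN _ _ α w (by omega) (hx.isMast_comp hI hv) with h | ⟨q, rfl⟩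
  · obtain ⟨q, rfl⟩ := h
    refine absurd (IsRightSubpath.trans ⟨q, ?_⟩ hv) hα
    rw [← Quiver.Path.comp_assoc]
    rfl
  · refine ⟨q, ?_, hv, hx.span_eq hI hv hj hj'⟩
    by_contra hq
    cases Quiver.Path.eq_nil_of_length_zero q (by omega)
    exact hα hv

end Frames

lemma ConditionN.isCircularHalyard (hN : ConditionN I) (hI : PathAlgebra.IsAdmissible I)
    {a b c d : V} {p : Quiver.Path a b} {α : c ⟶ d} {u : Quiver.Path a c}
    (h : IsHalyard I p α u) : IsCircularHalyard I p α u := by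
  refine ⟨h, ?_⟩
  obtain ⟨hd, U, hU, x, hx, hne⟩ := h
  obtain ⟨w, h1, h2, h3⟩ := hN.exists_cycle (K := K) hI ((isTopElement_iff hI hU).1 hx) hd.1 hd.2.1
    hne
  exact ⟨w, h1, h2, U, hU, x, hx, h3⟩

/-- If `α u x ≠ 0` for some detour, the cycle from `ConditionN.exists_cycle` makes the mast revisit
the end vertex of `u`, so two members of the sequence would be isomorphic. Thus both modules have
all coordinates zero with respect to the same mast. -/
lemma ConditionN.nonempty_equiv_of_distinct (hN : ConditionN I) (hI : PathAlgebra.IsAdmissible I)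
    {l : ℕ} {S : Fin (l + 1) → ModuleCat.{u} (PathAlgebra K V ⧸ I)}
    (hS : ∀ i, IsSimpleModule (PathAlgebra K V ⧸ I) (S i))
    (hS' : ∀ i j, i ≠ j → IsEmpty (S i ≃ₗ[PathAlgebra K V ⧸ I] S j))
    {U U' : ModuleCat.{u} (PathAlgebra K V ⧸ I)} (hU : HasCompSeries S U)
    (hU' : HasCompSeries S U') : Nonempty (U ≃ₗ[PathAlgebra K V ⧸ I] U') := by
  obtain ⟨P, x, hx⟩ := hU.exists_isFrame hI
  obtain ⟨P', x', hx'⟩ := hU'.exists_isFrame hI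
  obtain rfl := (subsingleton_seqPaths hI (hN.subsingleton hI) S hS).elim P P'
  obtain ⟨⟨a, b, p⟩, hp, hp'⟩ := P
  change p.length = l at hp
  have key : ∀ {U : ModuleCat.{u} (PathAlgebra K V ⧸ I)} {x : U} (hx : IsFrame I p x),
      IsCoord (K := K) I p x 0 := by
    intro U x hx
    obtain ⟨k, hk⟩ := hx.exists_isCoord (K := K) hI
    have hk0 : k = 0 := by
      funext w
      have h1 : pathElt I (w.u.cons w.α) • x = 0 := by
        by_contra hne
        obtain ⟨c, h1, h2, -⟩ := hN.exists_cycle (K := K) hI hx w.isDetour.1 w.isDetour.2.1 hne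
        have h3 := h2.of_cons.length_le
        rw [Quiver.Path.length_comp] at h3
        obtain ⟨d, v, hv, hvl, hvS⟩ := hp' ⟨w.u.length, by omega⟩
        obtain ⟨d', v', hv', hvl', hvS'⟩ := hp' ⟨w.u.length + c.length, by omega⟩
        cases IsRightSubpath.sigma_eq hv w.isDetour.1 hvl
        cases IsRightSubpath.sigma_eq hv' h2.of_cons
          (hvl'.trans (Quiver.Path.length_comp _ _).symm)
        obtain ⟨f⟩ := hvS.nonempty_equiv hI (hS _) (hS _) hvS'
        refine (hS' _ _ ?_).false f
        intro h
        have h4 : w.u.length = w.u.length + c.length := congrArg Fin.val h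
        omega
      have h2 := hk _ _ w.α (RightSubpathsTo.of w.u w.isDetour.1)
      have h3 := congrFun (hx.eq_zero_of_sum hI (h2.symm.trans h1))
        (RightSubpathsTo.of w.v w.isRightSubpath)
      rwa [substCoeff_detourVar, MvPolynomial.eval_X] at h3
    rwa [hk0] at hk
  exact hx.nonempty_equiv hI hx' (key hx) (key hx')

/-! ### Loops -/

/-- By (N) a non-trivial `p` starts or ends with `γ`; what remains is a shorter mast from `e` to
`e`. -/
lemma ConditionN.exists_eq_loopPow (hN : ConditionN I) (hI : PathAlgebra.IsAdmissible I) {e : V}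
    (γ : e ⟶ e) (p : Quiver.Path e e) (hp : IsMast I p) : ∃ m : ℕ, p = loopPow γ m := by
  induction hn : p.length using Nat.strong_induction_on generalizing p with
  | _ n ih =>
  subst hn
  rcases Nat.eq_zero_or_pos p.length with h0 | h0
  · exact ⟨0, Quiver.Path.eq_nil_of_length_zero p h0⟩
  rcases (conditionN_iff I).1 hN e e γ p h0 hp with ⟨q, rfl⟩ | ⟨q, rfl⟩
  · obtain ⟨m, rfl⟩ := ih q.length
      (by rw [Quiver.Path.length_comp, Quiver.Path.length_toPath]; omega) q
      (hp.of_comp hI (IsRightSubpath.refl _)) rfl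
    exact ⟨m + 1, toPath_comp_loopPow γ m⟩
  · obtain ⟨m, rfl⟩ := ih q.length (by rw [Quiver.Path.length_cons]; omega) q
      (hp.of_comp hI (u := Quiver.Path.nil) (by
        rw [Quiver.Path.nil_comp]; exact (IsRightSubpath.refl q).cons_right γ)) rfl
    exact ⟨m + 1, rfl⟩

/-! ### Extending modules at the top -/

section Extend

variable {M : Type u} [AddCommGroup M] [Module (PathAlgebra K V ⧸ I) M]
variable [Module K M] [IsScalarTower K (PathAlgebra K V ⧸ I) M]
variable {a b : V} {p : Quiver.Path a b} {x : M}

/-- Under condition (N), there is a top element which is annihilated by all arrows different from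
the first arrow of the mast. -/
lemma ConditionN.exists_isFrame (hN : ConditionN I) (hI : PathAlgebra.IsAdmissible I)
    (hx : IsFrame I p x) : ∃ y : M, IsFrame I p y ∧ ∀ (d : V) (β : a ⟶ d),
      ¬ IsRightSubpath β.toPath p → pathElt I β.toPath • y = 0 := by
  have hV := hN.subsingleton hI
  -- Successive approximation: the unwanted arrows push the top element deeper and deeper, until
  -- they reach a layer that is zero.
  have key : ∀ m : ℕ, ∃ y : M, IsFrame I p y ∧ ∀ (d : V) (β : a ⟶ d),
      ¬ IsRightSubpath β.toPath p → pathElt I β.toPath • y ∈ radPow Λ M m := by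
    intro m
    induction m with
    | zero => exact ⟨x, hx, fun _ _ _ => trivial⟩
    | succ m ih =>
      obtain ⟨y, hy, hym⟩ := ih
      by_cases hall : ∀ (d : V) (β : a ⟶ d), ¬ IsRightSubpath β.toPath p →
          pathElt I β.toPath • y ∈ radPow Λ M (m + 1)
      · exact ⟨y, hy, hall⟩
      push Not at hall
      obtain ⟨d, α, hα, hαm⟩ := hall
      have hm0 : 1 ≤ m := by
        by_contra h
        obtain rfl : m = 0 := by omega
        exact hαm (hy.mem_radPow hI α.toPath)
      have hml : m ≤ p.length := by
        by_contra h
        have h1 := radPow_anti (show p.length + 1 ≤ m by omega) (hym d α hα)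
        rw [hx.bot, Submodule.mem_bot] at h1
        exact hαm (h1 ▸ zero_mem _)
      obtain ⟨d', u, hu, rfl⟩ := IsRightSubpath.exists_length p hml
      obtain rfl := hy.vertex_eq hI hu (hym d α hα) hαm (vertexElt_smul_smul _ y)
      -- The leading term of `α y` is a multiple of `u y`. By (N), `u = α q` with `q` a cycle at
      -- `a`, so subtracting a multiple of `q y` from the top element cancels this term.
      obtain ⟨q, rfl⟩ : ∃ q : Quiver.Path a a, u = q.cons α := by
        refine ((conditionN_iff I).1 hN _ _ α u (by omega)
          (hy.isMast_comp hI (u := Quiver.Path.nil) (by rwa [Quiver.Path.nil_comp]))).resolve_left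
          fun h => hα (h.trans hu)
      have hq : 0 < q.length := by
        by_contra hq
        cases Quiver.Path.eq_nil_of_length_zero q (by omega)
        exact hα hu
      obtain ⟨c, hc⟩ := hy.exists_sub_smul_mem hI hu (hym _ α hα)
      refine ⟨y - c • pathElt I q • y, hy.sub_frame hI
        (smul_mem_radPow_K c (radPow_anti hq (hy.mem_radPow hI q)))
        (by rw [smul_comm_K, vertexElt_smul_smul]), ?_⟩
      intro e β hβ
      rw [smul_sub, smul_comm_K, toPath_smul_pathElt_smul]
      by_cases he : d' = e
      · subst he
        cases (hV _ _).elim β α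
        exact hc
      -- The layer in question lies at the vertex `d'`, so elements fixed by another vertex
      -- automatically lie in the next layer. An arrow ending in `d'` is `α` itself, as there are no
      -- double arrows.
      · have h1 : ∀ n : M, n ∈ radPow Λ M (q.cons α).length → vertexElt I e • n = n →
            n ∈ radPow Λ M ((q.cons α).length + 1) := by
          intro n hn hne
          by_contra h
          exact he (hy.vertex_eq hI hu hn h hne)
        refine sub_mem (h1 _ (hym e β hβ) (vertexElt_smul_smul _ y)) (smul_mem_radPow_K c
          (h1 _ ?_ (vertexElt_smul_smul _ y)))
        exact hy.mem_radPow hI (q.cons β)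
  obtain ⟨y, hy, hy'⟩ := key (p.length + 1)
  refine ⟨y, hy, fun d β hβ => ?_⟩
  have := hy' d β hβ
  rwa [hx.bot, Submodule.mem_bot] at this

/-- Membership of the pair in the span of pairs says that the same coefficients expand `α u x` and
`α u y`, without naming those coefficients. -/
lemma IsFrame.nonempty_equiv_of_mem_span (hx : IsFrame I p x) (hI : PathAlgebra.IsAdmissible I)
    {N : Type u} [AddCommGroup N] [Module (PathAlgebra K V ⧸ I) N]
    [Module K N] [IsScalarTower K (PathAlgebra K V ⧸ I) N] {y : N} (hy : IsFrame I p y)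
    (h : ∀ (c d : V) (α : c ⟶ d) (u : RightSubpathsTo p c),
      ((pathElt I (u.1.cons α) • x, pathElt I (u.1.cons α) • y) : M × N) ∈
        Submodule.span K (Set.range fun v : RightSubpathsTo p d =>
          ((pathElt I v.1 • x, pathElt I v.1 • y) : M × N))) :
    Nonempty (M ≃ₗ[PathAlgebra K V ⧸ I] N) := by
  obtain ⟨k, hk⟩ := hx.exists_isCoord (K := K) hI
  refine hx.nonempty_equiv hI hy hk fun c d α u => ?_
  obtain ⟨f, hf⟩ := (Submodule.mem_span_range_iff_exists_fun K).1 (h c d α u)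
  have h1 : ∑ v, f v • pathElt I v.1 • x = pathElt I (u.1.cons α) • x := by
    have := congrArg Prod.fst hf
    rwa [Prod.fst_sum] at this
  have h2 : ∑ v, f v • pathElt I v.1 • y = pathElt I (u.1.cons α) • y := by
    have := congrArg Prod.snd hf
    rwa [Prod.snd_sum] at this
  have h3 := hx.coeff_unique hI (h1.trans (hk c d α u))
  rw [← h2, h3]

variable (I) in
/-- The module `JM` has the coordinates `k` with respect to the top element `α x`. -/
def IsRadCoord {e : V} (α : a ⟶ e) (p' : Quiver.Path e b) (x : M) (k : DetourVar p' → K) : Prop :=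
  ∀ (c d : V) (β : c ⟶ d) (u : RightSubpathsTo p' c),
    pathElt I ((α.toPath.comp u.1).cons β) • x =
      ∑ v : RightSubpathsTo p' d, MvPolynomial.eval k (substCoeff K p' β u v) •
        pathElt I (α.toPath.comp v.1) • x

lemma IsFrame.exists_isRadCoord (hI : PathAlgebra.IsAdmissible I) {e : V} {α : a ⟶ e}
    {p' : Quiver.Path e b} (hx : IsFrame I (α.toPath.comp p') x) :
    ∃ k ∈ pathVariety I p', IsRadCoord I α p' x k := by
  -- The module `JM` is framed by the remaining path `p'` and the element `α x`.
  have h1 := hx.radLayer hI (IsRightSubpath.refl _) (hx.mem_radPow hI α.toPath)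
  obtain ⟨k, hk⟩ := h1.exists_isCoord (K := K) hI
  refine ⟨k, h1.coord_mem_pathVariety hI hk, fun c d β u => ?_⟩
  have h2 := hk c d β u
  set N := radPow Λ M α.toPath.length
  set Q := (radPow Λ M (α.toPath.length + (p'.length + 1))).submoduleOf N
  let y : N := ⟨pathElt I α.toPath • x, hx.mem_radPow hI α.toPath⟩
  have h3 : pathElt I (u.1.cons β) • y -
      ∑ v : RightSubpathsTo p' d, MvPolynomial.eval k (substCoeff K p' β u v) •
        pathElt I v.1 • y ∈ Q := by
    rw [← Submodule.Quotient.mk_eq_zero, Submodule.Quotient.mk_sub, sub_eq_zero]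
    refine h2.trans ?_
    have h4 := map_sum (Q.mkQ.restrictScalars K)
      (fun v : RightSubpathsTo p' d => MvPolynomial.eval k (substCoeff K p' β u v) •
        pathElt I v.1 • y) Finset.univ
    refine Eq.trans ?_ h4.symm
    rfl
  have h4 : (((pathElt I (u.1.cons β) • y -
      ∑ v : RightSubpathsTo p' d, MvPolynomial.eval k (substCoeff K p' β u v) •
        pathElt I v.1 • y : N)) : M) ∈ radPow Λ M (α.toPath.length + (p'.length + 1)) := h3
  have h5 : α.toPath.length + (p'.length + 1) = (α.toPath.comp p').length + 1 := by
    rw [Quiver.Path.length_comp]; omega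
  rw [h5, hx.bot, Submodule.mem_bot, Submodule.coe_sub, sub_eq_zero, Submodule.coe_sum] at h4
  rw [← Quiver.Path.comp_cons, ← pathElt_smul_pathElt_smul]
  refine h4.trans (Finset.sum_congr rfl fun v _ => ?_)
  rw [← pathElt_smul_pathElt_smul]
  rfl

lemma IsRightSubpath.of_toPath_comp {V : Type u} [Quiver.{u} V] {a b e c : V} {α : a ⟶ e}
    {p' : Quiver.Path e b} {u : Quiver.Path a c} (hu : IsRightSubpath u (α.toPath.comp p')) :
    u.length = 0 ∨ ∃ u' : Quiver.Path e c, u = α.toPath.comp u' ∧ IsRightSubpath u' p' := by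
  rcases Nat.eq_zero_or_pos u.length with h | h
  · exact Or.inl h
  · right
    obtain ⟨u', rfl⟩ := (IsRightSubpath.of_comp α.toPath p').of_le hu
      (by rw [Quiver.Path.length_toPath]; omega)
    obtain ⟨w, hw⟩ := hu
    rw [Quiver.Path.comp_assoc, Quiver.Path.comp_inj_right] at hw
    exact ⟨u', rfl, w, hw⟩

/-- On the top element only the first arrow of the mast acts non-trivially, and on the elements `α
u' x` the action is given by `k`. Hence `k` determines the whole module. -/
lemma IsFrame.nonempty_equiv_of_isRadCoord (hI : PathAlgebra.IsAdmissible I) {e : V} {α : a ⟶ e}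
    {p' : Quiver.Path e b} (hx : IsFrame I (α.toPath.comp p') x)
    (hx0 : ∀ (d : V) (β : a ⟶ d), ¬ IsRightSubpath β.toPath (α.toPath.comp p') →
      pathElt I β.toPath • x = 0)
    {N : Type u} [AddCommGroup N] [Module (PathAlgebra K V ⧸ I) N]
    [Module K N] [IsScalarTower K (PathAlgebra K V ⧸ I) N] {y : N}
    (hy : IsFrame I (α.toPath.comp p') y)
    (hy0 : ∀ (d : V) (β : a ⟶ d), ¬ IsRightSubpath β.toPath (α.toPath.comp p') →
      pathElt I β.toPath • y = 0)
    {k : DetourVar p' → K} (hk : IsRadCoord I α p' x k) (hk' : IsRadCoord I α p' y k) :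
    Nonempty (M ≃ₗ[PathAlgebra K V ⧸ I] N) := by
  refine hx.nonempty_equiv_of_mem_span hI hy fun c d β u => ?_
  by_cases h : IsRightSubpath (u.1.cons β) (α.toPath.comp p')
  · exact Submodule.subset_span ⟨RightSubpathsTo.of _ h, rfl⟩
  obtain ⟨u, hu⟩ := u
  rcases hu.of_toPath_comp with h1 | ⟨u', rfl, hu'⟩
  · cases Quiver.Path.eq_of_length_zero u h1
    cases Quiver.Path.eq_nil_of_length_zero u h1
    rw [show pathElt I (Quiver.Path.nil.cons β) • x = 0 from hx0 d β h,
      show pathElt I (Quiver.Path.nil.cons β) • y = 0 from hy0 d β h]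
    exact zero_mem _
  · have e1 : ((pathElt I ((α.toPath.comp u').cons β) • x,
        pathElt I ((α.toPath.comp u').cons β) • y) : M × N) =
        ∑ v : RightSubpathsTo p' d,
          MvPolynomial.eval k (substCoeff K p' β (RightSubpathsTo.of u' hu') v) •
          ((pathElt I (α.toPath.comp v.1) • x, pathElt I (α.toPath.comp v.1) • y) : M × N) := by
      refine Prod.ext ?_ ?_
      · rw [Prod.fst_sum]
        exact hk c d β (RightSubpathsTo.of u' hu')
      · rw [Prod.snd_sum]
        exact hk' c d β (RightSubpathsTo.of u' hu')
    change ((pathElt I ((α.toPath.comp u').cons β) • x,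
        pathElt I ((α.toPath.comp u').cons β) • y) : M × N) ∈ _
    rw [e1]
    refine sum_mem fun v _ => Submodule.smul_mem _ _ (Submodule.subset_span
      ⟨RightSubpathsTo.of (α.toPath.comp v.1) ?_, rfl⟩)
    obtain ⟨w, hw⟩ := v.2
    exact ⟨w, by rw [Quiver.Path.comp_assoc, ← hw]⟩

end Extend

lemma finitelyManyUpToIso_of_finite {R : Type u} [Ring R] {P : ModuleCat.{u} R → Prop}
    {T : Type*} [Finite T] (rel : T → ModuleCat.{u} R → Prop) (h : ∀ U, P U → ∃ t, rel t U)
    (h' : ∀ t U U', rel t U → rel t U' → Nonempty (U ≃ₗ[R] U')) : FinitelyManyUpToIso P := by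
  classical
  obtain ⟨n, ⟨f⟩⟩ := Finite.exists_equiv_fin T
  refine ⟨n, fun i => if hi : ∃ U, rel (f.symm i) U then hi.choose else ModuleCat.of R PUnit,
    fun U hU => ?_⟩
  obtain ⟨t, ht⟩ := h U hU
  have hex : ∃ U, rel (f.symm (f t)) U := ⟨U, by rwa [f.symm_apply_apply]⟩
  refine ⟨f t, ?_⟩
  change Nonempty (U ≃ₗ[R] (if hi : ∃ U, rel (f.symm (f t)) U then hi.choose else
    ModuleCat.of R PUnit :))
  rw [dif_pos hex]
  exact h' (f.symm (f t)) _ _ (by rwa [f.symm_apply_apply]) hex.choose_spec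

/-- The label of `U` consists of the mast of `JU` and the coordinates of `JU` with respect to `α x`,
where `x` is a top element normalised by `ConditionN.exists_isFrame` and `α` is the first arrow of
the mast. -/
lemma ConditionN.finitelyManyUpToIso (hN : ConditionN I) (hI : PathAlgebra.IsAdmissible I)
    {l : ℕ} {S : Fin (l + 1 + 1) → ModuleCat.{u} (PathAlgebra K V ⧸ I)}
    (hS : ∀ i, IsSimpleModule (PathAlgebra K V ⧸ I) (S i))
    (hfin : Finite (SeqVariety I fun i : Fin (l + 1) => S i.succ)) :
    FinitelyManyUpToIso fun U : ModuleCat.{u} (PathAlgebra K V ⧸ I) => HasCompSeries S U := by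
  have hV := hN.subsingleton hI
  have hsub := subsingleton_seqPaths hI hV S hS
  refine finitelyManyUpToIso_of_finite (T := SeqVariety I fun i : Fin (l + 1) => S i.succ)
    (fun t U => ∃ (a : V) (α : a ⟶ t.1.1.1) (x : U) (P : SeqPaths I S),
      P.1 = ⟨a, t.1.1.2.1, α.toPath.comp t.1.1.2.2⟩ ∧
      IsFrame I (α.toPath.comp t.1.1.2.2) x ∧
      (∀ (d : V) (β : a ⟶ d), ¬ IsRightSubpath β.toPath (α.toPath.comp t.1.1.2.2) →
        pathElt I β.toPath • x = 0) ∧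
      IsRadCoord (K := K) I α t.1.1.2.2 x t.2.1) ?_ ?_
  · intro U hU
    obtain ⟨P, x, hx⟩ := hU.exists_isFrame hI
    obtain ⟨y, hy, hy0⟩ := hN.exists_isFrame (K := K) hI hx
    obtain ⟨⟨a, b, p⟩, hp, hp'⟩ := P
    change p.length = l + 1 at hp
    obtain ⟨e, α, p', hpl, rfl⟩ := Quiver.Path.eq_toPath_comp_of_length_eq_succ p hp
    obtain ⟨k, hk, hk'⟩ := hy.exists_isRadCoord (K := K) hI
    refine ⟨⟨⟨⟨e, b, p'⟩, ?_, fun i => ?_⟩, ⟨k, hk⟩⟩, a, α, y, ⟨⟨a, b, _⟩, hp, hp'⟩, rfl, hy,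
      hy0, hk'⟩
    · rw [Quiver.Path.length_comp, Quiver.Path.length_toPath] at hp
      change p'.length = l
      omega
    · obtain ⟨c, u, hu, hui, huS⟩ := hp' i.succ
      rcases IsRightSubpath.of_toPath_comp hu with h | ⟨u', rfl, hu'⟩
      · rw [h] at hui
        simp at hui
      · refine ⟨c, u', hu', ?_, huS⟩
        rw [Quiver.Path.length_comp, Quiver.Path.length_toPath, Fin.val_succ] at hui
        omega
  · rintro ⟨⟨⟨e, b, p'⟩, hp'⟩, ⟨k, hk⟩⟩ U U' ⟨a, α, x, P, hP, hx, hx0, hxk⟩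
      ⟨a', α', x', P', hP', hx', hx0', hxk'⟩
    -- At most one path contributes to `V_S`, so the start and, without double arrows, the first
    -- arrow agree for both modules.
    have h1 : (⟨a, b, α.toPath.comp p'⟩ : AllPaths V) = ⟨a', b, α'.toPath.comp p'⟩ := by
      rw [← hP, ← hP', hsub.elim P P']
    obtain rfl : a = a' := (Sigma.mk.inj h1).1
    obtain rfl := (hV _ _).elim α α'
    exact hx.nonempty_equiv_of_isRadCoord hI hx0 hx' hx0' hxk hxk'

end BoundQuiver

-- Powers of loops, and arrows as masts

section Loops

variable {V : Type u} [Quiver.{u} V]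

lemma loopPow_add {e : V} (γ : e ⟶ e) (m n : ℕ) :
    loopPow γ (m + n) = (loopPow γ m).comp (loopPow γ n) := by
  induction n with
  | zero => rfl
  | succ n ih =>
    rw [← add_assoc, loopPow, ih]
    rfl

lemma length_loopPow {e : V} (γ : e ⟶ e) (m : ℕ) : (loopPow γ m).length = m := by
  induction m with
  | zero => rfl
  | succ m ih => rw [loopPow, Quiver.Path.length_cons, ih]

/-- A detour on an arrow would have to be a second arrow parallel to it. -/
lemma isEmpty_detourVar_toPath (hV : ∀ a b : V, Subsingleton (a ⟶ b)) {a b : V} (α : a ⟶ b) :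
    IsEmpty (DetourVar α.toPath) := by
  refine ⟨?_⟩
  rintro ⟨c, d, u, β, v, ⟨hu, hβ, -⟩, hv, hlt⟩
  have h1 := hv.length_le
  rw [Quiver.Path.length_toPath] at h1
  have h2 : u.length = 0 := by omega
  cases Quiver.Path.eq_of_length_zero u h2
  cases Quiver.Path.eq_nil_of_length_zero u h2
  cases IsRightSubpath.sigma_eq hv (IsRightSubpath.refl α.toPath)
    (by rw [Quiver.Path.length_toPath]; omega)
  obtain rfl := (hV _ _).elim α β
  exact hβ (IsRightSubpath.refl _)

end Loops

section BoundQuiver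

variable {K V : Type u} [Field K] [Quiver.{u} V] [Fintype V]
variable {I : Ideal (PathAlgebra K V)} [I.IsTwoSided]

local notation "Λ" => (PathAlgebra K V ⧸ I)

/-! ### Top and socle -/

section TopSocle

variable {M : Type u} [AddCommGroup M] [Module (PathAlgebra K V ⧸ I) M]
variable [Module K M] [IsScalarTower K (PathAlgebra K V ⧸ I) M]
variable {a b : V} {p : Quiver.Path a b} {x : M}

lemma IsFrame.isSimpleModule_radPow (hx : IsFrame I p x) (hI : PathAlgebra.IsAdmissible I) :
    IsSimpleModule Λ (radPow Λ M p.length) := by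
  rw [isSimpleModule_iff_isAtom]
  refine ⟨hx.radPow_ne_bot hI, fun B hB => ?_⟩
  by_contra hne
  obtain ⟨z, hz, hz0⟩ := Submodule.exists_mem_ne_zero_of_ne_bot hne
  refine hB.not_ge fun w hw => ?_
  by_cases hw0 : w = 0
  · rw [hw0]
    exact zero_mem _
  have h1 := hx.span_eq hI (IsRightSubpath.refl p) (hB.le hz)
    (by rwa [hx.bot, Submodule.mem_bot])
  have h2 := hx.span_eq hI (IsRightSubpath.refl p) hw (by rwa [hx.bot, Submodule.mem_bot])
  have h3 : w ∈ Submodule.span Λ {z} := by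
    rw [h1, ← h2]
    exact Submodule.mem_span_singleton_self w
  exact (Submodule.span_singleton_le_iff_mem z B).2 hz h3

lemma IsFrame.moduleSocle_eq (hx : IsFrame I p x) (hI : PathAlgebra.IsAdmissible I) :
    moduleSocle Λ M = radPow Λ M p.length := by
  have h := hx.isSimpleModule_radPow hI
  refine le_antisymm (sSup_le fun N hN => ?_) (le_sSup h)
  have hN' : IsSimpleModule Λ N := hN
  rw [isSimpleModule_iff_isAtom] at h hN'
  rcases hx.chain N (radPow Λ M p.length) with h1 | h1
  · exact h1
  · rcases hN'.le_iff.1 h1 with h2 | h2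
    · exact absurd h2 h.1
    · exact h2.ge

lemma IsFrame.isSimpleModule_quotient (hx : IsFrame I p x) (hI : PathAlgebra.IsAdmissible I) :
    IsSimpleModule Λ (M ⧸ radPow Λ M 1) := by
  have h0 : pathElt I (Quiver.Path.nil : Quiver.Path a a) • x = x := hx.vertex
  rw [isSimpleModule_iff_isCoatom]
  refine ⟨fun h => ?_, fun B hB => ?_⟩
  · have h1 := hx.notMem_radPow hI (IsRightSubpath.nil p)
    rw [Quiver.Path.length_nil, zero_add, h] at h1
    exact h1 trivial
  · obtain ⟨y, hy, hy'⟩ := SetLike.exists_of_lt hB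
    have h1 := hx.span_eq hI (IsRightSubpath.nil p) (n := y) trivial hy'
    rw [h0] at h1
    have hxB : x ∈ B := by
      have : x ∈ Submodule.span Λ {y} := h1 ▸ Submodule.mem_span_singleton_self x
      exact (Submodule.span_singleton_le_iff_mem y B).2 hy this
    rw [eq_top_iff]
    intro m _
    obtain ⟨r, rfl⟩ := hx.exists_smul_eq hI m
    exact B.smul_mem r hxB

end TopSocle

open scoped ModuleCat.Algebra

lemma IsFrame.correspondsTo_quotient (hI : PathAlgebra.IsAdmissible I)
    {U : ModuleCat.{u} (PathAlgebra K V ⧸ I)} {a b : V} {p : Quiver.Path a b} {x : U}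
    (hx : IsFrame I p x) : CorrespondsTo I (ModuleCat.of Λ (U ⧸ radPow Λ U 1)) a := by
  have h1 := hx.notMem_radPow (K := K) hI (IsRightSubpath.nil p)
  refine ⟨Submodule.Quotient.mk x, fun h => h1 ?_⟩
  exact (Submodule.Quotient.mk_eq_zero _).1 h

lemma IsFrame.correspondsTo_socle (hI : PathAlgebra.IsAdmissible I)
    {U : ModuleCat.{u} (PathAlgebra K V ⧸ I)} {a b : V} {p : Quiver.Path a b} {x : U}
    (hx : IsFrame I p x) : CorrespondsTo I (ModuleCat.of Λ (moduleSocle Λ U)) b := by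
  refine ⟨⟨pathElt I p • x, ?_⟩, fun h => ?_⟩
  · rw [hx.moduleSocle_eq (K := K) hI]
    exact hx.mem_radPow (K := K) hI p
  · have h1 : vertexElt I b • pathElt I p • x = 0 := congrArg Subtype.val h
    rw [vertexElt_smul_smul] at h1
    exact hx.ne h1

lemma IsFrame.hasTop_iff (hI : PathAlgebra.IsAdmissible I)
    {U S : ModuleCat.{u} (PathAlgebra K V ⧸ I)} (hS : IsSimpleModule (PathAlgebra K V ⧸ I) S)
    {a b : V} {p : Quiver.Path a b} {x : U} (hx : IsFrame I p x) :
    HasTop U S ↔ CorrespondsTo I S a :=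
  ⟨fun ⟨f⟩ => (hx.correspondsTo_quotient hI).congr f,
    fun h => CorrespondsTo.nonempty_equiv (S := ModuleCat.of Λ (U ⧸ radPow Λ U 1)) hI
      (hx.isSimpleModule_quotient (K := K) hI) hS (hx.correspondsTo_quotient hI) h⟩

lemma IsFrame.hasSocle_iff (hI : PathAlgebra.IsAdmissible I)
    {U S : ModuleCat.{u} (PathAlgebra K V ⧸ I)} (hS : IsSimpleModule (PathAlgebra K V ⧸ I) S)
    {a b : V} {p : Quiver.Path a b} {x : U} (hx : IsFrame I p x) :
    HasSocle U S ↔ CorrespondsTo I S b :=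
  ⟨fun ⟨f⟩ => (hx.correspondsTo_socle hI).congr f,
    fun h => CorrespondsTo.nonempty_equiv (S := ModuleCat.of Λ (moduleSocle Λ U)) hI
      (by
        change IsSimpleModule Λ (moduleSocle Λ U)
        rw [hx.moduleSocle_eq (K := K) hI]
        exact hx.isSimpleModule_radPow (K := K) hI) hS (hx.correspondsTo_socle hI) h⟩

/-- A uniserial module of length `l + 1` with top and socle isomorphic to the simple module at `e`
has a mast of length `l` from `e` to `e`. -/
lemma exists_isFrame_of_hasTop_hasSocle (hI : PathAlgebra.IsAdmissible I)
    {U S : ModuleCat.{u} (PathAlgebra K V ⧸ I)} (hS : IsSimpleModule (PathAlgebra K V ⧸ I) S)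
    {e : V} (he : CorrespondsTo I S e) (hU : IsUniserial (PathAlgebra K V ⧸ I) U) {l : ℕ}
    (hl : Module.length (PathAlgebra K V ⧸ I) U = (l + 1 : ℕ)) (ht : HasTop U S)
    (hs : HasSocle U S) :
    ∃ (p : Quiver.Path e e) (x : U), p.length = l ∧ IsFrame I p x := by
  obtain ⟨l', h1, h2, h3⟩ := exists_radPow_of_isUniserial (K := K) hI hU
  obtain ⟨a, b, p, x, hp, hx⟩ := exists_isFrame (K := K) hI hU.2.2 h2 h3
  obtain rfl := ((hx.hasTop_iff hI hS).1 ht).eq hI hS he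
  obtain rfl := ((hx.hasSocle_iff hI hS).1 hs).eq hI hS he
  have h4 : ((l' + 1 : ℕ) : ℕ∞) = ((l + 1 : ℕ) : ℕ∞) := h1.symm.trans hl
  have h5 := Nat.cast_injective h4
  exact ⟨p, x, by omega, hx⟩

/-- The mast of `W` is a loop `γ`, so by (N) the mast of `U` is a power of `γ`, and `J^i U / J^(i+2)
U` has mast `γ` too. There are no coordinates for this mast, so the two modules are isomorphic. -/
lemma ConditionN.nonempty_radLayer_equiv (hN : ConditionN I) (hI : PathAlgebra.IsAdmissible I)
    {S W U : ModuleCat.{u} (PathAlgebra K V ⧸ I)} (hS : IsSimpleModule (PathAlgebra K V ⧸ I) S)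
    (hW : IsUniserial (PathAlgebra K V ⧸ I) W) (hW2 : Module.length (PathAlgebra K V ⧸ I) W = 2)
    (hWt : HasTop W S) (hWs : HasSocle W S) {l : ℕ}
    (hU : IsUniserial (PathAlgebra K V ⧸ I) U) (hUl : Module.length (PathAlgebra K V ⧸ I) U = l)
    (hUt : HasTop U S) (hUs : HasSocle U S) {i : ℕ} (hi : i + 2 ≤ l) :
    Nonempty (RadLayer (PathAlgebra K V ⧸ I) U i (i + 2) ≃ₗ[PathAlgebra K V ⧸ I] W) := by
  have hV := hN.subsingleton hI
  obtain ⟨e, he⟩ := exists_correspondsTo hS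
  obtain ⟨q, y, hq, hy⟩ := exists_isFrame_of_hasTop_hasSocle hI hS he hW (l := 1)
    (by rw [hW2]; rfl) hWt hWs
  obtain ⟨j, rfl⟩ : ∃ j, l = (i + (1 + j)) + 1 := ⟨l - i - 2, by omega⟩
  obtain ⟨p, x, hp, hx⟩ := exists_isFrame_of_hasTop_hasSocle hI hS he hU hUl hUt hUs
  obtain ⟨e', γ, q', hq', rfl⟩ := Quiver.Path.eq_toPath_comp_of_length_eq_succ q hq
  cases Quiver.Path.eq_of_length_zero q' hq'
  cases Quiver.Path.eq_nil_of_length_zero q' hq'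
  rw [Quiver.Path.comp_nil] at hy
  obtain ⟨m, rfl⟩ := hN.exists_eq_loopPow hI γ p (isMast_of_isFrame hI hx)
  rw [length_loopPow] at hp
  subst hp
  have h1 : IsRightSubpath ((loopPow γ i).comp γ.toPath) (loopPow γ (i + (1 + j))) :=
    ⟨loopPow γ j, by
      rw [loopPow_add, loopPow_add, Quiver.Path.comp_assoc]
      rfl⟩
  have h2 := hx.radLayer (K := K) hI h1 (hx.mem_radPow (K := K) hI _)
  obtain ⟨k, hk⟩ := h2.exists_isCoord (K := K) hI
  obtain ⟨k', hk'⟩ := hy.exists_isCoord (K := K) hI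
  have := isEmpty_detourVar_toPath hV γ
  obtain rfl := Subsingleton.elim k k'
  have h3 := h2.nonempty_equiv hI hy hk hk'
  rw [Quiver.Path.length_toPath, length_loopPow] at h3
  exact h3

/-! ### Self-extensions of simple modules -/

open CategoryTheory Abelian

/-- If the group of self-extensions were trivial, the isomorphism from the socle `JW` to `S` would
extend to a map `W → S`. Such a map sends `JW` into `JS = 0`, a contradiction. -/
lemma nontrivial_ext_of_isUniserial (hI : PathAlgebra.IsAdmissible I)
    {S W : ModuleCat.{u} (PathAlgebra K V ⧸ I)} (hS : IsSimpleModule (PathAlgebra K V ⧸ I) S)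
    (hW : IsUniserial (PathAlgebra K V ⧸ I) W) (hW2 : Module.length (PathAlgebra K V ⧸ I) W = 2)
    (hWt : HasTop W S) (hWs : HasSocle W S) : Nontrivial (Ext.{u} S S 1) := by
  by_contra hne
  rw [not_nontrivial_iff_subsingleton] at hne
  obtain ⟨e, he⟩ := exists_correspondsTo hS
  obtain ⟨q, y, hq, hy⟩ := exists_isFrame_of_hasTop_hasSocle hI hS he hW (l := 1)
    (by rw [hW2]; rfl) hWt hWs
  obtain ⟨t⟩ := hWt
  obtain ⟨s⟩ := hWs
  have hsoc := hy.moduleSocle_eq (K := K) hI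
  rw [hq] at hsoc
  let f := (radPow Λ W 1).mkQ
  have hf : f.shortComplexKer.ShortExact :=
    LinearMap.shortExact_shortComplexKer (Submodule.mkQ_surjective _)
  have hker : LinearMap.ker f = moduleSocle Λ W := by rw [hsoc, Submodule.ker_mkQ]
  let g : f.shortComplexKer.X₁ ⟶ S :=
    ModuleCat.ofHom ((LinearEquiv.ofEq _ _ hker).trans s).toLinearMap
  let i : f.shortComplexKer.X₃ ≅ S := LinearEquiv.toModuleIso t
  have h1 : hf.extClass.comp (Ext.mk₀ g) (add_zero 1) = 0 := by
    have h2 : (Ext.mk₀ i.inv).comp (hf.extClass.comp (Ext.mk₀ g) (add_zero 1)) (zero_add 1) = 0 :=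
      Subsingleton.elim _ _
    have h3 := congrArg (fun z => (Ext.mk₀ i.hom).comp z (zero_add 1)) h2
    simpa using h3
  obtain ⟨x₂, hx₂⟩ := Ext.contravariant_sequence_exact₁ hf S (Ext.mk₀ g) (add_zero 1) h1
  obtain ⟨h, rfl⟩ := Ext.homEquiv₀.symm.surjective x₂
  change (Ext.mk₀ f.shortComplexKer.f).comp (Ext.mk₀ h) _ = _ at hx₂
  rw [Ext.mk₀_comp_mk₀] at hx₂
  have h4 : f.shortComplexKer.f ≫ h = g := Ext.homEquiv₀.symm.injective hx₂
  have hz : pathElt I q • y ∈ radPow Λ W 1 := by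
    have := hy.mem_radPow (K := K) hI q
    rwa [hq] at this
  have hz' : pathElt I q • y ∈ LinearMap.ker f := by rwa [Submodule.ker_mkQ]
  have h5 : g.hom ⟨pathElt I q • y, hz'⟩ = 0 := by
    rw [← h4]
    have h6 := map_mem_radPow h.hom hz
    rwa [radPow_one_eq_bot_of_simple (K := K) hI hS, Submodule.mem_bot] at h6
  have h7 := (LinearEquiv.map_eq_zero_iff ((LinearEquiv.ofEq _ _ hker).trans s)).1 h5
  exact hy.ne (congrArg Subtype.val h7)

/-- As `R` is projective, the connecting map from homomorphisms `ker → S` to self-extensions of `S`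
is onto. -/
lemma exists_ker_toSpanSingleton_hom_ne_zero {R : Type u} [Ring R] {S : ModuleCat.{u} R}
    [Nontrivial (Ext.{u} S S 1)] {s : S} (hs : Function.Surjective (LinearMap.toSpanSingleton R S s)) :
    ∃ g : LinearMap.ker (LinearMap.toSpanSingleton R S s) →ₗ[R] S, g ≠ 0 := by
  obtain ⟨x, hx⟩ := exists_ne (0 : Ext.{u} S S 1)
  have hf := LinearMap.shortExact_shortComplexKer hs
  have : Projective (LinearMap.toSpanSingleton R S s).shortComplexKer.X₂ :=
    inferInstanceAs (Projective (ModuleCat.of R R))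
  obtain ⟨y, hy⟩ := Ext.contravariant_sequence_exact₃ hf S x (Ext.eq_zero_of_projective _)
    (add_zero 1)
  obtain ⟨g, rfl⟩ := Ext.homEquiv₀.symm.surjective y
  refine ⟨g.hom, fun hg => hx ?_⟩
  have h0 : g = 0 := ModuleCat.hom_ext hg
  rw [← hy, h0]
  change hf.extClass.comp (Ext.mk₀ 0) _ = 0
  rw [Ext.mk₀_zero, Ext.comp_zero]

/-- If there is no loop at `e`, then all homomorphisms from the annihilator of an element of the
simple module at `e` to this simple module vanish. -/
lemma eq_zero_of_isEmpty_loop (hI : PathAlgebra.IsAdmissible I)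
    {S : ModuleCat.{u} (PathAlgebra K V ⧸ I)} (hS : IsSimpleModule (PathAlgebra K V ⧸ I) S)
    {e : V} {s : S} (hs : vertexElt I e • s ≠ 0) (he : IsEmpty (e ⟶ e))
    (g : LinearMap.ker (LinearMap.toSpanSingleton (PathAlgebra K V ⧸ I) S s)
      →ₗ[PathAlgebra K V ⧸ I] S) : g = 0 := by
  let N : Submodule Λ Λ := LinearMap.ker (LinearMap.toSpanSingleton (PathAlgebra K V ⧸ I) S s)
  let A : Submodule Λ Λ := (LinearMap.ker g).map N.subtype
  have hs0 : s ≠ 0 := fun h => hs (by rw [h, smul_zero])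
  have hact := simple_smul_eq (K := K) hI hS hs
  have hN : ∀ r : Λ, r ∈ N ↔ vertexChar hI e r = 0 := fun r => by
    change r • s = 0 ↔ _
    rw [hact, smul_eq_zero, or_iff_left hs0]
  -- For `d ≠ e` the vertex `d` acts on `S` as zero, so `g` kills every element of `N` fixed by `d`.
  have hA : ∀ (r : Λ) (d : V), d ≠ e → vertexElt I d * r = r → r ∈ N → r ∈ A := by
    intro r d hd hr hrN
    refine ⟨⟨r, hrN⟩, ?_, rfl⟩
    have h1 : (⟨r, hrN⟩ : N) = vertexElt I d • ⟨r, hrN⟩ := Subtype.ext hr.symm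
    rw [SetLike.mem_coe, LinearMap.mem_ker, h1, map_smul, hact, vertexChar_of_ne hI hd, zero_smul]
  have hvertex : ∀ v : V, v ≠ e → vertexElt I v ∈ A := fun v hv =>
    hA _ v hv (vertexElt_mul_self I v) ((hN _).2 (vertexChar_of_ne hI hv))
  -- An arrow starting at `e` ends elsewhere, as there is no loop; any other arrow is a left
  -- multiple of a vertex in `A`.
  have harrow : ∀ (c d : V) (β : c ⟶ d), pathElt I β.toPath ∈ A := by
    intro c d β
    by_cases hc : c = e
    · have hd : d ≠ e := by
        rintro rfl
        subst hc
        exact he.elim β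
      refine hA _ d hd (vertexElt_mul_pathElt I _) ((hN _).2 ?_)
      exact vertexChar_of_mem_longSpan hI e (pathElt_mem_longSpan _ le_rfl)
    · rw [← pathElt_mul_vertexElt I β.toPath]
      exact A.smul_mem _ (hvertex c hc)
  have hpath : ∀ (c d : V) (q : Quiver.Path c d), 1 ≤ q.length → pathElt I q ∈ A := by
    intro c d q
    induction q with
    | nil => simp
    | cons q β ih =>
      intro _
      rcases Nat.eq_zero_or_pos q.length with h | h
      · cases Quiver.Path.eq_of_length_zero q h
        cases Quiver.Path.eq_nil_of_length_zero q h
        exact harrow _ _ β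
      · rw [pathElt_cons]
        exact A.smul_mem _ (ih h)
  have hlong : longSpan I 1 ≤ A.restrictScalars K := by
    refine Submodule.span_le.2 ?_
    rintro _ ⟨c, d, q, hq, rfl⟩
    exact hpath c d q hq
  ext ⟨r, hr⟩
  have h1 : r ∈ A.restrictScalars K := by
    rw [← sub_add_cancel r (∑ v : V, vertexChar hI v r • vertexElt I v)]
    refine add_mem (hlong (sub_sum_vertexChar_mem hI r)) (sum_mem fun v _ => ?_)
    by_cases hv : v = e
    · rw [hv, (hN r).1 hr, zero_smul]
      exact zero_mem _
    · exact Submodule.smul_mem _ _ (hvertex v hv)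
  obtain ⟨⟨r', hr'⟩, h2, rfl⟩ := h1
  exact h2

lemma exists_isUniserial_of_loop (hI : PathAlgebra.IsAdmissible I)
    {S : ModuleCat.{u} (PathAlgebra K V ⧸ I)} (hS : IsSimpleModule (PathAlgebra K V ⧸ I) S)
    {e : V} (he : CorrespondsTo I S e) (γ : e ⟶ e) :
    ∃ W : ModuleCat.{u} (PathAlgebra K V ⧸ I), IsUniserial (PathAlgebra K V ⧸ I) W ∧
      Module.length (PathAlgebra K V ⧸ I) W = 2 ∧ HasTop W S ∧ HasSocle W S := by
  have h0 := mem_pathVariety_of_length_le_one hI (p := γ.toPath) le_rfl 0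
  have h1 := PointModule.isFrame h0 hI
  obtain ⟨h2, h3⟩ := isUniserial_of_chain (K := K) hI h1.chain (h1.radPow_ne_bot hI) h1.bot
  refine ⟨ModuleCat.of _ (PointModule h0), h2, h3, ?_, ?_⟩
  · exact (IsFrame.hasTop_iff (U := ModuleCat.of _ (PointModule h0)) hI hS h1).2 he
  · exact (IsFrame.hasSocle_iff (U := ModuleCat.of _ (PointModule h0)) hI hS h1).2 he

/-- A simple module has non-trivial self-extensions if and only if there is a uniserial module of
length two with this simple module as top and socle. -/
lemma exists_isUniserial_iff_nontrivial_ext (hI : PathAlgebra.IsAdmissible I)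
    {S : ModuleCat.{u} (PathAlgebra K V ⧸ I)} (hS : IsSimpleModule (PathAlgebra K V ⧸ I) S) :
    (∃ W : ModuleCat.{u} (PathAlgebra K V ⧸ I), IsUniserial (PathAlgebra K V ⧸ I) W ∧
      Module.length (PathAlgebra K V ⧸ I) W = 2 ∧ HasTop W S ∧ HasSocle W S) ↔
    Nontrivial (Ext.{u} S S 1) := by
  refine ⟨fun ⟨W, h1, h2, h3, h4⟩ => nontrivial_ext_of_isUniserial hI hS h1 h2 h3 h4, fun _ => ?_⟩
  obtain ⟨e, he⟩ := exists_correspondsTo hS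
  obtain ⟨s, hs⟩ := id he
  have hs0 : s ≠ 0 := fun h => hs (by rw [h, smul_zero])
  obtain ⟨g, hg⟩ := exists_ker_toSpanSingleton_hom_ne_zero
    (IsSimpleModule.toSpanSingleton_surjective _ hs0)
  by_cases hl : IsEmpty (e ⟶ e)
  · exact absurd (eq_zero_of_isEmpty_loop hI hS hs hl g) hg
  · obtain ⟨γ⟩ := not_isEmpty_iff.1 hl
    exact exists_isUniserial_of_loop hI hS he γ

end BoundQuiver

/-! ### Isomorphisms of bound path algebras -/

section Transfer

variable {K V V' : Type u} [Field K] [Quiver.{u} V] [Fintype V] [Quiver.{u} V'] [Fintype V']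
variable {I : Ideal (PathAlgebra K V)} [I.IsTwoSided]
variable {I' : Ideal (PathAlgebra K V')} [I'.IsTwoSided]

local notation "Λ" => (PathAlgebra K V ⧸ I)
local notation "Λ'" => (PathAlgebra K V' ⧸ I')

lemma eq_of_vertexChar_eq (hI : PathAlgebra.IsAdmissible I) {v w : V}
    (h : ∀ r, vertexChar hI v r = vertexChar hI w r) : v = w := by
  by_contra hne
  have h1 := h (vertexElt I v)
  rw [vertexChar_self, vertexChar_of_ne hI hne] at h1
  exact one_ne_zero h1

/-- The values of `f` on the orthogonal idempotents are zero except at one vertex, where the value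
is one; nilpotent elements are mapped to zero. -/
lemma exists_eq_vertexChar (hI : PathAlgebra.IsAdmissible I) (f : (PathAlgebra K V ⧸ I) →ₐ[K] K) :
    ∃ v, ∀ r, f r = vertexChar hI v r := by
  have h1 : ∃ v, f (vertexElt I v) ≠ 0 := by
    by_contra! h
    have h2 := congrArg f (sum_vertexElt I)
    rw [map_sum, map_one, Finset.sum_eq_zero fun v _ => h v] at h2
    exact zero_ne_one h2
  obtain ⟨v, hv⟩ := h1
  have h2 : f (vertexElt I v) = 1 := by
    have h3 := congrArg f (vertexElt_mul_self I v)
    rw [map_mul] at h3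
    exact mul_right_cancel₀ hv (h3.trans (one_mul _).symm)
  refine ⟨v, fun r => ?_⟩
  have h3 : f (r - ∑ w : V, vertexChar hI w r • vertexElt I w) = 0 :=
    ((isNilpotent_of_mem_longSpan hI (sub_sum_vertexChar_mem hI r)).map f).eq_zero
  rw [map_sub, sub_eq_zero, map_sum, Finset.sum_eq_single v] at h3
  · rw [h3, map_smul, h2, smul_eq_mul, mul_one]
  · intro w _ hw
    have h4 : f (vertexElt I w) * f (vertexElt I v) = 0 := by
      rw [← map_mul, vertexElt_mul_of_ne I hw, map_zero]
    rw [map_smul, (mul_eq_zero.1 h4).resolve_right hv, smul_zero]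
  · intro h
    exact absurd (Finset.mem_univ v) h

/-- The vertices `v` and `v'` correspond to each other under `φ`: the isomorphism `φ` takes the
simple module at `v` to the simple module at `v'`. -/
def VertexCorr (hI : PathAlgebra.IsAdmissible I) (hI' : PathAlgebra.IsAdmissible I')
    (φ : (PathAlgebra K V ⧸ I) ≃ₐ[K] (PathAlgebra K V' ⧸ I')) (v : V) (v' : V') : Prop :=
  ∀ r, vertexChar hI' v' (φ r) = vertexChar hI v r

variable {hI : PathAlgebra.IsAdmissible I} {hI' : PathAlgebra.IsAdmissible I'}
variable {φ : (PathAlgebra K V ⧸ I) ≃ₐ[K] (PathAlgebra K V' ⧸ I')}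

lemma VertexCorr.symm {v : V} {v' : V'} (h : VertexCorr hI hI' φ v v') :
    VertexCorr hI' hI φ.symm v' v := fun r => by rw [← h, AlgEquiv.apply_symm_apply]

lemma VertexCorr.unique {v : V} {v' w' : V'} (h : VertexCorr hI hI' φ v v')
    (h' : VertexCorr hI hI' φ v w') : v' = w' :=
  eq_of_vertexChar_eq hI' fun r => by
    obtain ⟨s, rfl⟩ := φ.surjective r
    rw [h, h']

lemma exists_vertexCorr (hI : PathAlgebra.IsAdmissible I)
    (hI' : PathAlgebra.IsAdmissible I')
    (φ : (PathAlgebra K V ⧸ I) ≃ₐ[K] (PathAlgebra K V' ⧸ I')) (v : V) : ∃ v', VertexCorr hI hI' φ v v' := by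
  obtain ⟨v', h⟩ := exists_eq_vertexChar hI' ((vertexChar hI v).comp φ.symm.toAlgHom)
  refine ⟨v', fun r => ?_⟩
  rw [← h]
  exact congrArg (vertexChar hI v) (φ.symm_apply_apply r)

lemma exists_vertexCorr' (hI : PathAlgebra.IsAdmissible I)
    (hI' : PathAlgebra.IsAdmissible I')
    (φ : (PathAlgebra K V ⧸ I) ≃ₐ[K] (PathAlgebra K V' ⧸ I')) (v' : V') : ∃ v, VertexCorr hI hI' φ v v' := by
  obtain ⟨v, h⟩ := exists_vertexCorr hI' hI φ.symm v'
  exact ⟨v, h.symm⟩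

lemma VertexCorr.map_vertexElt_sub_mem {v : V} {v' : V'} (h : VertexCorr hI hI' φ v v') :
    φ (vertexElt I v) - vertexElt I' v' ∈ longSpan I' 1 := by
  rw [mem_longSpan_one_iff hI']
  intro w'
  obtain ⟨w, hw⟩ := exists_vertexCorr' hI hI' φ w'
  rw [map_sub, hw]
  by_cases hvw : v = w
  · subst hvw
    obtain rfl := h.unique hw
    rw [vertexChar_self, vertexChar_self, sub_self]
  · have hvw' : v' ≠ w' := fun h' => hvw (by
      subst h'
      exact h.symm.unique hw.symm)
    rw [vertexChar_of_ne hI hvw, vertexChar_of_ne hI' hvw', sub_self]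

/-- The common kernel of the vertex characters is preserved because `φ` matches these characters.
Higher spans consist of combinations of products of elements of this kernel. -/
lemma map_mem_longSpan (hI : PathAlgebra.IsAdmissible I)
    (hI' : PathAlgebra.IsAdmissible I')
    (φ : (PathAlgebra K V ⧸ I) ≃ₐ[K] (PathAlgebra K V' ⧸ I')) {n : ℕ} {r : PathAlgebra K V ⧸ I} (hr : r ∈ longSpan I n) :
    φ r ∈ longSpan I' n := by
  have h1 : ∀ r ∈ longSpan I 1, φ r ∈ longSpan I' 1 := by
    intro r hr
    rw [mem_longSpan_one_iff hI']
    intro w'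
    obtain ⟨w, hw⟩ := exists_vertexCorr' hI hI' φ w'
    rw [hw]
    exact vertexChar_of_mem_longSpan hI w hr
  have h2 : ∀ (a b : V) (p : Quiver.Path a b), φ (pathElt I p) ∈ longSpan I' p.length := by
    intro a b p
    induction p with
    | nil => exact mem_longSpan_zero _
    | cons p α ih =>
      rw [pathElt_cons, map_mul, Quiver.Path.length_cons, add_comm]
      exact mul_mem_longSpan (h1 _ (pathElt_mem_longSpan _ le_rfl)) ih
  refine longSpan_induction (P := fun r => φ r ∈ longSpan I' n) ?_ ?_ ?_ ?_ hr
  · exact fun a b p hp => longSpan_anti hp (h2 a b p)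
  · rw [map_zero]
    exact zero_mem _
  · intro x y hx hy
    rw [map_add]
    exact add_mem hx hy
  · intro c x hx
    rw [map_smul]
    exact Submodule.smul_mem _ _ hx

lemma map_mem_longSpan_iff (hI : PathAlgebra.IsAdmissible I)
    (hI' : PathAlgebra.IsAdmissible I')
    (φ : (PathAlgebra K V ⧸ I) ≃ₐ[K] (PathAlgebra K V' ⧸ I')) {n : ℕ} {r : PathAlgebra K V ⧸ I} :
    φ r ∈ longSpan I' n ↔ r ∈ longSpan I n := by
  refine ⟨fun h => ?_, map_mem_longSpan hI hI' φ⟩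
  have := map_mem_longSpan hI' hI φ.symm h
  rwa [AlgEquiv.symm_apply_apply] at this

/-! ### Correspondence of arrows -/

lemma vertexElt_mul_mul_vertexElt_mem {r : PathAlgebra K V ⧸ I} (hr : r ∈ longSpan I 1) (c d : V) :
    vertexElt I d * r * vertexElt I c ∈
      Submodule.span K (Set.range fun α : c ⟶ d => pathElt I α.toPath) ⊔ longSpan I 2 := by
  refine longSpan_induction (P := fun r => vertexElt I d * r * vertexElt I c ∈
    Submodule.span K (Set.range fun α : c ⟶ d => pathElt I α.toPath) ⊔ longSpan I 2)
    ?_ ?_ ?_ ?_ hr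
  · intro a b q hq
    by_cases hb : d = b
    · by_cases ha : a = c
      · subst hb ha
        rw [vertexElt_mul_pathElt, pathElt_mul_vertexElt]
        rcases Nat.lt_or_ge 1 q.length with h | h
        · exact Submodule.mem_sup_right (pathElt_mem_longSpan q h)
        · obtain ⟨e, α, q', hq', rfl⟩ := Quiver.Path.eq_toPath_comp_of_length_eq_succ q
            (le_antisymm h hq)
          cases Quiver.Path.eq_of_length_zero q' hq'
          cases Quiver.Path.eq_nil_of_length_zero q' hq'
          exact Submodule.mem_sup_left (Submodule.subset_span ⟨α, rfl⟩)
      · rw [mul_assoc, pathElt_mul_vertexElt_of_ne I q ha, mul_zero]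
        exact zero_mem _
    · rw [vertexElt_mul_pathElt_of_ne I q hb, zero_mul]
      exact zero_mem _
  · rw [mul_zero, zero_mul]
    exact zero_mem _
  · intro x y hx hy
    rw [mul_add, add_mul]
    exact add_mem hx hy
  · intro s x hx
    rw [mul_smul_comm, smul_mul_assoc]
    exact Submodule.smul_mem _ _ hx

lemma toPath_notMem_longSpan_two (hI : PathAlgebra.IsAdmissible I) {c d : V} (α : c ⟶ d) :
    pathElt I α.toPath ∉ longSpan I 2 := fun h => by
  have h1 := eltCoeff_of_mem_longSpan hI α.toPath (by rw [Quiver.Path.length_toPath]; omega)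
    (by rw [Quiver.Path.length_toPath]; omega) h
  rw [eltCoeff_pathElt, if_pos rfl] at h1
  exact one_ne_zero h1

/-- The isomorphism preserves `J / J²` together with the action of corresponding vertices, and the
part from `c'` to `d'` is spanned by arrows, of which there is at most one. -/
lemma VertexCorr.exists_arrow {c d : V} {c' d' : V'} (hc : VertexCorr hI hI' φ c c')
    (hd : VertexCorr hI hI' φ d d') [Subsingleton (c' ⟶ d')] (α : c ⟶ d) :
    ∃ (α' : c' ⟶ d') (s : K), s ≠ 0 ∧
      φ (pathElt I α.toPath) - s • pathElt I' α'.toPath ∈ longSpan I' 2 := by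
  set r := φ (pathElt I α.toPath) with hr
  have h1 : r ∈ longSpan I' 1 := map_mem_longSpan hI hI' φ (pathElt_mem_longSpan _ le_rfl)
  -- Replacing the images of the vertices by `c'` and `d'` changes `r` only within `J²`, as both the
  -- vertex errors and `r` lie in `J`.
  have h2 : r - vertexElt I' d' * r * vertexElt I' c' ∈ longSpan I' 2 := by
    have e1 : r = φ (vertexElt I d) * r * φ (vertexElt I c) := by
      rw [hr, ← map_mul, ← map_mul, vertexElt_mul_pathElt, pathElt_mul_vertexElt]
    have e2 : r - vertexElt I' d' * r * vertexElt I' c' =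
        (φ (vertexElt I d) - vertexElt I' d') * r * φ (vertexElt I c) +
          vertexElt I' d' * (r * (φ (vertexElt I c) - vertexElt I' c')) := by
      have e3 : (φ (vertexElt I d) - vertexElt I' d') * r * φ (vertexElt I c) +
          vertexElt I' d' * (r * (φ (vertexElt I c) - vertexElt I' c')) =
          φ (vertexElt I d) * r * φ (vertexElt I c) - vertexElt I' d' * r * vertexElt I' c' := by
        noncomm_ring
      rw [e3, ← e1]
    rw [e2]
    refine add_mem ?_ ?_
    · exact mul_mem_longSpan (m := 2) (n := 0)
        (mul_mem_longSpan (m := 1) (n := 1) hd.map_vertexElt_sub_mem h1) (mem_longSpan_zero _)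
    · exact mul_mem_longSpan (m := 0) (n := 2) (mem_longSpan_zero _)
        (mul_mem_longSpan (m := 1) (n := 1) h1 hc.map_vertexElt_sub_mem)
  have h3 : r ∉ longSpan I' 2 := by
    rw [hr, map_mem_longSpan_iff hI hI' φ]
    exact toPath_notMem_longSpan_two hI α
  obtain ⟨y, hy, z, hz, hyz⟩ := Submodule.mem_sup.1 (vertexElt_mul_mul_vertexElt_mem h1 c' d')
  have h4 : r - y ∈ longSpan I' 2 := by
    have : r - y = (r - vertexElt I' d' * r * vertexElt I' c') + z := by
      rw [← hyz]
      abel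
    rw [this]
    exact add_mem h2 hz
  rcases isEmpty_or_nonempty (c' ⟶ d') with hE | ⟨⟨α'⟩⟩
  · rw [Set.range_eq_empty, Submodule.span_empty, Submodule.mem_bot] at hy
    rw [hy, sub_zero] at h4
    exact absurd h4 h3
  · have h5 : (Set.range fun α : c' ⟶ d' => pathElt I' α.toPath) = {pathElt I' α'.toPath} := by
      ext t
      constructor
      · rintro ⟨β, rfl⟩
        rw [Subsingleton.elim β α']
        rfl
      · rintro rfl
        exact ⟨α', rfl⟩
    rw [h5] at hy
    obtain ⟨s, rfl⟩ := Submodule.mem_span_singleton.1 hy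
    refine ⟨α', s, ?_, h4⟩
    rintro rfl
    rw [zero_smul, sub_zero] at h4
    exact h3 h4

/-- Two parallel arrows would have proportional images modulo `J²`, although distinct arrows are
linearly independent there. -/
lemma subsingleton_of_algEquiv (hI : PathAlgebra.IsAdmissible I)
    (hI' : PathAlgebra.IsAdmissible I')
    (φ : (PathAlgebra K V ⧸ I) ≃ₐ[K] (PathAlgebra K V' ⧸ I'))
    (hV : ∀ c' d' : V', Subsingleton (c' ⟶ d')) (c d : V) :
    Subsingleton (c ⟶ d) := by
  refine ⟨fun α β => ?_⟩
  by_contra hne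
  obtain ⟨c', hc⟩ := exists_vertexCorr hI hI' φ c
  obtain ⟨d', hd⟩ := exists_vertexCorr hI hI' φ d
  have := hV c' d'
  obtain ⟨α', s, hs, hα⟩ := hc.exists_arrow hd α
  obtain ⟨β', t, ht, hβ⟩ := hc.exists_arrow hd β
  obtain rfl := Subsingleton.elim α' β'
  have h1 : φ (t • pathElt I α.toPath - s • pathElt I β.toPath) ∈ longSpan I' 2 := by
    have e : φ (t • pathElt I α.toPath - s • pathElt I β.toPath) =
        t • (φ (pathElt I α.toPath) - s • pathElt I' α'.toPath) -
          s • (φ (pathElt I β.toPath) - t • pathElt I' α'.toPath) := by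
      rw [map_sub, map_smul, map_smul, smul_sub, smul_sub, smul_comm t s]
      abel
    rw [e]
    exact sub_mem (Submodule.smul_mem _ _ hα) (Submodule.smul_mem _ _ hβ)
  rw [map_mem_longSpan_iff hI hI' φ] at h1
  have h2 := eltCoeff_of_mem_longSpan hI α.toPath (by rw [Quiver.Path.length_toPath]; omega)
    (by rw [Quiver.Path.length_toPath]; omega) h1
  rw [map_sub, map_smul, map_smul, eltCoeff_pathElt, eltCoeff_pathElt, if_pos rfl, if_neg] at h2
  · simp [ht] at h2
  · intro h
    apply hne
    have h3 := eq_of_heq (Sigma.mk.inj (eq_of_heq (Sigma.mk.inj h).2)).2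
    exact (eq_of_heq (Quiver.Path.cons.inj h3).2.2).symm

/-! ### Correspondence of paths -/

/-- The right subpaths of `p'` are, up to non-zero scalars and longer paths, the images under `φ` of
the right subpaths of `p`. -/
def PathCorr (hI : PathAlgebra.IsAdmissible I) (hI' : PathAlgebra.IsAdmissible I')
    (φ : (PathAlgebra K V ⧸ I) ≃ₐ[K] (PathAlgebra K V' ⧸ I')) {a b : V} {a' b' : V'}
    (p : Quiver.Path a b) (p' : Quiver.Path a' b') : Prop :=
  p'.length = p.length ∧ ∀ (c : V) (u : Quiver.Path a c), IsRightSubpath u p →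
    ∃ (c' : V') (u' : Quiver.Path a' c'), IsRightSubpath u' p' ∧ u'.length = u.length ∧
      VertexCorr hI hI' φ c c' ∧ ∃ s : K, s ≠ 0 ∧
        φ (pathElt I u) - s • pathElt I' u' ∈ longSpan I' (u.length + 1)

/-- The arrows of `p` are matched one after the other; leading scalars multiply, and the error terms
remain longer than the product. -/
lemma VertexCorr.exists_pathCorr (hV : ∀ c' d' : V', Subsingleton (c' ⟶ d')) {a : V} {a' : V'}
    (ha : VertexCorr hI hI' φ a a') {b : V} (p : Quiver.Path a b) :
    ∃ (b' : V') (p' : Quiver.Path a' b'), PathCorr hI hI' φ p p' := by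
  induction p with
  | nil =>
    refine ⟨a', Quiver.Path.nil, rfl, fun c u hu => ?_⟩
    cases IsRightSubpath.eq_of_length_eq hu (Nat.le_zero.1 hu.length_le)
    refine ⟨a', Quiver.Path.nil, IsRightSubpath.refl _, rfl, ha, 1, one_ne_zero, ?_⟩
    rw [one_smul]
    exact ha.map_vertexElt_sub_mem
  | @cons b d p α ih =>
    obtain ⟨b', p', hl, h⟩ := ih
    obtain ⟨c', u', hu', hul, hc, t, ht, hut⟩ := h b p (IsRightSubpath.refl p)
    cases IsRightSubpath.eq_of_length_eq hu' (hul.trans hl.symm)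
    obtain ⟨d', hd⟩ := exists_vertexCorr hI hI' φ d
    have := hV b' d'
    obtain ⟨α', s, hs, hα⟩ := hc.exists_arrow hd α
    refine ⟨d', p'.cons α', by simp [hl], fun c u hu => ?_⟩
    rcases hu.eq_or_of_cons with h1 | h1
    · cases h1
      refine ⟨d', p'.cons α', IsRightSubpath.refl _, by simp [hl], hd, s * t, mul_ne_zero hs ht, ?_⟩
      have e : φ (pathElt I (p.cons α)) - (s * t) • pathElt I' (p'.cons α') =
          (φ (pathElt I α.toPath) - s • pathElt I' α'.toPath) * φ (pathElt I p) +
            (s • pathElt I' α'.toPath) * (φ (pathElt I p) - t • pathElt I' p') := by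
        rw [pathElt_cons, pathElt_cons, map_mul, sub_mul, mul_sub, smul_mul_smul_comm]
        abel
      rw [e, Quiver.Path.length_cons]
      refine add_mem ?_ ?_
      · have := mul_mem_longSpan hα (map_mem_longSpan hI hI' φ (pathElt_mem_longSpan p le_rfl))
        rwa [show 2 + p.length = p.length + 1 + 1 by omega] at this
      · have := mul_mem_longSpan (Submodule.smul_mem _ s (pathElt_mem_longSpan α'.toPath le_rfl)) hut
        rwa [Quiver.Path.length_toPath, show 1 + (p.length + 1) = p.length + 1 + 1 by omega] at this
    · obtain ⟨c', u', h2, h3⟩ := h c u h1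
      exact ⟨c', u', h2.cons_right α', h3⟩

lemma PathCorr.exists_symm {a b : V} {a' b' : V'} {p : Quiver.Path a b} {p' : Quiver.Path a' b'}
    (h : PathCorr hI hI' φ p p') {c : V} {u : Quiver.Path a c} (hu : IsRightSubpath u p) :
    ∃ (c' : V') (u' : Quiver.Path a' c'), IsRightSubpath u' p' ∧ u'.length = u.length ∧
      VertexCorr hI hI' φ c c' ∧ ∃ s : K, s ≠ 0 ∧
        φ.symm (pathElt I' u') - s • pathElt I u ∈ longSpan I (u.length + 1) := by
  obtain ⟨c', u', h1, h2, h3, s, hs, h4⟩ := h.2 c u hu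
  refine ⟨c', u', h1, h2, h3, s⁻¹, inv_ne_zero hs, ?_⟩
  rw [← map_mem_longSpan_iff hI hI' φ]
  have e : φ (φ.symm (pathElt I' u') - s⁻¹ • pathElt I u) =
      (-s⁻¹) • (φ (pathElt I u) - s • pathElt I' u') := by
    rw [map_sub, AlgEquiv.apply_symm_apply, map_smul, smul_sub, smul_smul, neg_mul,
      inv_mul_cancel₀ hs, neg_smul, neg_smul, one_smul]
    abel
  rw [e]
  exact Submodule.smul_mem _ _ h4

lemma PathCorr.symm {a b : V} {a' b' : V'} {p : Quiver.Path a b} {p' : Quiver.Path a' b'}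
    (h : PathCorr hI hI' φ p p') : PathCorr hI' hI φ.symm p' p := by
  refine ⟨h.1.symm, fun c' u' hu' => ?_⟩
  obtain ⟨c, u, hu, hl⟩ := IsRightSubpath.exists_length p (i := u'.length)
    (hu'.length_le.trans h.1.le)
  obtain ⟨c'', u'', h1, h2, h3, h4⟩ := h.exists_symm hu
  cases IsRightSubpath.sigma_eq h1 hu' (h2.trans hl)
  exact ⟨c, u, hu, hl, h3.symm, by rwa [h2]⟩

lemma PathCorr.exists_symm_top {a b : V} {a' b' : V'} {p : Quiver.Path a b}
    {p' : Quiver.Path a' b'} (h : PathCorr hI hI' φ p p') :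
    ∃ s : K, s ≠ 0 ∧ φ.symm (pathElt I' p') - s • pathElt I p ∈ longSpan I (p.length + 1) := by
  obtain ⟨c', u', h1, h2, -, h4⟩ := h.exists_symm (IsRightSubpath.refl p)
  cases h1.eq_of_length_eq (h2.trans h.1.symm)
  exact h4

/-- A module over isomorphic algebras. -/
lemma IsFrame.transfer {M : Type u} [AddCommGroup M] [Module (PathAlgebra K V ⧸ I) M]
    [Module (PathAlgebra K V' ⧸ I') M] [Module K M] [IsScalarTower K (PathAlgebra K V ⧸ I) M]
    [IsScalarTower K (PathAlgebra K V' ⧸ I') M] {a b : V} {a' b' : V'} {p : Quiver.Path a b}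
    {p' : Quiver.Path a' b'} {x : M} (hx : IsFrame I p x) (hφM : ∀ (r : Λ) (m : M), φ r • m = r • m)
    (hφ : φ (vertexElt I a) = vertexElt I' a') (h : PathCorr hI hI' φ p p') :
    IsFrame I' p' x where
  vertex := by rw [← hφ, hφM, hx.vertex]
  chain A B := by
    let res : Submodule Λ' M → Submodule Λ M := fun A =>
      { A.toAddSubmonoid with
        smul_mem' := fun r m hm => by
          rw [← hφM]
          exact A.smul_mem _ hm }
    exact hx.chain (res A) (res B)
  ne := by
    obtain ⟨s, hs, h1⟩ := h.exists_symm_top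
    have h2 := smul_mem_radPow hI h1 (i := 0) (m := x) trivial
    rw [zero_add, hx.bot, Submodule.mem_bot, sub_smul, sub_eq_zero, smul_assoc] at h2
    have h3 := hφM (φ.symm (pathElt I' p')) x
    rw [AlgEquiv.apply_symm_apply] at h3
    rw [h3, h2]
    exact smul_ne_zero hs hx.ne
  bot := by
    refine radPow_eq_bot_of_forall (K := K) hI' fun c d q hq m => ?_
    have h3 := hφM (φ.symm (pathElt I' q)) m
    rw [AlgEquiv.apply_symm_apply] at h3
    have h4 := smul_mem_radPow hI (map_mem_longSpan hI' hI φ.symm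
      (pathElt_mem_longSpan q (hq.trans (congrArg (· + 1) h.1)).ge)) (i := 0) (m := m) trivial
    rw [zero_add, hx.bot, Submodule.mem_bot] at h4
    rw [h3, h4]

end Transfer

/-! ### Polynomial coordinates -/

section Polynomial

/-- The `w` are obtained from the `b` by a triangular system with respect to `len`. Its diagonal
entries are non-zero constants, independent of `x`, so no division by polynomials is needed and the
inverse is polynomial. The system is solved from the largest `len` downwards. -/
lemma exists_polynomial_combination {K : Type*} [Field K] {X σ ι ι' : Type*} {E : X → Type*}
    [∀ x, AddCommGroup (E x)] [∀ x, Module K (E x)] [Fintype ι] [Fintype ι'] (pt : X → σ → K)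
    (b : ι → ∀ x, E x) (w : ι' → ∀ x, E x) (len : ι → ℕ) {N : ℕ} (hN : ∀ i, len i ≤ N)
    (h : ∀ i, ∃ (j : ι') (s : K) (c : ι → MvPolynomial σ K), s ≠ 0 ∧
      (∀ i', len i' ≤ len i → c i' = 0) ∧
      ∀ x, w j x = s • b i x + ∑ i', MvPolynomial.eval (pt x) (c i') • b i' x) (i : ι) :
    ∃ d : ι' → MvPolynomial σ K, ∀ x, b i x = ∑ j, MvPolynomial.eval (pt x) (d j) • w j x := by
  classical
  induction hm : N - len i using Nat.strong_induction_on generalizing i with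
  | _ m ih =>
  subst hm
  obtain ⟨j, s, c, hs, hc, hw⟩ := h i
  have h1 : ∀ i', ∃ d : ι' → MvPolynomial σ K, len i < len i' →
      ∀ x, b i' x = ∑ j, MvPolynomial.eval (pt x) (d j) • w j x := by
    intro i'
    by_cases hi : len i < len i'
    · obtain ⟨d, hd⟩ := ih (N - len i') (by have := hN i'; omega) i' rfl
      exact ⟨d, fun _ => hd⟩
    · exact ⟨0, fun h' => absurd h' hi⟩
  choose d hd using h1
  -- The relation for `w j` is solved for `b i`, with the expansions of the longer `b i'` inserted.
  -- For the other `i'` the choice of `d i'` does not matter, since `c i' = 0`.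
  refine ⟨fun j' => MvPolynomial.C s⁻¹ * ((if j' = j then 1 else 0) - ∑ i', c i' * d i' j'),
    fun x => ?_⟩
  have h2 : ∑ i', MvPolynomial.eval (pt x) (c i') • b i' x =
      ∑ j', (∑ i', MvPolynomial.eval (pt x) (c i') * MvPolynomial.eval (pt x) (d i' j')) •
        w j' x := by
    simp_rw [Finset.sum_smul]
    rw [Finset.sum_comm]
    refine Finset.sum_congr rfl fun i' _ => ?_
    by_cases hi : len i < len i'
    · rw [hd i' hi x, Finset.smul_sum]
      exact Finset.sum_congr rfl fun j' _ => smul_smul _ _ _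
    · simp [hc i' (not_lt.1 hi)]
  have h3 : ∑ j', MvPolynomial.eval (pt x)
      (MvPolynomial.C s⁻¹ * ((if j' = j then 1 else 0) - ∑ i', c i' * d i' j')) • w j' x =
      s⁻¹ • (w j x - ∑ i', MvPolynomial.eval (pt x) (c i') • b i' x) := by
    rw [h2, smul_sub, Finset.smul_sum]
    simp only [map_mul, MvPolynomial.eval_C, map_sub, map_sum, mul_smul, sub_smul, smul_sub,
      Finset.sum_sub_distrib]
    congr 1
    rw [Finset.sum_eq_single j]
    · simp
    · intro j' _ hj'
      simp [hj']
    · intro h'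
      exact absurd (Finset.mem_univ j) h'
  rw [h3, hw x, add_sub_cancel_right, smul_smul, inv_mul_cancel₀ hs, one_smul]

variable {K V V' : Type u} [Field K] [Quiver.{u} V] [Fintype V] [Quiver.{u} V'] [Fintype V']
variable {I : Ideal (PathAlgebra K V)} [I.IsTwoSided]
variable {I' : Ideal (PathAlgebra K V')} [I'.IsTwoSided]

/-- The coefficients produced by reduction are polynomials in the point, chosen once for all points
of `V_p`. -/
lemma PointModule.exists_smul_top_eq (hI : PathAlgebra.IsAdmissible I) {a b : V}
    (p : Quiver.Path a b) {n : ℕ} {r : PathAlgebra K V ⧸ I} (hr : r ∈ longSpan I n) :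
    ∃ c : (Σ d, RightSubpathsTo p d) → MvPolynomial (DetourVar p) K,
      (∀ i, i.2.1.length < n → c i = 0) ∧ ∀ (k : DetourVar p → K) (hk : k ∈ pathVariety I p),
        r • PointModule.top hk =
          ∑ i, MvPolynomial.eval k (c i) • pathElt I i.2.1 • PointModule.top hk := by
  refine longSpan_induction (P := fun r => ∃ c : (Σ d, RightSubpathsTo p d) →
    MvPolynomial (DetourVar p) K, (∀ i, i.2.1.length < n → c i = 0) ∧
      ∀ (k : DetourVar p → K) (hk : k ∈ pathVariety I p), r • PointModule.top hk =
        ∑ i, MvPolynomial.eval k (c i) • pathElt I i.2.1 • PointModule.top hk) ?_ ?_ ?_ ?_ hr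
  · intro a' d' q hq
    refine ⟨fun i => reduceLin K p i.2 (PathAlgebra.ofPath K q), fun i hi => ?_, fun k hk => ?_⟩
    · by_cases h : a' = a ∧ d' = i.1
      · obtain ⟨d, v⟩ := i
        obtain ⟨rfl, rfl⟩ := h
        exact (reduceLin_ofPath p v q).trans
          (reducePath_of_length_lt q v (lt_of_lt_of_le hi hq))
      · exact reduceLin_ofPath_of_ne _ _ _ h
    · rw [Fintype.sum_sigma]
      exact (PointModule.isCoord hk).mk_smul_eq (PointModule.isFrame hk hI).vertex _
  · exact ⟨0, fun _ _ => rfl, fun k hk => by simp⟩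
  · rintro x y ⟨c, hc, hc'⟩ ⟨d, hd, hd'⟩
    refine ⟨c + d, fun i hi => by rw [Pi.add_apply, hc i hi, hd i hi, add_zero], fun k hk => ?_⟩
    rw [add_smul, hc', hd', ← Finset.sum_add_distrib]
    exact Finset.sum_congr rfl fun i _ => by rw [Pi.add_apply, map_add, add_smul]
  · rintro s x ⟨c, hc, hc'⟩
    refine ⟨fun i => MvPolynomial.C s * c i, fun i hi => by simp [hc i hi], fun k hk => ?_⟩
    rw [smul_assoc, hc', Finset.smul_sum]
    exact Finset.sum_congr rfl fun i _ => by rw [map_mul, MvPolynomial.eval_C, mul_smul]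

variable {hI : PathAlgebra.IsAdmissible I} {hI' : PathAlgebra.IsAdmissible I'}
variable {φ : (PathAlgebra K V ⧸ I) ≃ₐ[K] (PathAlgebra K V' ⧸ I')}
variable {a b : V} {a' b' : V'} {p : Quiver.Path a b} {p' : Quiver.Path a' b'}

/-- The preimages of the right subpaths of `p'` act on the top element as multiples of the `u x` up
to longer terms, so they expand the `u x` with polynomial coefficients. -/
lemma PathCorr.exists_smul_top_eq (h : PathCorr hI hI' φ p p') (r : PathAlgebra K V ⧸ I) :
    ∃ c : (Σ d, RightSubpathsTo p' d) → MvPolynomial (DetourVar p) K,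
      ∀ (k : DetourVar p → K) (hk : k ∈ pathVariety I p), r • PointModule.top hk =
        ∑ i, MvPolynomial.eval k (c i) • φ.symm (pathElt I' i.2.1) • PointModule.top hk := by
  have key := exists_polynomial_combination (X := pathVariety I p) (ι := Σ d, RightSubpathsTo p d)
    (ι' := Σ d, RightSubpathsTo p' d) (E := fun k => PointModule k.2) (fun k => k.1)
    (fun i k => pathElt I i.2.1 • PointModule.top k.2)
    (fun i k => φ.symm (pathElt I' i.2.1) • PointModule.top k.2) (fun i => i.2.1.length)
    (fun i => i.2.2.length_le) (by
      rintro ⟨d, u⟩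
      obtain ⟨d', u', hu', -, -, s, hs, h1⟩ := h.exists_symm u.2
      obtain ⟨c, hc, hc'⟩ := PointModule.exists_smul_top_eq hI p h1
      refine ⟨⟨d', RightSubpathsTo.of u' hu'⟩, s, c, hs, fun i hi => hc i (Nat.lt_succ_of_le hi),
        fun k => ?_⟩
      rw [← hc' k.1 k.2, ← smul_assoc s, ← add_smul, add_sub_cancel]
      rfl)
  choose D hD using key
  obtain ⟨c, -, hc⟩ := PointModule.exists_smul_top_eq hI p (mem_longSpan_zero r)
  refine ⟨fun j => ∑ i, c i * D i j, fun k hk => ?_⟩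
  rw [hc k hk]
  simp_rw [map_sum, Finset.sum_smul]
  rw [Finset.sum_comm]
  refine Finset.sum_congr rfl fun i _ => ?_
  have := hD i ⟨k, hk⟩
  rw [this, Finset.smul_sum]
  exact Finset.sum_congr rfl fun j _ => by rw [map_mul, mul_smul]

/-- The coordinates with respect to `p'` of the modules given by the points of `V_p` are polynomial
functions. -/
lemma PathCorr.exists_polynomial_map (h : PathCorr hI hI' φ p p')
    (hφ : φ (vertexElt I a) = vertexElt I' a') :
    ∃ F : DetourVar p' → MvPolynomial (DetourVar p) K,
      ∀ (k : DetourVar p → K) (hk : k ∈ pathVariety I p),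
        ∃ hk' : (fun w => MvPolynomial.eval k (F w)) ∈ pathVariety I' p',
          ∀ r, r • PointModule.top hk = 0 ↔ φ r • PointModule.top hk' = 0 := by
  choose D hD using h.exists_smul_top_eq
  refine ⟨fun w => D (φ.symm (pathElt I' (w.u.cons w.α)))
    ⟨w.d, RightSubpathsTo.of w.v w.isRightSubpath⟩, fun k hk => ?_⟩
  -- The point module is viewed as a `Λ'`-module through the inverse of `φ`. It is framed by `p'`
  -- with the same top element because `φ` matches the starting vertices exactly.
  let inst : Module (PathAlgebra K V' ⧸ I') (PointModule hk) :=
    Module.compHom (PointModule hk) φ.symm.toAlgHom.toRingHom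
  have hsmul : ∀ (r : PathAlgebra K V' ⧸ I') (m : PointModule hk), r • m = φ.symm r • m :=
    fun _ _ => rfl
  have inst' : IsScalarTower K (PathAlgebra K V' ⧸ I') (PointModule hk) :=
    ⟨fun c r m => by rw [hsmul, hsmul, map_smul, smul_assoc]⟩
  have hφM : ∀ (r : PathAlgebra K V ⧸ I) (m : PointModule hk), φ r • m = r • m := fun r m => by
    rw [hsmul, AlgEquiv.symm_apply_apply]
  have hx : IsFrame I' p' (PointModule.top hk) :=
    (PointModule.isFrame hk hI).transfer hφM hφ h
  obtain ⟨k', hk'⟩ := hx.exists_isCoord (K := K) hI'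
  have h1 : (fun w : DetourVar p' => MvPolynomial.eval k (D (φ.symm (pathElt I' (w.u.cons w.α)))
      ⟨w.d, RightSubpathsTo.of w.v w.isRightSubpath⟩)) = k' := by
    funext w
    have h2 := hD (φ.symm (pathElt I' (w.u.cons w.α))) k hk
    rw [Fintype.sum_sigma] at h2
    -- Multiplication by the end vertex of the arrow removes the terms at other vertices; uniqueness
    -- of coefficients then identifies the polynomial values with the coordinates.
    have h3 := congrArg (fun m => vertexElt I' w.d • m) h2
    have h4 : pathElt I' (w.u.cons w.α) • PointModule.top hk =
        ∑ v : RightSubpathsTo p' w.d, MvPolynomial.eval k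
          (D (φ.symm (pathElt I' (w.u.cons w.α))) ⟨w.d, v⟩) •
            pathElt I' v.1 • PointModule.top hk := by
      simp only [← hsmul, vertexElt_smul_smul] at h3
      rw [h3, Finset.smul_sum, Finset.sum_eq_single w.d]
      · rw [Finset.smul_sum]
        exact Finset.sum_congr rfl fun v _ => by rw [smul_comm_K, vertexElt_smul_smul]
      · intro d _ hd
        rw [Finset.smul_sum]
        refine Finset.sum_eq_zero fun v _ => ?_
        rw [smul_comm_K, vertexElt_smul_of_ne hd.symm (vertexElt_smul_smul _ _), smul_zero]
      · intro h'
        exact absurd (Finset.mem_univ w.d) h'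
    have h5 := hx.coeff_unique hI' (h4.symm.trans
      (hk' _ _ w.α (RightSubpathsTo.of w.u w.isDetour.1)))
    have h6 := congrFun h5 (RightSubpathsTo.of w.v w.isRightSubpath)
    rwa [substCoeff_detourVar, MvPolynomial.eval_X] at h6
  rw [h1]
  refine ⟨hx.coord_mem_pathVariety hI' hk', fun r => ?_⟩
  rw [← hφM]
  exact hx.smul_eq_zero_iff hI' (PointModule.isFrame _ hI') hk' (PointModule.isCoord _) _

/-- The annihilator of the top element contains `α u` minus its substitution at `k`, and coordinates
of a frame are unique. -/
lemma PointModule.eq_of_annihilator_eq (hI : PathAlgebra.IsAdmissible I) {k l : DetourVar p → K}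
    (hk : k ∈ pathVariety I p) (hl : l ∈ pathVariety I p)
    (h : ∀ r : PathAlgebra K V ⧸ I, r • PointModule.top hk = 0 → r • PointModule.top hl = 0) :
    k = l := by
  refine (PointModule.isFrame hl hI).isCoord_unique hI (fun c d α u => ?_) (PointModule.isCoord hl)
  have h1 := h (pathElt I (u.1.cons α) - ∑ v : RightSubpathsTo p d,
    MvPolynomial.eval k (substCoeff K p α u v) • pathElt I v.1) (by
      rw [sub_smul, sub_eq_zero, Finset.sum_smul, PointModule.isCoord hk c d α u]
      exact Finset.sum_congr rfl fun v _ => (smul_assoc _ _ _).symm)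
  rw [sub_smul, sub_eq_zero, Finset.sum_smul] at h1
  rw [h1]
  exact Finset.sum_congr rfl fun v _ => smul_assoc _ _ _

/-- Passing to the other algebra and back preserves the annihilator of the top element, and
therefore the point. -/
lemma PathCorr.affineVarietyIso (h : PathCorr hI hI' φ p p')
    (hφ : φ (vertexElt I a) = vertexElt I' a') :
    AffineVarietyIso (pathVariety I p) (pathVariety I' p') := by
  obtain ⟨F, hF⟩ := h.exists_polynomial_map hφ
  obtain ⟨G, hG⟩ := h.symm.exists_polynomial_map (by rw [← hφ, AlgEquiv.symm_apply_apply])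
  refine ⟨F, G, fun k hk => (hF k hk).1, fun k hk => (hG k hk).1, fun k hk => ?_, fun k hk => ?_⟩
  · obtain ⟨h1, h2⟩ := hF k hk
    obtain ⟨h3, h4⟩ := hG _ h1
    refine (PointModule.eq_of_annihilator_eq hI hk h3 fun r hr => ?_).symm
    have h5 := (h4 _).1 ((h2 r).1 hr)
    rwa [AlgEquiv.symm_apply_apply] at h5
  · obtain ⟨h1, h2⟩ := hG k hk
    obtain ⟨h3, h4⟩ := hF _ h1
    refine (PointModule.eq_of_annihilator_eq hI' hk h3 fun r hr => ?_).symm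
    have h5 := (h4 _).1 ((h2 r).1 hr)
    rwa [AlgEquiv.apply_symm_apply] at h5

end Polynomial

-- Transfer of sequences of simple modules and their varieties

section Sequences

variable {K V V' : Type u} [Field K] [Quiver.{u} V] [Fintype V] [Quiver.{u} V'] [Fintype V']
variable {I : Ideal (PathAlgebra K V)} [I.IsTwoSided]
variable {I' : Ideal (PathAlgebra K V')} [I'.IsTwoSided]
variable {hI : PathAlgebra.IsAdmissible I} {hI' : PathAlgebra.IsAdmissible I'}
variable {φ : (PathAlgebra K V ⧸ I) ≃ₐ[K] (PathAlgebra K V' ⧸ I')}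

/-- Up to an inner automorphism, an isomorphism takes vertices to the corresponding vertices. -/
lemma VertexCorr.exists_conj {a : V} {a' : V'} (ha : VertexCorr hI hI' φ a a') :
    ∃ ψ : (PathAlgebra K V ⧸ I) ≃ₐ[K] (PathAlgebra K V' ⧸ I'),
      (∀ v v', VertexCorr hI hI' ψ v v' ↔ VertexCorr hI hI' φ v v') ∧
        ψ (vertexElt I a) = vertexElt I' a' := by
  set e := vertexElt I' a' with he
  set f := φ (vertexElt I a) with hf
  have hee : e * e = e := vertexElt_mul_self I' a'
  have hff : f * f = f := by rw [hf, ← map_mul, vertexElt_mul_self]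
  -- This element intertwines the idempotents, `f t = f e = t e`, and `t - 1 = (f - e)(2 e - 1)`
  -- lies in the radical, so `t` is a unit conjugating one to the other.
  set t := f * e + (1 - f) * (1 - e) with ht
  have h1 : t - 1 ∈ longSpan I' 1 := by
    have e1 : t - 1 = (f - e) * (e - (1 - e)) := by
      rw [ht]
      have : f * e + (1 - f) * (1 - e) - 1 - (f - e) * (e - (1 - e)) = 2 • (e * e - e) := by
        noncomm_ring
      rw [hee, sub_self, smul_zero, sub_eq_zero] at this
      exact this
    rw [e1]
    exact mul_mem_longSpan (m := 1) (n := 0) ha.map_vertexElt_sub_mem (mem_longSpan_zero _)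
  have h2 : IsUnit t := by
    have := (isNilpotent_of_mem_longSpan hI' h1).isUnit_one_add
    rwa [add_sub_cancel] at this
  obtain ⟨w, hw⟩ := h2
  have h3 : f * t = t * e := by
    have e1 : f * t = f * f * e + (f - f * f) * (1 - e) := by rw [ht]; noncomm_ring
    have e2 : t * e = f * (e * e) + (1 - f) * (e - e * e) := by rw [ht]; noncomm_ring
    rw [e1, e2, hff, hee, sub_self, sub_self, zero_mul, mul_zero]
  let ψ : (PathAlgebra K V ⧸ I) ≃ₐ[K] (PathAlgebra K V' ⧸ I') :=
    φ.trans (MulSemiringAction.toAlgEquiv K (PathAlgebra K V' ⧸ I') (ConjAct.toConjAct w⁻¹))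
  have hψ : ∀ r, ψ r = ↑w⁻¹ * φ r * ↑w := fun r => by
    change ConjAct.toConjAct w⁻¹ • φ r = _
    rw [ConjAct.units_smul_def, ConjAct.ofConjAct_toConjAct, inv_inv]
  refine ⟨ψ, fun v v' => forall_congr' fun r => ?_, ?_⟩
  -- Characters have values in a commutative field, so conjugation does not affect them.
  · have h4 : vertexChar hI' v' (↑w⁻¹) * vertexChar hI' v' ↑w = 1 := by
      rw [← map_mul, Units.inv_mul, map_one]
    rw [hψ, map_mul, map_mul, mul_right_comm, h4, one_mul]
  · rw [hψ, ← hf, mul_assoc, hw, h3, ← hw, Units.inv_mul_cancel_left]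

lemma isSimpleModule_of_semilinear {R R' : Type u} [Ring R] [Ring R'] (φ : R ≃+* R')
    {S S' : Type u} [AddCommGroup S] [Module R S] [AddCommGroup S'] [Module R' S']
    (hS : IsSimpleModule R S) (f : S ≃+ S') (hf : ∀ (r : R) (s : S), f (r • s) = φ r • f s) :
    IsSimpleModule R' S' := by
  let g : S →ₛₗ[(φ : R →+* R')] S' :=
    { f.toAddMonoidHom with map_smul' := hf }
  have : RingHomSurjective (φ : R →+* R') := ⟨φ.surjective⟩
  exact (LinearMap.isSimpleModule_iff_of_bijective g f.bijective).1 hS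

open scoped ModuleCat.Algebra

lemma CorrespondsTo.transfer {S : ModuleCat.{u} (PathAlgebra K V ⧸ I)}
    {S' : ModuleCat.{u} (PathAlgebra K V' ⧸ I')}
    (hS : IsSimpleModule (PathAlgebra K V ⧸ I) S) (f : S ≃+ S')
    (hf : ∀ (r : PathAlgebra K V ⧸ I) (s : S), f (r • s) = φ r • f s) {c : V} {c' : V'}
    (hc : VertexCorr hI hI' φ c c') (h : CorrespondsTo I S c) : CorrespondsTo I' S' c' := by
  obtain ⟨s, hs⟩ := h
  refine ⟨f s, ?_⟩
  have h1 := hf (φ.symm (vertexElt I' c')) s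
  rw [AlgEquiv.apply_symm_apply, simple_smul_eq (K := K) hI hS hs, ← hc, AlgEquiv.apply_symm_apply,
    vertexChar_self, one_smul] at h1
  rw [← h1]
  intro h2
  apply hs
  rw [(AddEquiv.map_eq_zero_iff f).1 h2, smul_zero]

/-- The transfer of a path contributing to `V_S`. -/
lemma exists_seqPaths_iso (hI : PathAlgebra.IsAdmissible I) (hI' : PathAlgebra.IsAdmissible I')
    (φ : (PathAlgebra K V ⧸ I) ≃ₐ[K] (PathAlgebra K V' ⧸ I'))
    (hV' : ∀ c' d' : V', Subsingleton (c' ⟶ d')) {l : ℕ}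
    {S : Fin (l + 1) → ModuleCat.{u} (PathAlgebra K V ⧸ I)}
    {S' : Fin (l + 1) → ModuleCat.{u} (PathAlgebra K V' ⧸ I')}
    (hS : ∀ i, IsSimpleModule (PathAlgebra K V ⧸ I) (S i))
    (h : ∀ i, ∃ f : S i ≃+ S' i, ∀ (r : PathAlgebra K V ⧸ I) (s : S i), f (r • s) = φ r • f s)
    (P : SeqPaths I S) : ∃ P' : SeqPaths I' S',
      AffineVarietyIso (pathVariety I P.1.2.2) (pathVariety I' P'.1.2.2) := by
  obtain ⟨⟨a, b, p⟩, hp, hp'⟩ := P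
  obtain ⟨a', ha⟩ := exists_vertexCorr hI hI' φ a
  -- Conjugation keeps the correspondence of vertices and makes the image of the starting vertex
  -- equal to a vertex, not merely congruent to one modulo the radical.
  obtain ⟨ψ, h1, h2⟩ := ha.exists_conj
  obtain ⟨b', p', h3⟩ := ((h1 a a').2 ha).exists_pathCorr hV' p
  refine ⟨⟨⟨a', b', p'⟩, h3.1.trans hp, fun i => ?_⟩, h3.affineVarietyIso h2⟩
  obtain ⟨c, u, hu, hui, huS⟩ := hp' i
  obtain ⟨c', u', h4, h5, h6, -⟩ := h3.2 c u hu
  obtain ⟨f, hf⟩ := h i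
  exact ⟨c', u', h4, h5.trans hui, huS.transfer (hS i) f hf ((h1 c c').1 h6)⟩

lemma ConditionN.exists_seqPaths_equiv (hN : ConditionN I) (hI : PathAlgebra.IsAdmissible I)
    (hI' : PathAlgebra.IsAdmissible I') (φ : (PathAlgebra K V ⧸ I) ≃ₐ[K] (PathAlgebra K V' ⧸ I'))
    {l : ℕ} {S : Fin (l + 1) → ModuleCat.{u} (PathAlgebra K V ⧸ I)}
    {S' : Fin (l + 1) → ModuleCat.{u} (PathAlgebra K V' ⧸ I')}
    (hS : ∀ i, IsSimpleModule (PathAlgebra K V ⧸ I) (S i))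
    (h : ∀ i, ∃ f : S i ≃+ S' i, ∀ (r : PathAlgebra K V ⧸ I) (s : S i), f (r • s) = φ r • f s) :
    ∃ σ : SeqPaths I S ≃ SeqPaths I' S', ∀ x : SeqPaths I S,
      AffineVarietyIso (pathVariety I x.1.2.2) (pathVariety I' (σ x).1.2.2) := by
  have hV := hN.subsingleton hI
  have hV' := subsingleton_of_algEquiv hI' hI φ.symm hV
  have hS' : ∀ i, IsSimpleModule (PathAlgebra K V' ⧸ I') (S' i) := fun i => by
    obtain ⟨f, hf⟩ := h i
    exact isSimpleModule_of_semilinear φ.toRingEquiv (hS i) f hf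
  have h' : ∀ i, ∃ f : S' i ≃+ S i, ∀ (r : PathAlgebra K V' ⧸ I') (s : S' i),
      f (r • s) = φ.symm r • f s := fun i => by
    obtain ⟨f, hf⟩ := h i
    refine ⟨f.symm, fun r s => f.injective ?_⟩
    rw [hf, AddEquiv.apply_symm_apply, AddEquiv.apply_symm_apply, AlgEquiv.apply_symm_apply]
  have := subsingleton_seqPaths hI hV S hS
  have := subsingleton_seqPaths hI' hV' S' hS'
  have key := exists_seqPaths_iso hI hI' φ hV' hS h
  choose F hF using key
  choose G hG using exists_seqPaths_iso hI' hI φ.symm hV hS' h'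
  -- At most one path contributes on either side, so maps in both directions already form a
  -- bijection.
  exact ⟨equivOfSubsingletonOfSubsingleton F G, hF⟩

end Sequences

end

theorem theorem3p3 {K V : Type u} [Field K] [Infinite K] [Quiver.{u} V] [Fintype V]
    [∀ a b : V, Finite (a ⟶ b)] (I : Ideal (PathAlgebra K V)) [I.IsTwoSided]
    (hI : PathAlgebra.IsAdmissible I) :
    -- (I)
    (FiniteUniserialType (PathAlgebra K V ⧸ I) → ConditionN I) ∧
    -- (II)
    (ConditionN I →
      -- (a)
      ((∀ a b : V, Subsingleton (a ⟶ b)) ∧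
        (∀ U : ModuleCat.{u} (PathAlgebra K V ⧸ I), IsUniserial (PathAlgebra K V ⧸ I) U →
          ∃! x : AllPaths V, IsMastOf I x.2.2 U) ∧
        (∀ (l : ℕ) (S : Fin (l + 1) → ModuleCat.{u} (PathAlgebra K V ⧸ I)),
          (∀ i, IsSimpleModule (PathAlgebra K V ⧸ I) (S i)) → Subsingleton (SeqPaths I S)) ∧
        (∀ (V' : Type u) [Quiver.{u} V'] [Fintype V'] [∀ a b : V', Finite (a ⟶ b)]
          (I' : Ideal (PathAlgebra K V')) [I'.IsTwoSided] (_ : PathAlgebra.IsAdmissible I')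
          (φ : (PathAlgebra K V ⧸ I) ≃ₐ[K] (PathAlgebra K V' ⧸ I')) (l : ℕ)
          (S : Fin (l + 1) → ModuleCat.{u} (PathAlgebra K V ⧸ I))
          (S' : Fin (l + 1) → ModuleCat.{u} (PathAlgebra K V' ⧸ I')),
          (∀ i, IsSimpleModule (PathAlgebra K V ⧸ I) (S i)) →
          (∀ i, ∃ f : S i ≃+ S' i, ∀ (r : PathAlgebra K V ⧸ I) (s : S i), f (r • s) = φ r • f s) →
          ∃ σ : SeqPaths I S ≃ SeqPaths I' S', ∀ x : SeqPaths I S,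
            AffineVarietyIso (pathVariety I x.1.2.2) (pathVariety I' (σ x).1.2.2))) ∧
      -- (b)
      ((∀ (a b c d : V) (p : Quiver.Path a b) (α : c ⟶ d) (u : Quiver.Path a c),
          IsHalyard I p α u → IsCircularHalyard I p α u) ∧
        (∀ (l : ℕ) (S : Fin (l + 1) → ModuleCat.{u} (PathAlgebra K V ⧸ I)),
          (∀ i, IsSimpleModule (PathAlgebra K V ⧸ I) (S i)) →
          (∀ i j, i ≠ j → IsEmpty (S i ≃ₗ[PathAlgebra K V ⧸ I] S j)) →
          ∀ U U' : ModuleCat.{u} (PathAlgebra K V ⧸ I), HasCompSeries S U → HasCompSeries S U' →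
            Nonempty (U ≃ₗ[PathAlgebra K V ⧸ I] U'))) ∧
      -- (c)
      ((∀ (e : V) (γ : e ⟶ e) (p : Quiver.Path e e), IsMast I p → ∃ m : ℕ, p = loopPow γ m) ∧
        (∀ S : ModuleCat.{u} (PathAlgebra K V ⧸ I), IsSimpleModule (PathAlgebra K V ⧸ I) S →
          ((∃ W : ModuleCat.{u} (PathAlgebra K V ⧸ I), IsUniserial (PathAlgebra K V ⧸ I) W ∧
              Module.length (PathAlgebra K V ⧸ I) W = 2 ∧ HasTop W S ∧ HasSocle W S) ↔
            Nontrivial (CategoryTheory.Abelian.Ext.{u} S S 1)) ∧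
          (∀ W : ModuleCat.{u} (PathAlgebra K V ⧸ I), IsUniserial (PathAlgebra K V ⧸ I) W →
            Module.length (PathAlgebra K V ⧸ I) W = 2 → HasTop W S → HasSocle W S →
            ∀ (l : ℕ) (U : ModuleCat.{u} (PathAlgebra K V ⧸ I)), 2 ≤ l →
              IsUniserial (PathAlgebra K V ⧸ I) U → Module.length (PathAlgebra K V ⧸ I) U = l →
              HasTop U S → HasSocle U S →
              ∀ i : ℕ, i + 2 ≤ l →
                Nonempty (RadLayer (PathAlgebra K V ⧸ I) U i (i + 2)
                  ≃ₗ[PathAlgebra K V ⧸ I] W)))) ∧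
      -- (d)
      (∀ (l : ℕ) (S : Fin (l + 1 + 1) → ModuleCat.{u} (PathAlgebra K V ⧸ I)),
        (∀ i, IsSimpleModule (PathAlgebra K V ⧸ I) (S i)) →
        Finite (SeqVariety I fun i : Fin (l + 1) => S i.succ) →
        FinitelyManyUpToIso fun U : ModuleCat.{u} (PathAlgebra K V ⧸ I) =>
          HasCompSeries S U)) := by
  refine ⟨conditionN_of_finiteUniserialType hI, fun hN => ⟨⟨hN.subsingleton hI, fun U hU =>
    existsUnique_mast hI (hN.subsingleton hI) hU, fun l S hS =>
    subsingleton_seqPaths hI (hN.subsingleton hI) S hS, ?_⟩, ⟨?_, ?_⟩, ⟨?_, fun S hS => ⟨?_, ?_⟩⟩, ?_⟩⟩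
  · intro V' _ _ _ I' _ hI' φ l S S' hS h
    exact hN.exists_seqPaths_equiv hI hI' φ hS h
  · intro a b c d p α u h
    exact hN.isCircularHalyard hI h
  · intro l S hS hS' U U' hU hU'
    exact hN.nonempty_equiv_of_distinct hI hS hS' hU hU'
  · intro e γ p hp
    exact hN.exists_eq_loopPow hI γ p hp
  · exact exists_isUniserial_iff_nontrivial_ext hI hS
  · intro W hW hW2 hWt hWs l U _ hU hUl hUt hUs i hi
    exact hN.nonempty_radLayer_equiv hI hS hW hW2 hWt hWs hU hUl hUt hUs hi
  · intro l S hS hfin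
    exact hN.finitelyManyUpToIso hI hS hfin
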